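/- **The algorithm.** Let $X$ be a set of $n\ge1$ items with keys in a totally ordered set (keys of different items may be equal; items are compared through their keys) and let $1\le k\le n$. Fix constants $\alpha\in(0,1/2]$, $r>1$, $\kappa:=1/r$ and $\beta$. The randomized algorithm $\mathrm{SELECT}(X,k)$ is the following. If $n=1$, return the only item. Otherwise put $\theta:=k/n$; let $s_1\le\dots\le s_{\bar l}<s_{\bar l+1}=n$ be sample sizes depending only on $n$ (specified below), let $g_l\ge0$ $(l\le\bar l)$ be gaps (specified below), $g_{\bar l+1}:=0$, and $$i_u^l:=\max\{\lceil\theta s_l-g_l\rceil,1\},\qquad i_v^l:=\min\{\lceil\theta s_l+g_l\rceil,s_l\}.$$ Draw a uniformly random subset $S_1\subset X$ of size $s_1$ and set $u_1:=\mathrm{SELECT}(S_1,i_u^1)$, $v_1:=\mathrm{SELECT}(S_1,i_v^1)$. For $l=1,\dots,\bar l$: 1. add to $S_l$ a uniformly random set of $s_{l+1}-s_l$ items of $X\setminus S_l$ to get $S_{l+1}$; 2. compare each $x\in S_{l+1}\setminus S_l$ with $u:=u_l$ and $v:=v_l$ (if $\theta<1/2$, first with $v$, and with $u$ only if $x<v$;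 if $\theta\ge1/2$, first with $u$, and with $v$ only if $x>u$), which splits $S_{l+1}$ into $L=\{x<u\}$, $U=\{x=u\}$, $M=\{u<x<v\}$, $V=\{x=v\}$, $R=\{x>v\}$; 3. find the $i_u^{l+1}$th smallest item $u_{l+1}$ of $S_{l+1}$: it is $u$ if $|L|<i_u^{l+1}\le|L\cup U|$, it is $v$ if $|L\cup U\cup M|<i_u^{l+1}\le s_{l+1}-|R|$, and otherwise it is found by a recursive call of SELECT on that one of $L,M,R$ which contains it, with the index shifted accordingly; find $v_{l+1}$ in the same way, with $i_v^{l+1}$ instead of $i_u^{l+1}$. Return $u_{\bar l+1}$. All calls use independent randomness. **Sample sizes.** One of the following three rules is used for all inputs of size $n\ge2$. * (Nonrounded sizes) $s_l=r^{2(l-1)}n^\alpha$ for $l\le\bar l$, where $\bar l$ is the least integer with $r^{2\bar l}n^\alpha\ge n$; sizes that are not integers are replaced by one of the two adjacent integers, in any way that keeps $s_1\le\dots\le s_{\bar l}<n$. * (Rounded sizes) $r^2$ is an integer, $s_1=\min\{\lceil n^\alpha\rceil,n-1\}$, $\bar l=\min\{l:r^{2l}s_1\ge n\}$, $s_{l+1}=\min\{r^{2l}s_1,n\}$.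 * (Reduced rounded sizes) $r^2$ is an integer, $\bar\eta\in(1/r^2,1]$ is a constant; if $n\ge\max\{[r^2/(\bar\eta r^2-1)]^{1/\alpha},3\}$, then $\bar l=\min\{l:r^{2l}n^\alpha\ge n\}$, $s_1=\lceil n/r^{2\bar l}\rceil$, $s_{l+1}=\min\{r^{2l}s_1,n\}$; for all other $n$ the rounded sizes are used. **Gaps.** Either $g_l=(\beta s_l\ln n)^{1/2}$ for $l\le\bar l$, with $\beta\ge\frac14(1-\kappa)^{-2}$; or $g_l=(\beta s_l\ln s_l)^{1/2}$ for $l\le\bar l$, with $\beta>\frac14(1-\kappa)^{-2}$. **Cut-off (optional).** For a constant $n_{\rm cut}\ge0$, calls with $2\le|X|\le n_{\rm cut}$ are instead handled by an arbitrary, possibly randomized, routine that finds the $k$th smallest item (with probability one) with an expected number of at most $C_{\rm cut}<\infty$ comparisons. ($n_{\rm cut}=0$ means no cut-off.) **Theorem 4.1.** There is a constant $\gamma>0$, depending only on $\alpha,r,\beta,\bar\eta,n_{\rm cut},C_{\rm cut}$, such that for each of these versions of SELECT, for all $1\le k\le n$ and every input $X$ of $n$ (not necessarily distinct) elements, the expected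 number $C_{nk}$ of comparisons made by $\mathrm{SELECT}(X,k)$ satisfies $$C_{nk}\le n+\min\{k,n-k\}+\gamma\,(n\ln n)^{1/2}.$$ -/

import Mathlib

open scoped ENNReal

noncomputable section

namespace FloydRivest

/-! ### Randomized computations with a comparison count -/

/-- A randomized computation with result in `A`: a probability distribution on pairs
(result, number of comparisons made). The outcome `none` is a run that does not terminate
properly; it is charged infinitely many comparisons. -/
def Run (A : Type) : Type := PMF (Option (A × ℕ))

namespace Run

/-- Return `a` without making comparisons. -/
def ret {A : Type} (a : A) : Run A := PMF.pure (some (a, 0))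

/-- A run that does not terminate. -/
def diverge {A : Type} : Run A := PMF.pure none

/-- Make `c` comparisons. -/
def tick (c : ℕ) : Run Unit := PMF.pure (some ((), c))

/-- Run `m`, then `f` (with fresh randomness) on its result; the comparison counts add up. -/
def bind {A B : Type} (m : Run A) (f : A → Run B) : Run B :=
  PMF.bind m fun o =>
    match o with
    | none => PMF.pure none
    | some (a, c) => PMF.map (Option.map fun p => (p.1, c + p.2)) (f a)

/-- Draw a subset of `X` of size `s`, uniformly at random. -/
def sample {ι : Type} (X : Finset ι) (s : ℕ) : Run (Finset ι) :=
  if h : (X.powersetCard s).Nonempty then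
    PMF.map (fun S => some (S, 0)) (PMF.uniformOfFinset (X.powersetCard s) h)
  else diverge

/-- The number of comparisons in an outcome. -/
def cost {A : Type} : Option (A × ℕ) → ℝ≥0∞
  | none => ⊤
  | some p => (p.2 : ℝ≥0∞)

/-- The expected number of comparisons. -/
def expectedComparisons {A : Type} (m : Run A) : ℝ≥0∞ :=
  ∑' o, (show PMF (Option (A × ℕ)) from m) o * cost o

/-- With probability one the computation ends with a result satisfying `P`. -/
def AlmostSurely {A : Type} (m : Run A) (P : A → Prop) : Prop :=
  ∀ o ∈ (show PMF (Option (A × ℕ)) from m).support, ∃ a c, o = some (a, c) ∧ P a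

end Run

/-! ### Sample sizes and gaps -/

/-- The sample sizes used on an input of a given size: the number `lbar` of iterations, and the
sizes `s 1, …, s lbar, s (lbar + 1)` of the nested samples. -/
structure Plan where
  lbar : ℕ
  s : ℕ → ℕ

/-- The sample sizes `r ^ (2 (l - 1)) n ^ α` for inputs of size `n`, with each of them that is
not an integer replaced by one of the two adjacent integers. The number `lbar` is the least
number with `n ≤ r ^ (2 lbar) n ^ α`, so that `n = r ^ (2 lbar) n ^ α` if this is possible. -/
structure NonroundedSizes (α r : ℝ) (n : ℕ) (p : Plan) : Prop where
  lbar_least : IsLeast {l : ℕ | (n : ℝ) ≤ r ^ (2 * l) * (n : ℝ) ^ α} p.lbar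
  size : ∀ l, 1 ≤ l → l ≤ p.lbar →
    p.s l = ⌊r ^ (2 * (l - 1)) * (n : ℝ) ^ α⌋₊ ∨ p.s l = ⌈r ^ (2 * (l - 1)) * (n : ℝ) ^ α⌉₊
  lt : ∀ l, 1 ≤ l → l ≤ p.lbar → p.s l < n
  mono : ∀ l, 1 ≤ l → l ≤ p.lbar → p.s l ≤ p.s (l + 1)
  last : p.s (p.lbar + 1) = n

/-- The rounded sample sizes: `s 1 = min (⌈n ^ α⌉, n - 1)` and
`s (l + 1) = min (r ^ (2 l) s 1, n)`, where `r ^ 2` is an integer. -/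
structure RoundedSizes (α r : ℝ) (n : ℕ) (p : Plan) : Prop where
  sq_int : ∃ q : ℕ, (q : ℝ) = r ^ 2
  first : p.s 1 = min ⌈(n : ℝ) ^ α⌉₊ (n - 1)
  lbar_least : IsLeast {l : ℕ | (n : ℝ) ≤ r ^ (2 * l) * (p.s 1 : ℝ)} p.lbar
  step : ∀ l, 1 ≤ l → l ≤ p.lbar →
    (p.s (l + 1) : ℝ) = min (r ^ (2 * l) * (p.s 1 : ℝ)) (n : ℝ)

/-- The rounded sample sizes with `lbar` least such that `n ≤ r ^ (2 lbar) n ^ α` and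
`s 1 = ⌈n / r ^ (2 lbar)⌉`, which make `s lbar` small relative to `n`. -/
structure ReducedSizes (α r : ℝ) (n : ℕ) (p : Plan) : Prop where
  sq_int : ∃ q : ℕ, (q : ℝ) = r ^ 2
  lbar_least : IsLeast {l : ℕ | (n : ℝ) ≤ r ^ (2 * l) * (n : ℝ) ^ α} p.lbar
  first : p.s 1 = ⌈(n : ℝ) / r ^ (2 * p.lbar)⌉₊
  step : ∀ l, 1 ≤ l → l ≤ p.lbar →
    (p.s (l + 1) : ℝ) = min (r ^ (2 * l) * (p.s 1 : ℝ)) (n : ℝ)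

/-- The reduced sizes for all `n` above the threshold determined by `η`, and the rounded sizes
for the other `n`. -/
def ReducedRoundedSizes (α r η : ℝ) (n : ℕ) (p : Plan) : Prop :=
  (max ((r ^ 2 / (η * r ^ 2 - 1)) ^ (1 / α)) 3 ≤ (n : ℝ) → ReducedSizes α r n p) ∧
  ((n : ℝ) < max ((r ^ 2 / (η * r ^ 2 - 1)) ^ (1 / α)) 3 → RoundedSizes α r n p)

/-- The gap `(β s ln n) ^ (1/2)` for a sample of size `s` from an input of size `n`. -/
def gapN (β : ℝ) (n s : ℕ) : ℝ := √(β * s * Real.log n)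

/-- The smaller gap `(β s ln s) ^ (1/2)`. -/
def gapS (β : ℝ) (_n s : ℕ) : ℝ := √(β * s * Real.log s)

/-- The gap `g_l` at iteration `l`; it is `0` for the final sample. -/
def gapAt (gap : ℕ → ℕ → ℝ) (n : ℕ) (p : Plan) (l : ℕ) : ℝ :=
  if l ≤ p.lbar then gap n (p.s l) else 0

/-- The lower pivot index `max {⌈θ s_l - g_l⌉, 1}`, where `θ = k / n`. -/
def iu (gap : ℕ → ℕ → ℝ) (n k : ℕ) (p : Plan) (l : ℕ) : ℕ :=
  max ⌈(k : ℝ) / n * p.s l - gapAt gap n p l⌉₊ 1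

/-- The upper pivot index `min {⌈θ s_l + g_l⌉, s_l}`, where `θ = k / n`. -/
def iv (gap : ℕ → ℕ → ℝ) (n k : ℕ) (p : Plan) (l : ℕ) : ℕ :=
  min ⌈(k : ℝ) / n * p.s l + gapAt gap n p l⌉₊ (p.s l)

/-! ### The algorithm

The input is a finite set of items `ι`; the item `z` has the key `key z` in a linear order, and
different items may have equal keys. -/

variable {ι : Type} {T : Type*} [DecidableEq ι] [LinearOrder T]

/-- The number of comparisons for partitioning the items of `D` by the pivots `u` and `v`. If
`θ < 1/2`, an item is compared to `v` first, and to `u` only if it is below `v`; otherwise it is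
compared to `u` first, and to `v` only if it is above `u`. -/
def partitionCost (key : ι → T) (θ : ℝ) (u v : ι) (D : Finset ι) : ℕ :=
  ∑ z ∈ D,
    if θ < 1 / 2 then (if key z < key v then 2 else 1)
    else (if key u < key z then 2 else 1)

/-- Find the `i`th smallest item of `S`, which has been partitioned by the pivots `u` and `v`,
by recursive selection `rec` from one of the parts if it is not one of the pivots. -/
def findPivot (key : ι → T) (rec : Finset ι → ℕ → Run ι) (S : Finset ι) (u v : ι) (i : ℕ) :
    Run ι :=
  let L := {z ∈ S | key z < key u}
  let U := {z ∈ S | key z = key u}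
  let M := {z ∈ S | key u < key z ∧ key z < key v}
  let R := {z ∈ S | key v < key z}
  if L.card < i ∧ i ≤ (L ∪ U).card then Run.ret u
  else if (L ∪ U ∪ M).card < i ∧ i ≤ S.card - R.card then Run.ret v
  else if i ≤ L.card then rec L i
  else if S.card - R.card < i then rec R (i - (S.card - R.card))
  else rec M (i - (L ∪ U).card)

/-- The remaining `m` iterations, starting from iteration `l` with the sample `S` and the pivots
`u` and `v`: enlarge the sample, partition it, and find the new pivots. -/
def iterations (key : ι → T) (gap : ℕ → ℕ → ℝ) (p : Plan) (rec : Finset ι → ℕ → Run ι)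
    (X : Finset ι) (k : ℕ) : (m l : ℕ) → (S : Finset ι) → (u v : ι) → Run ι
  | 0, _, _, u, _ => Run.ret u
  | m + 1, l, S, u, v =>
    (Run.sample (X \ S) (p.s (l + 1) - p.s l)).bind fun D =>
    (Run.tick (partitionCost key ((k : ℝ) / X.card) u v D)).bind fun _ =>
    (findPivot key rec (S ∪ D) u v (iu gap X.card k p (l + 1))).bind fun u' =>
    (findPivot key rec (S ∪ D) u v (iv gap X.card k p (l + 1))).bind fun v' =>
    iterations key gap p rec X k m (l + 1) (S ∪ D) u' v'

/-- The algorithm, for the selection of the `k`th smallest item of `X`. It uses the sample sizes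
`plan n` for inputs of size `n`, and the routine `small` for inputs of sizes `2, …, ncut`; thus
`ncut = 0` gives the version without a cut-off. All recursive calls are for smaller sets (a call
for a set that is not smaller would not terminate). -/
def select (key : ι → T) (plan : ℕ → Plan) (gap : ℕ → ℕ → ℝ) (ncut : ℕ)
    (small : Finset ι → ℕ → Run ι) (X : Finset ι) (k : ℕ) : Run ι :=
  if h1 : X.card = 1 then Run.ret (Finset.card_eq_one.mp h1).choose
  else if X.card ≤ ncut then small X k
  else
    let p := plan X.card
    let rec' : Finset ι → ℕ → Run ι := fun Y i =>
      if _h : Y.card < X.card then select key plan gap ncut small Y i else Run.diverge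
    (Run.sample X (p.s 1)).bind fun S =>
    (rec' S (iu gap X.card k p 1)).bind fun u =>
    (rec' S (iv gap X.card k p 1)).bind fun v =>
    iterations key gap p rec' X k p.lbar 1 S u v
termination_by X.card

/-- The item `y` is an `i`th smallest item of `Y`. -/
def IsKthSmallest (key : ι → T) (Y : Finset ι) (i : ℕ) (y : ι) : Prop :=
  y ∈ Y ∧ {z ∈ Y | key z < key y}.card < i ∧ i ≤ {z ∈ Y | key z ≤ key y}.card

/-- A (possibly randomized) routine that finds the `i`th smallest item of each set of at most
`ncut` items with an expected number of at most `Ccut` comparisons. -/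
def IsSmallSelect (key : ι → T) (ncut : ℕ) (Ccut : ℝ) (small : Finset ι → ℕ → Run ι) : Prop :=
  ∀ (Y : Finset ι) (i : ℕ), 2 ≤ Y.card → Y.card ≤ ncut → 1 ≤ i → i ≤ Y.card →
    (small Y i).AlmostSurely (IsKthSmallest key Y i) ∧
    (small Y i).expectedComparisons ≤ ENNReal.ofReal Ccut

end FloydRivest

end

/-!
Write `θ = k / n`, `t = s (l + 1)` and `s = s l`. The bound comes from a recursion for the expected
cost and an induction on the input size.

*Recursion.* The cost of an iteration depends only on the sample `S` before it and the sample
`W ⊇ S` after it, because the pivots are order statistics of `S` and the partition depends only on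
their keys. As `W` is a uniform subset of the input and `S` a uniform subset of `W`
(`sum_powersetCard_sdiff`), it suffices to bound the average of this cost over the `s`-subsets `S`
of each fixed `t`-set `W` (`select_spec`).

*Partitioning.* Given `S ∪ {z}`, each of its items is equally likely to be the new item `z`, so `z`
is below the `i`th smallest item of `S` with probability at most `i / (s + 1)`
(`sum_card_filter_sdiff_le`). With `i ≤ θ s + g + 1` for the upper pivot, the second comparisons
cost at most `(t - s) θ + O(g + 1)` if `θ < 1 / 2`, and symmetrically `(t - s) (1 - θ) + O(g + 1)`
otherwise. All partitions together cost `n + min (k, n - k) + O(∑ g)`, and `∑ g = O(√(n ln n))`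
because the sample sizes grow geometrically.

*Selection of the new pivots.* If a new pivot is between the old ones, it is selected from the
middle part, whose expected size is `O(g + 1)`. Otherwise `S` contains far too many or too few of
the smallest items of `W`. Hoeffding's bound for sampling without replacement
(`card_filter_le_card_inter_le`) and the lower bound for `β` make the probability of this event
`O(1 / √s)` (`gapN_tail`, `gapS_tail`), so that its contribution is `O(√s)`. If the index of a pivot
is truncated to `1` or to `s`, the bound is not available, but then the outer part in question is
of expected size `O(1)`.

*Induction.* Let a selection from `m` items cost `3 / 2 m + γ √(m ln m)`. The recursive calls then
contribute terms without `γ` of order `√(n ln n)`, and terms with `γ` that are at most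
`3 / 4 γ √(n ln n)` for large `n`, after the square root is replaced by a linear bound
(`costBound_le_linear`) in which the size of the middle part is averaged. Thus the induction closes
for large `γ` (`select_spec_of_goodPlan`). Inputs of bounded size are covered by a crude bound
(`exists_select_bound`).
-/

namespace FloydRivest

/-! ### Expected costs of randomized computations -/

/-- The expectation of `f` under the distribution `p`. -/
noncomputable def expect {A : Type*} (p : PMF A) (f : A → ℝ≥0∞) : ℝ≥0∞ := ∑' a, p a * f a

theorem expect_pure {A : Type*} (a : A) (f : A → ℝ≥0∞) : expect (PMF.pure a) f = f a := by
  unfold expect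
  rw [tsum_eq_single a]
  · simp
  · intro b hb
    simp [hb]

theorem expect_bind {A B : Type*} (p : PMF A) (q : A → PMF B) (f : B → ℝ≥0∞) :
    expect (p.bind q) f = expect p fun a => expect (q a) f := by
  simp only [expect, PMF.bind_apply, ← ENNReal.tsum_mul_right, ← ENNReal.tsum_mul_left]
  rw [ENNReal.tsum_comm]
  simp only [mul_assoc]

theorem expect_map {A B : Type*} (g : A → B) (p : PMF A) (f : B → ℝ≥0∞) :
    expect (p.map g) f = expect p (f ∘ g) := by
  rw [PMF.map, expect_bind]
  simp [expect_pure, Function.comp_def]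

theorem expect_mono {A : Type*} (p : PMF A) {f g : A → ℝ≥0∞}
    (h : ∀ a ∈ p.support, f a ≤ g a) : expect p f ≤ expect p g := by
  refine ENNReal.tsum_le_tsum fun a => ?_
  by_cases ha : p a = 0
  · simp [ha]
  · exact mul_le_mul_right (h a ((PMF.mem_support_iff _ _).2 ha)) _

theorem expect_add_const {A : Type*} (p : PMF A) (f : A → ℝ≥0∞) (c : ℝ≥0∞) :
    (expect p fun a => f a + c) = expect p f + c := by
  simp only [expect, mul_add, ENNReal.tsum_add, ENNReal.tsum_mul_right, PMF.tsum_coe, one_mul]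

theorem expect_uniformOfFinset {A : Type*} (s : Finset A) (hs : s.Nonempty) (f : A → ℝ≥0∞) :
    expect (PMF.uniformOfFinset s hs) f = (∑ a ∈ s, f a) / s.card := by
  unfold expect
  rw [tsum_eq_sum (s := s)]
  · rw [ENNReal.div_eq_inv_mul, Finset.mul_sum]
    refine Finset.sum_congr rfl fun a ha => ?_
    rw [PMF.uniformOfFinset_apply_of_mem hs ha]
  · intro b hb
    rw [PMF.uniformOfFinset_apply_of_notMem hs hb, zero_mul]

namespace Run

variable {A B : Type}

/-- The charge for an outcome: its comparisons, and `φ` of its result. -/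
def charge (φ : A → ℝ≥0∞) : Option (A × ℕ) → ℝ≥0∞
  | none => ⊤
  | some p => (p.2 : ℝ≥0∞) + φ p.1

/-- The expected number of comparisons of a run, plus the expected cost `φ` of continuing from
its result. With this continuation-passing form, sequencing of runs is composition. -/
noncomputable def costThen (m : Run A) (φ : A → ℝ≥0∞) : ℝ≥0∞ :=
  expect (show PMF (Option (A × ℕ)) from m) (charge φ)

theorem expectedComparisons_eq_costThen (m : Run A) :
    m.expectedComparisons = m.costThen fun _ => 0 := by
  unfold expectedComparisons costThen expect
  refine tsum_congr fun o => ?_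
  cases o <;> simp [charge, cost]

theorem costThen_bind (m : Run A) (f : A → Run B) (φ : B → ℝ≥0∞) :
    (m.bind f).costThen φ = m.costThen fun a => (f a).costThen φ := by
  unfold costThen Run.bind
  refine (expect_bind (A := Option (A × ℕ)) m _ _).trans ?_
  unfold expect
  refine tsum_congr fun o => ?_
  congr 1
  rcases o with _ | ⟨a, c⟩
  · exact expect_pure _ _
  · refine (expect_map _ _ _).trans ?_
    have h : (charge φ ∘ Option.map fun p : B × ℕ => (p.1, c + p.2)) =
        fun o => charge φ o + (c : ℝ≥0∞) := by
      funext o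
      rcases o with _ | ⟨b, d⟩
      · simp [charge]
      · simp [charge]
        ring
    rw [h]
    refine (expect_add_const _ _ _).trans ?_
    rw [add_comm]
    rfl

theorem costThen_ret (a : A) (φ : A → ℝ≥0∞) : (ret a).costThen φ = φ a := by
  unfold costThen ret
  refine (expect_pure _ _).trans ?_
  simp [charge]

theorem costThen_tick (c : ℕ) (φ : Unit → ℝ≥0∞) : (tick c).costThen φ = c + φ () := by
  unfold costThen tick
  exact expect_pure _ _

theorem costThen_sample {ι : Type} (X : Finset ι) {s : ℕ} (hs : s ≤ X.card)
    (φ : Finset ι → ℝ≥0∞) :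
    (sample X s).costThen φ = (∑ S ∈ X.powersetCard s, φ S) / (X.card.choose s : ℕ) := by
  have h : (X.powersetCard s).Nonempty := Finset.powersetCard_nonempty.2 hs
  have hsample : sample X s =
      PMF.map (fun S => some (S, 0)) (PMF.uniformOfFinset (X.powersetCard s) h) := dif_pos h
  unfold costThen
  rw [hsample]
  refine (expect_map _ _ _).trans ?_
  rw [expect_uniformOfFinset, Finset.card_powersetCard]
  simp [charge]

theorem costThen_mono {m : Run A} {P : A → Prop} (hm : m.AlmostSurely P) {φ ψ : A → ℝ≥0∞}
    (h : ∀ a, P a → φ a ≤ ψ a) : m.costThen φ ≤ m.costThen ψ := by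
  refine expect_mono _ fun o ho => ?_
  obtain ⟨a, c, rfl, ha⟩ := hm o ho
  exact add_le_add_right (h a ha) _

theorem costThen_le {m : Run A} {P : A → Prop} (hm : m.AlmostSurely P) {φ : A → ℝ≥0∞}
    {c : ℝ≥0∞} (h : ∀ a, P a → φ a ≤ c) : m.costThen φ ≤ m.expectedComparisons + c := by
  refine (costThen_mono hm h).trans (le_of_eq ?_)
  rw [expectedComparisons_eq_costThen]
  refine Eq.trans ?_ (expect_add_const _ _ _)
  unfold costThen
  congr 1
  funext o
  cases o <;> simp [charge]

theorem AlmostSurely.mono {m : Run A} {P Q : A → Prop} (hm : m.AlmostSurely P)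
    (h : ∀ a, P a → Q a) : m.AlmostSurely Q := fun o ho => by
  obtain ⟨a, c, rfl, ha⟩ := hm o ho
  exact ⟨a, c, rfl, h a ha⟩

theorem almostSurely_ret {P : A → Prop} {a : A} (h : P a) : (ret a).AlmostSurely P := by
  intro o ho
  have : o = some (a, 0) := by simpa [ret] using ho
  exact ⟨a, 0, this, h⟩

theorem almostSurely_tick (c : ℕ) : (tick c).AlmostSurely fun _ => True := by
  intro o ho
  have : o = some ((), c) := by simpa [tick] using ho
  exact ⟨(), c, this, trivial⟩

theorem almostSurely_sample {ι : Type} (X : Finset ι) {s : ℕ} (hs : s ≤ X.card) :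
    (sample X s).AlmostSurely fun S => S ⊆ X ∧ S.card = s := by
  have h : (X.powersetCard s).Nonempty := Finset.powersetCard_nonempty.2 hs
  have hsample : sample X s =
      PMF.map (fun S => some (S, 0)) (PMF.uniformOfFinset (X.powersetCard s) h) := dif_pos h
  rw [hsample]
  intro o ho
  obtain ⟨S, hS, rfl⟩ := (PMF.mem_support_map_iff _ _ _).1 ho
  rw [PMF.mem_support_uniformOfFinset_iff, Finset.mem_powersetCard] at hS
  exact ⟨S, 0, rfl, hS⟩

theorem AlmostSurely.bind {m : Run A} {P : A → Prop} (hm : m.AlmostSurely P) {f : A → Run B}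
    {Q : B → Prop} (hf : ∀ a, P a → (f a).AlmostSurely Q) : (m.bind f).AlmostSurely Q := by
  intro o ho
  unfold Run.bind at ho
  obtain ⟨o', ho', h⟩ := (PMF.mem_support_bind_iff _ _ _).1 ho
  obtain ⟨a, c, rfl, ha⟩ := hm o' ho'
  obtain ⟨o'', ho'', rfl⟩ := (PMF.mem_support_map_iff _ _ _).1 h
  obtain ⟨b, d, rfl, hb⟩ := hf a ha o'' ho''
  exact ⟨b, c + d, rfl, hb⟩

end Run

/-! ### Parts of a sample, and selection from one of them -/

section Parts

variable {ι : Type} {T : Type*} [DecidableEq ι] [LinearOrder T]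

/-- The items of `W` whose keys are below the key of the `i`th smallest item of `S`. The
condition is expressed by ranks, so that no `i`th smallest item has to be chosen. -/
def lowerPart (key : ι → T) (S : Finset ι) (i : ℕ) (W : Finset ι) : Finset ι :=
  {z ∈ W | {w ∈ S | key w ≤ key z}.card < i}

/-- The items of `W` whose keys are above the key of the `i`th smallest item of `S`. -/
def upperPart (key : ι → T) (S : Finset ι) (i : ℕ) (W : Finset ι) : Finset ι :=
  {z ∈ W | i ≤ {w ∈ S | key w < key z}.card}

/-- The items of `W` whose keys are strictly between the keys of the `i`th smallest item and the
`j`th smallest item of `S`. -/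
def midPart (key : ι → T) (S : Finset ι) (i j : ℕ) (W : Finset ι) : Finset ι :=
  {z ∈ W | i ≤ {w ∈ S | key w < key z}.card ∧ {w ∈ S | key w ≤ key z}.card < j}

omit [DecidableEq ι] in
theorem IsKthSmallest.lt_iff {key : ι → T} {S : Finset ι} {i : ℕ} {v : ι}
    (h : IsKthSmallest key S i v) (z : ι) :
    key z < key v ↔ {w ∈ S | key w ≤ key z}.card < i := by
  obtain ⟨-, h1, h2⟩ := h
  constructor
  · intro hz
    refine lt_of_le_of_lt (Finset.card_le_card fun w => ?_) h1
    simp only [Finset.mem_filter]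
    exact fun hw => ⟨hw.1, hw.2.trans_lt hz⟩
  · intro hz
    by_contra! hlt
    refine absurd (h2.trans (Finset.card_le_card fun w => ?_)) (not_le.2 hz)
    simp only [Finset.mem_filter]
    exact fun hw => ⟨hw.1, hw.2.trans hlt⟩

omit [DecidableEq ι] in
theorem IsKthSmallest.gt_iff {key : ι → T} {S : Finset ι} {i : ℕ} {v : ι}
    (h : IsKthSmallest key S i v) (z : ι) :
    key v < key z ↔ i ≤ {w ∈ S | key w < key z}.card := by
  obtain ⟨-, h1, h2⟩ := h
  constructor
  · intro hz
    refine h2.trans (Finset.card_le_card fun w => ?_)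
    simp only [Finset.mem_filter]
    exact fun hw => ⟨hw.1, hw.2.trans_lt hz⟩
  · intro hz
    by_contra! hlt
    refine absurd (hz.trans (Finset.card_le_card fun w => ?_)) (not_le.2 h1)
    simp only [Finset.mem_filter]
    exact fun hw => ⟨hw.1, hw.2.trans_le hlt⟩

omit [DecidableEq ι] in
theorem IsKthSmallest.key_le_key {key : ι → T} {S : Finset ι} {i j : ℕ} {u v : ι}
    (hu : IsKthSmallest key S i u) (hv : IsKthSmallest key S j v) (hij : i ≤ j) :
    key u ≤ key v := by
  by_contra! h
  have h1 := (hu.lt_iff v).1 h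
  have h2 := hv.2.2
  omega

omit [DecidableEq ι] in
theorem exists_isKthSmallest (key : ι → T) (S : Finset ι) {i : ℕ} (h1 : 1 ≤ i)
    (h2 : i ≤ S.card) : ∃ y, IsKthSmallest key S i y := by
  -- the item is the least one with at least `i` items weakly below it
  have hne : {y ∈ S | i ≤ {z ∈ S | key z ≤ key y}.card}.Nonempty := by
    obtain ⟨y, hy, hmax⟩ := S.exists_max_image key (Finset.card_pos.1 (by omega))
    refine ⟨y, Finset.mem_filter.2 ⟨hy, ?_⟩⟩
    rwa [Finset.filter_true_of_mem hmax]
  obtain ⟨y, hy, hmin⟩ := Finset.exists_min_image _ key hne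
  rw [Finset.mem_filter] at hy
  refine ⟨y, hy.1, ?_, hy.2⟩
  by_contra! hlt
  have hne' : {z ∈ S | key z < key y}.Nonempty := Finset.card_pos.1 (by omega)
  obtain ⟨x, hx, hxmax⟩ := Finset.exists_max_image _ key hne'
  rw [Finset.mem_filter] at hx
  refine absurd (hmin x (Finset.mem_filter.2 ⟨hx.1, hlt.trans ?_⟩)) (not_le.2 hx.2)
  refine Finset.card_le_card fun z hz => ?_
  exact Finset.mem_filter.2 ⟨(Finset.mem_filter.1 hz).1, hxmax z hz⟩

/-- A bound for the expected cost of finding the `q`th smallest item of `W` after a partition by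
the `i`th and the `j`th smallest items of `S`, if a selection from `m` items costs `B m`. A
selection from the middle part is always charged; selections from the outer parts are charged
if the item is there. -/
noncomputable def findBound (B : ℕ → ℝ) (key : ι → T) (S : Finset ι) (i j : ℕ) (W : Finset ι)
    (q : ℕ) : ℝ :=
  B (midPart key S i j W).card +
    (if q ≤ (lowerPart key S i W).card then B (lowerPart key S i W).card else 0) +
    (if W.card < q + (upperPart key S j W).card then B (upperPart key S j W).card else 0)

omit [DecidableEq ι] in
theorem findBound_nonneg {B : ℕ → ℝ} (hB : ∀ m, 0 ≤ B m) (key : ι → T) (S : Finset ι) (i j : ℕ)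
    (W : Finset ι) (q : ℕ) : 0 ≤ findBound B key S i j W q := by
  unfold findBound
  have h1 := hB (midPart key S i j W).card
  have h2 := hB (lowerPart key S i W).card
  have h3 := hB (upperPart key S j W).card
  split_ifs <;> positivity

/-- Finding a new pivot: correctness and cost. Every recursive call is for a part of `W` that misses
an old pivot, hence for a smaller set. -/
theorem findPivot_spec {B : ℕ → ℝ} (hB : ∀ m, 0 ≤ B m) {key : ι → T}
    {rec : Finset ι → ℕ → Run ι} {S W : Finset ι} {i j q : ℕ} {u v : ι}
    (hu : IsKthSmallest key S i u) (hv : IsKthSmallest key S j v) (hij : i ≤ j) (hSW : S ⊆ W)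
    (hq : 1 ≤ q) (hqW : q ≤ W.card)
    (hrec : ∀ Y : Finset ι, Y.card < W.card → ∀ i, 1 ≤ i → i ≤ Y.card →
      (rec Y i).AlmostSurely (IsKthSmallest key Y i) ∧
        (rec Y i).expectedComparisons ≤ ENNReal.ofReal (B Y.card)) :
    (findPivot key rec W u v q).AlmostSurely (IsKthSmallest key W q) ∧
      (findPivot key rec W u v q).expectedComparisons ≤
        ENNReal.ofReal (findBound B key S i j W q) := by
  have huv := hu.key_le_key hv hij
  have huW := hSW hu.1
  have hvW := hSW hv.1
  have hL : lowerPart key S i W = {z ∈ W | key z < key u} :=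
    Finset.filter_congr fun z _ => (hu.lt_iff z).symm
  have hR : upperPart key S j W = {z ∈ W | key v < key z} :=
    Finset.filter_congr fun z _ => (hv.gt_iff z).symm
  have hM : midPart key S i j W = {z ∈ W | key u < key z ∧ key z < key v} :=
    Finset.filter_congr fun z _ => and_congr (hu.gt_iff z).symm (hv.lt_iff z).symm
  have hLU : {z ∈ W | key z < key u} ∪ {z ∈ W | key z = key u} = {z ∈ W | key z ≤ key u} := by
    ext z
    simp only [Finset.mem_union, Finset.mem_filter, le_iff_lt_or_eq]
    tauto
  have hLR : ∀ x : T, {z ∈ W | key z ≤ x}.card + {z ∈ W | x < key z}.card = W.card := by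
    intro x
    simpa only [not_le] using W.card_filter_add_card_filter_not (fun z => key z ≤ x)
  have hLlt : {z ∈ W | key z < key u}.card < W.card :=
    Finset.card_lt_card (Finset.filter_ssubset.2 ⟨u, huW, lt_irrefl _⟩)
  have hRlt : {z ∈ W | key v < key z}.card < W.card :=
    Finset.card_lt_card (Finset.filter_ssubset.2 ⟨v, hvW, lt_irrefl _⟩)
  have hMlt : {z ∈ W | key u < key z ∧ key z < key v}.card < W.card :=
    Finset.card_lt_card (Finset.filter_ssubset.2 ⟨u, huW, fun h => lt_irrefl _ h.1⟩)
  have hLUM : ({z ∈ W | key z ≤ key u} ∪ {z ∈ W | key u < key z ∧ key z < key v}).card =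
      {z ∈ W | key z ≤ key u}.card + {z ∈ W | key u < key z ∧ key z < key v}.card := by
    refine Finset.card_union_of_disjoint (Finset.disjoint_filter.2 fun z _ h1 h2 => ?_)
    exact absurd h1 (not_le.2 h2.1)
  have hret : ∀ y : ι, (Run.ret y).expectedComparisons = 0 := fun y => by
    rw [Run.expectedComparisons_eq_costThen, Run.costThen_ret]
  have hbound : ∀ {Y : Finset ι} {i' : ℕ}, Y.card < W.card → 1 ≤ i' → i' ≤ Y.card →
      B Y.card ≤ findBound B key S i j W q →
      (rec Y i').expectedComparisons ≤ ENNReal.ofReal (findBound B key S i j W q) :=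
    fun h1 h2 h3 h4 => (hrec _ h1 _ h2 h3).2.trans (ENNReal.ofReal_le_ofReal h4)
  have hB1 := hB (midPart key S i j W).card
  have hB2 := hB (lowerPart key S i W).card
  have hB3 := hB (upperPart key S j W).card
  unfold findPivot
  simp only [hLU, hLUM]
  have e1 := hLR (key u)
  have e2 := hLR (key v)
  split_ifs with c1 c2 c3 c4
  · refine ⟨Run.almostSurely_ret ⟨huW, c1⟩, ?_⟩
    rw [hret]
    exact zero_le
  · refine ⟨Run.almostSurely_ret ⟨hvW, ?_, by omega⟩, ?_⟩
    · refine lt_of_le_of_lt ?_ c2.1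
      rw [← hLUM]
      refine Finset.card_le_card fun z => ?_
      simp only [Finset.mem_union, Finset.mem_filter]
      intro hz
      rcases le_or_gt (key z) (key u) with h | h
      · exact Or.inl ⟨hz.1, h⟩
      · exact Or.inr ⟨hz.1, h, hz.2⟩
    · rw [hret]
      exact zero_le
  · refine ⟨(hrec _ hLlt _ hq c3).1.mono fun y hy => ?_, hbound hLlt hq c3 ?_⟩
    · obtain ⟨hy1, hy2, hy3⟩ := hy
      rw [Finset.mem_filter] at hy1
      refine ⟨hy1.1, ?_, ?_⟩
      · convert hy2 using 2
        rw [Finset.filter_filter]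
        refine Finset.filter_congr fun z _ => ?_
        exact ⟨fun h => ⟨h.trans hy1.2, h⟩, fun h => h.2⟩
      · refine hy3.trans (Finset.card_le_card ?_)
        exact Finset.filter_subset_filter _ (Finset.filter_subset _ _)
    · unfold findBound
      rw [← hL] at c3 ⊢
      rw [if_pos c3]
      split_ifs <;> linarith
  · refine ⟨(hrec _ hRlt _ (by omega) (by omega)).1.mono fun y hy => ?_,
      hbound hRlt (by omega) (by omega) ?_⟩
    · obtain ⟨hy1, hy2, hy3⟩ := hy
      rw [Finset.mem_filter] at hy1
      have hsplit : ∀ P : ι → Prop, ∀ [DecidablePred P], (∀ z, key z ≤ key v → P z) →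
          {z ∈ W | P z}.card = {z ∈ W | key z ≤ key v}.card +
            {z ∈ {z ∈ W | key v < key z} | P z}.card := by
        intro P _ hP
        rw [← Finset.card_filter_add_card_filter_not (s := {z ∈ W | P z})
          (fun z => key z ≤ key v), Finset.filter_filter, Finset.filter_filter,
          Finset.filter_filter]
        congr 2
        · refine Finset.filter_congr fun z _ => ?_
          exact ⟨fun h => h.2, fun h => ⟨hP z h, h⟩⟩
        · refine Finset.filter_congr fun z _ => ?_
          rw [not_le, and_comm]
      refine ⟨hy1.1, ?_, ?_⟩
      · rw [hsplit _ fun z hz => hz.trans_lt hy1.2]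
        omega
      · rw [hsplit _ fun z hz => hz.trans hy1.2.le]
        omega
    · unfold findBound
      rw [← hR] at c4 ⊢
      rw [if_pos (show W.card < q + (upperPart key S j W).card by omega)]
      split_ifs <;> linarith
  · have hq1 : {z ∈ W | key z ≤ key u}.card < q := by
      by_contra! h
      exact c1 ⟨by omega, h⟩
    have hq2 : q ≤ {z ∈ W | key z ≤ key u}.card +
        {z ∈ W | key u < key z ∧ key z < key v}.card := by
      by_contra! h
      exact c2 ⟨h, by omega⟩
    refine ⟨(hrec _ hMlt _ (by omega) (by omega)).1.mono fun y hy => ?_,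
      hbound hMlt (by omega) (by omega) ?_⟩
    · obtain ⟨hy1, hy2, hy3⟩ := hy
      rw [Finset.mem_filter] at hy1
      have hsplit : ∀ P : ι → Prop, ∀ [DecidablePred P], (∀ z, key z ≤ key u → P z) →
          (∀ z, P z → key z < key v) →
          {z ∈ W | P z}.card = {z ∈ W | key z ≤ key u}.card +
            {z ∈ {z ∈ W | key u < key z ∧ key z < key v} | P z}.card := by
        intro P _ hP hP'
        rw [← Finset.card_filter_add_card_filter_not (s := {z ∈ W | P z})
          (fun z => key z ≤ key u), Finset.filter_filter, Finset.filter_filter,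
          Finset.filter_filter]
        congr 2
        · refine Finset.filter_congr fun z _ => ?_
          exact ⟨fun h => h.2, fun h => ⟨hP z h, h⟩⟩
        · refine Finset.filter_congr fun z _ => ?_
          rw [not_le]
          exact ⟨fun h => ⟨⟨h.2, hP' z h.1⟩, h.1⟩, fun h => ⟨h.2, h.1.1⟩⟩
      refine ⟨hy1.1, ?_, ?_⟩
      · rw [hsplit _ (fun z hz => hz.trans_lt hy1.2.1) (fun z hz => hz.trans hy1.2.2)]
        omega
      · rw [hsplit _ (fun z hz => hz.trans hy1.2.1.le) (fun z hz => hz.trans_lt hy1.2.2)]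
        omega
    · unfold findBound
      rw [← hM]
      split_ifs <;> linarith

end Parts

/-! ### The recursion for the expected number of comparisons -/

/-- Choosing a subset `S` of `X` and then an enlargement `W` of it amounts to choosing `W` first
and then `S` inside `W`. -/
theorem sum_powersetCard_sdiff {ι M : Type*} [DecidableEq ι] [AddCommMonoid M] (X : Finset ι)
    (a b : ℕ) (f : Finset ι → Finset ι → M) :
    ∑ S ∈ X.powersetCard a, ∑ D ∈ (X \ S).powersetCard b, f S (S ∪ D) =
      ∑ W ∈ X.powersetCard (a + b), ∑ S ∈ W.powersetCard a, f S W := by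
  rw [Finset.sum_sigma', Finset.sum_sigma']
  refine Finset.sum_bij' (fun x _ => ⟨x.1 ∪ x.2, x.1⟩) (fun y _ => ⟨y.2, y.1 \ y.2⟩) ?_ ?_ ?_ ?_ ?_
  · rintro ⟨S, D⟩ h
    simp only [Finset.mem_sigma, Finset.mem_powersetCard, Finset.subset_sdiff] at h ⊢
    obtain ⟨⟨h1, h2⟩, ⟨h3, h4⟩, h5⟩ := h
    refine ⟨⟨Finset.union_subset h1 h3, ?_⟩, Finset.subset_union_left, h2⟩
    rw [Finset.card_union_of_disjoint h4.symm, h2, h5]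
  · rintro ⟨W, S⟩ h
    simp only [Finset.mem_sigma, Finset.mem_powersetCard, Finset.subset_sdiff] at h ⊢
    obtain ⟨⟨h1, h2⟩, h3, h4⟩ := h
    refine ⟨⟨h3.trans h1, h4⟩, ⟨Finset.sdiff_subset.trans h1, Finset.sdiff_disjoint⟩, ?_⟩
    rw [Finset.card_sdiff_of_subset h3, h2, h4]
    omega
  · rintro ⟨S, D⟩ h
    simp only [Finset.mem_sigma, Finset.mem_powersetCard, Finset.subset_sdiff] at h
    have hd : (S ∪ D) \ S = D := by
      rw [Finset.union_sdiff_left, Finset.sdiff_eq_self_of_disjoint h.2.1.2]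
    simp [hd]
  · rintro ⟨W, S⟩ h
    simp only [Finset.mem_sigma, Finset.mem_powersetCard] at h
    simp [Finset.union_sdiff_of_subset h.2.1]
  · rintro ⟨S, D⟩ _
    rfl

/-- The properties of the sample sizes that make the algorithm correct. -/
structure ValidPlan (n : ℕ) (p : Plan) : Prop where
  one_le : 1 ≤ p.s 1
  lt : p.s 1 < n
  mono : ∀ l, 1 ≤ l → l ≤ p.lbar → p.s l ≤ p.s (l + 1)
  last : p.s (p.lbar + 1) = n

namespace ValidPlan

variable {n : ℕ} {p : Plan}

theorem size_mono (h : ValidPlan n p) {l m : ℕ} (hl : 1 ≤ l) (hlm : l ≤ m)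
    (hm : m ≤ p.lbar + 1) : p.s l ≤ p.s m := by
  induction m, hlm using Nat.le_induction with
  | base => exact le_rfl
  | succ m hlm ih => exact (ih (by omega)).trans (h.mono m (by omega) (by omega))

theorem le_last (h : ValidPlan n p) {l : ℕ} (hl : 1 ≤ l) (hm : l ≤ p.lbar + 1) : p.s l ≤ n := by
  simpa only [h.last] using h.size_mono hl hm le_rfl

theorem one_le_size (h : ValidPlan n p) {l : ℕ} (hl : 1 ≤ l) (hm : l ≤ p.lbar + 1) :
    1 ≤ p.s l :=
  h.one_le.trans (h.size_mono le_rfl hl hm)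

end ValidPlan

section Indices

variable {gap : ℕ → ℕ → ℝ} {n k : ℕ} {p : Plan} {l : ℕ}

theorem gapAt_nonneg (hgap : ∀ n s, 0 ≤ gap n s) (n : ℕ) (p : Plan) (l : ℕ) :
    0 ≤ gapAt gap n p l := by
  unfold gapAt
  split_ifs
  · exact hgap _ _
  · exact le_rfl

theorem one_le_iu : 1 ≤ iu gap n k p l := le_max_right _ _

theorem iv_le : iv gap n k p l ≤ p.s l := min_le_right _ _

theorem iu_le_iv (hgap : ∀ n s, 0 ≤ gap n s) (hk : 1 ≤ k) (hkn : k ≤ n) (hs : 1 ≤ p.s l) :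
    iu gap n k p l ≤ iv gap n k p l := by
  have hg := gapAt_nonneg hgap n p l
  have hn : (0 : ℝ) < n := by exact_mod_cast (by omega : 0 < n)
  have hk' : (0 : ℝ) < k := by exact_mod_cast (by omega : 0 < k)
  have hs' : (0 : ℝ) < p.s l := by exact_mod_cast (by omega : 0 < p.s l)
  have hθ : (k : ℝ) / n ≤ 1 := (div_le_one hn).2 (by exact_mod_cast hkn)
  have hpos : 0 < (k : ℝ) / n * p.s l := by positivity
  unfold iu iv
  refine max_le (le_min ?_ ?_) (le_min ?_ hs)
  · exact Nat.ceil_mono (by linarith)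
  · refine Nat.ceil_le.2 ?_
    nlinarith
  · exact Nat.one_le_iff_ne_zero.2 (Nat.ceil_pos.2 (by linarith)).ne'

theorem iu_last (hk : 1 ≤ k) (hkn : k ≤ n) (hp : p.s (p.lbar + 1) = n) :
    iu gap n k p (p.lbar + 1) = k := by
  have hn : (n : ℝ) ≠ 0 := by exact_mod_cast (by omega : n ≠ 0)
  unfold iu gapAt
  rw [hp, if_neg (by omega), sub_zero, div_mul_cancel₀ _ hn, Nat.ceil_natCast]
  exact max_eq_left hk

end Indices

section Recursion

variable {ι : Type} {T : Type*} [DecidableEq ι] [LinearOrder T]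

/-- The number of comparisons for partitioning `W \ S` by the `i`th and the `j`th smallest items
of `S`. -/
noncomputable def partitionBound (key : ι → T) (θ : ℝ) (S : Finset ι) (i j : ℕ) (W : Finset ι) :
    ℝ :=
  ((W \ S).card : ℝ) +
    if θ < 1 / 2 then ((lowerPart key S j (W \ S)).card : ℝ)
    else ((upperPart key S i (W \ S)).card : ℝ)

/-- A bound for the expected cost of the iteration that enlarges the sample `S` of size `s l` to
the sample `W`, if a selection from `m` items costs `B m`. -/
noncomputable def stepBound (B : ℕ → ℝ) (key : ι → T) (gap : ℕ → ℕ → ℝ) (n k : ℕ) (p : Plan)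
    (l : ℕ) (S W : Finset ι) : ℝ :=
  partitionBound key ((k : ℝ) / n) S (iu gap n k p l) (iv gap n k p l) W +
    findBound B key S (iu gap n k p l) (iv gap n k p l) W (iu gap n k p (l + 1)) +
    findBound B key S (iu gap n k p l) (iv gap n k p l) W (iv gap n k p (l + 1))

theorem partitionBound_nonneg (key : ι → T) (θ : ℝ) (S : Finset ι) (i j : ℕ) (W : Finset ι) :
    0 ≤ partitionBound key θ S i j W := by
  unfold partitionBound
  split_ifs <;> positivity

theorem partitionCost_eq {key : ι → T} {S D : Finset ι} {i j : ℕ} {u v : ι} (θ : ℝ)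
    (hu : IsKthSmallest key S i u) (hv : IsKthSmallest key S j v) (hD : Disjoint S D) :
    (partitionCost key θ u v D : ℝ) = partitionBound key θ S i j (S ∪ D) := by
  have h : ∀ P : ι → Prop, ∀ [DecidablePred P],
      (∑ z ∈ D, if P z then 2 else 1) = D.card + {z ∈ D | P z}.card := by
    intro P _
    rw [Finset.card_filter, Finset.card_eq_sum_ones, ← Finset.sum_add_distrib]
    refine Finset.sum_congr rfl fun z _ => ?_
    split_ifs <;> rfl
  have hd : (S ∪ D) \ S = D := by
    rw [Finset.union_sdiff_left, Finset.sdiff_eq_self_of_disjoint hD.symm]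
  unfold partitionCost partitionBound
  rw [hd]
  split_ifs with hθ
  · rw [h]
    have e : lowerPart key S j D = {z ∈ D | key z < key v} :=
      Finset.filter_congr fun z _ => (hv.lt_iff z).symm
    rw [e, Nat.cast_add]
  · rw [h]
    have e : upperPart key S i D = {z ∈ D | key u < key z} :=
      Finset.filter_congr fun z _ => (hu.gt_iff z).symm
    rw [e, Nat.cast_add]

/-- The largest expected cost of the last `m` iterations from a sample `S` with correct
pivots. -/
noncomputable def iterCost (key : ι → T) (gap : ℕ → ℕ → ℝ) (p : Plan)
    (rec : Finset ι → ℕ → Run ι) (X : Finset ι) (k m l : ℕ) (S : Finset ι) : ℝ≥0∞ :=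
  ⨆ u, ⨆ v, ⨆ (_ : IsKthSmallest key S (iu gap X.card k p l) u ∧
    IsKthSmallest key S (iv gap X.card k p l) v),
    (iterations key gap p rec X k m l S u v).expectedComparisons

theorem le_iterCost {key : ι → T} {gap : ℕ → ℕ → ℝ} {p : Plan}
    {rec : Finset ι → ℕ → Run ι} {X : Finset ι} {k m l : ℕ} {S : Finset ι} {u v : ι}
    (hu : IsKthSmallest key S (iu gap X.card k p l) u)
    (hv : IsKthSmallest key S (iv gap X.card k p l) v) :
    (iterations key gap p rec X k m l S u v).expectedComparisons ≤
      iterCost key gap p rec X k m l S :=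
  le_iSup_of_le u (le_iSup_of_le v (le_iSup_of_le ⟨hu, hv⟩ le_rfl))

/-- The recursive routine finds the `i`th smallest items of the sets with fewer than `n` items,
at an expected cost of at most `B m` for `m` items. -/
def SelectsBelow (key : ι → T) (rec : Finset ι → ℕ → Run ι) (B : ℕ → ℝ) (n : ℕ) : Prop :=
  ∀ Y : Finset ι, Y.card < n → ∀ i, 1 ≤ i → i ≤ Y.card →
    (rec Y i).AlmostSurely (IsKthSmallest key Y i) ∧
      (rec Y i).expectedComparisons ≤ ENNReal.ofReal (B Y.card)

variable {key : ι → T} {gap : ℕ → ℕ → ℝ} {p : Plan} {rec : Finset ι → ℕ → Run ι}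
  {X : Finset ι} {k : ℕ} {B : ℕ → ℝ}

theorem iterations_almostSurely (hB : ∀ m, 0 ≤ B m) (hgap : ∀ n s, 0 ≤ gap n s)
    (hp : ValidPlan X.card p) (hrec : SelectsBelow key rec B X.card) (hk : 1 ≤ k)
    (hkX : k ≤ X.card) (m : ℕ) : ∀ (l : ℕ) (S : Finset ι) (u v : ι), 1 ≤ l →
      l + m = p.lbar + 1 → S ⊆ X → S.card = p.s l →
      IsKthSmallest key S (iu gap X.card k p l) u → IsKthSmallest key S (iv gap X.card k p l) v →
      (iterations key gap p rec X k m l S u v).AlmostSurely (IsKthSmallest key X k) := by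
  induction m with
  | zero =>
    intro l S u v hl hlm hSX hS hu hv
    obtain rfl : l = p.lbar + 1 := by omega
    rw [hp.last] at hS
    obtain rfl : S = X := Finset.eq_of_subset_of_card_le hSX hS.ge
    rw [iu_last hk hkX hp.last] at hu
    exact Run.almostSurely_ret hu
  | succ m ih =>
    intro l S u v hl hlm hSX hS hu hv
    have hs := hp.mono l hl (by omega)
    have ht := hp.le_last (l := l + 1) (by omega) (by omega)
    have h1 := hp.one_le_size (l := l + 1) (by omega) (by omega)
    have h1' := hp.one_le_size (l := l) (by omega) (by omega)
    have hij := iu_le_iv hgap hk hkX h1'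
    have hij' := iu_le_iv hgap hk hkX h1
    have hd : p.s (l + 1) - p.s l ≤ (X \ S).card := by
      rw [Finset.card_sdiff_of_subset hSX]; omega
    unfold iterations
    refine (Run.almostSurely_sample _ hd).bind fun D hD => ?_
    rw [Finset.subset_sdiff] at hD
    have hW : (S ∪ D).card = p.s (l + 1) := by
      rw [Finset.card_union_of_disjoint hD.1.2.symm, hS, hD.2]; omega
    have hfind := fun q h1 h2 => findPivot_spec (q := q) (W := S ∪ D) hB hu hv hij
      Finset.subset_union_left h1 h2 (fun Y hY => hrec Y (by omega))
    have hiv : iv gap X.card k p (l + 1) ≤ (S ∪ D).card := hW ▸ iv_le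
    refine (Run.almostSurely_tick _).bind fun _ _ => ?_
    refine (hfind _ one_le_iu (hij'.trans hiv)).1.bind fun u' hu' => ?_
    refine (hfind _ (one_le_iu.trans hij') hiv).1.bind fun v' hv' => ?_
    exact ih (l + 1) _ _ _ (by omega) (by omega) (Finset.union_subset hSX hD.1.1) hW hu' hv'

theorem iterCost_succ_le (hB : ∀ m, 0 ≤ B m) (hgap : ∀ n s, 0 ≤ gap n s)
    (hp : ValidPlan X.card p) (hrec : SelectsBelow key rec B X.card) (hk : 1 ≤ k)
    (hkX : k ≤ X.card) {m l : ℕ} (hl : 1 ≤ l) (hlb : l ≤ p.lbar) {S : Finset ι} (hSX : S ⊆ X)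
    (hS : S.card = p.s l) :
    iterCost key gap p rec X k (m + 1) l S ≤
      (∑ D ∈ (X \ S).powersetCard (p.s (l + 1) - p.s l),
        (ENNReal.ofReal (stepBound B key gap X.card k p l S (S ∪ D)) +
          iterCost key gap p rec X k m (l + 1) (S ∪ D))) /
        ((X.card - p.s l).choose (p.s (l + 1) - p.s l) : ℕ) := by
  refine iSup_le fun u => iSup_le fun v => iSup_le fun ⟨hu, hv⟩ => ?_
  have hs := hp.mono l hl (by omega)
  have ht := hp.le_last (l := l + 1) (by omega) (by omega)
  have h1 := hp.one_le_size (l := l + 1) (by omega) (by omega)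
  have h1' := hp.one_le_size (l := l) (by omega) (by omega)
  have hij := iu_le_iv hgap hk hkX h1'
  have hij' := iu_le_iv hgap hk hkX h1
  have hc : (X \ S).card = X.card - p.s l := by rw [Finset.card_sdiff_of_subset hSX, hS]
  have hd : p.s (l + 1) - p.s l ≤ (X \ S).card := by omega
  unfold iterations
  rw [Run.expectedComparisons_eq_costThen, Run.costThen_bind, Run.costThen_sample _ hd, hc]
  refine ENNReal.div_le_div_right (Finset.sum_le_sum fun D hD => ?_) _
  rw [Finset.mem_powersetCard, Finset.subset_sdiff] at hD
  have hW : (S ∪ D).card = p.s (l + 1) := by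
    rw [Finset.card_union_of_disjoint hD.1.2.symm, hS, hD.2]; omega
  have hfind := fun q h1 h2 => findPivot_spec (q := q) (W := S ∪ D) hB hu hv hij
    Finset.subset_union_left h1 h2 (fun Y hY => hrec Y (by omega))
  have hiv : iv gap X.card k p (l + 1) ≤ (S ∪ D).card := hW ▸ iv_le
  have hfu := hfind _ one_le_iu (hij'.trans hiv)
  have hfv := hfind _ (one_le_iu.trans hij') hiv
  simp only [Run.costThen_bind, Run.costThen_tick]
  have hpc : ((partitionCost key ((k : ℝ) / X.card) u v D : ℕ) : ℝ≥0∞) =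
      ENNReal.ofReal (partitionBound key ((k : ℝ) / X.card) S (iu gap X.card k p l)
        (iv gap X.card k p l) (S ∪ D)) := by
    rw [← partitionCost_eq _ hu hv hD.1.2.symm, ENNReal.ofReal_natCast]
  unfold stepBound
  rw [hpc, ENNReal.ofReal_add (add_nonneg (partitionBound_nonneg ..) (findBound_nonneg hB ..))
    (findBound_nonneg hB ..), ENNReal.ofReal_add (partitionBound_nonneg ..)
    (findBound_nonneg hB ..), add_assoc, add_assoc]
  gcongr
  refine (Run.costThen_le hfu.1 fun u' hu' => ?_).trans (add_le_add_left hfu.2 _)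
  refine (Run.costThen_le hfv.1 fun v' hv' => ?_).trans (add_le_add_left hfv.2 _)
  rw [← Run.expectedComparisons_eq_costThen]
  exact le_iterCost hu' hv'

/-- The cost of the iterations from a uniform sample of size `s l`: as the next sample is again
uniform, the average costs `K l` of the iterations, taken for fixed next samples, add up. -/
theorem sum_iterCost_le (hB : ∀ m, 0 ≤ B m) (hgap : ∀ n s, 0 ≤ gap n s)
    (hp : ValidPlan X.card p) (hrec : SelectsBelow key rec B X.card) (hk : 1 ≤ k)
    (hkX : k ≤ X.card) {K : ℕ → ℝ}
    (hK : ∀ l, 1 ≤ l → l ≤ p.lbar → ∀ W ⊆ X, W.card = p.s (l + 1) →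
      ∑ S ∈ W.powersetCard (p.s l), stepBound B key gap X.card k p l S W ≤
        ((p.s (l + 1)).choose (p.s l) : ℝ) * K l) (m : ℕ) :
    ∀ l, 1 ≤ l → l + m = p.lbar + 1 →
      ∑ S ∈ X.powersetCard (p.s l), iterCost key gap p rec X k m l S ≤
        (X.card.choose (p.s l) : ℕ) * ∑ j ∈ Finset.range m, ENNReal.ofReal (K (l + j)) := by
  induction m with
  | zero =>
    intro l hl hlm
    have h0 : ∀ S, iterCost key gap p rec X k 0 l S = 0 := by
      intro S
      unfold iterCost
      simp only [iterations, Run.expectedComparisons_eq_costThen, Run.costThen_ret]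
      simp
    simp [h0]
  | succ m ih =>
    intro l hl hlm
    have hs := hp.mono l hl (by omega)
    have ht := hp.le_last (l := l + 1) (by omega) (by omega)
    set s := p.s l
    set t := p.s (l + 1)
    set n := X.card
    have hst : s + (t - s) = t := by omega
    have hN : (((n - s).choose (t - s) : ℕ) : ℝ≥0∞) ≠ 0 := by
      exact_mod_cast (Nat.choose_pos (by omega)).ne'
    have hmul : ((n.choose t : ℕ) : ℝ≥0∞) * (t.choose s : ℕ) =
        (n.choose s : ℕ) * ((n - s).choose (t - s) : ℕ) := by
      exact_mod_cast Nat.choose_mul hs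
    have hstep : ∀ S ∈ X.powersetCard s, iterCost key gap p rec X k (m + 1) l S ≤
        (∑ D ∈ (X \ S).powersetCard (t - s),
          (ENNReal.ofReal (stepBound B key gap n k p l S (S ∪ D)) +
          iterCost key gap p rec X k m (l + 1) (S ∪ D))) / ((n - s).choose (t - s) : ℕ) := by
      intro S hS
      rw [Finset.mem_powersetCard] at hS
      exact iterCost_succ_le hB hgap hp hrec hk hkX hl (by omega) hS.1 hS.2
    refine (Finset.sum_le_sum hstep).trans ?_
    simp only [ENNReal.div_eq_inv_mul]
    rw [← Finset.mul_sum, sum_powersetCard_sdiff X s (t - s) (fun S W =>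
      ENNReal.ofReal (stepBound B key gap n k p l S W) + iterCost key gap p rec X k m (l + 1) W),
      hst]
    have hW : ∀ W ∈ X.powersetCard t, ∑ S ∈ W.powersetCard s,
        (ENNReal.ofReal (stepBound B key gap n k p l S W) +
          iterCost key gap p rec X k m (l + 1) W) ≤
        (t.choose s : ℕ) * (ENNReal.ofReal (K l) + iterCost key gap p rec X k m (l + 1) W) := by
      intro W hW
      rw [Finset.mem_powersetCard] at hW
      rw [Finset.sum_add_distrib, Finset.sum_const, Finset.card_powersetCard, hW.2,
        nsmul_eq_mul, mul_add]
      gcongr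
      rw [← ENNReal.ofReal_sum_of_nonneg, ← ENNReal.ofReal_natCast,
        ← ENNReal.ofReal_mul (by positivity)]
      · exact ENNReal.ofReal_le_ofReal (hK l hl (by omega) W hW.1 hW.2)
      · intro S _
        unfold stepBound
        exact add_nonneg (add_nonneg (partitionBound_nonneg ..) (findBound_nonneg hB ..))
          (findBound_nonneg hB ..)
    refine (mul_le_mul_right (Finset.sum_le_sum hW) _).trans ?_
    rw [← Finset.mul_sum, Finset.sum_add_distrib, Finset.sum_const, Finset.card_powersetCard,
      nsmul_eq_mul]
    refine (mul_le_mul_right (mul_le_mul_right (add_le_add_right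
      (ih (l + 1) (by omega) (by omega)) _) _) _).trans (le_of_eq ?_)
    rw [← mul_add, Finset.sum_range_succ']
    have hreindex : ∀ j, l + 1 + j = l + (j + 1) := fun j => by omega
    simp only [hreindex, add_zero]
    rw [add_comm (ENNReal.ofReal (K l)), ← mul_assoc ((t.choose s : ℕ) : ℝ≥0∞),
      mul_comm ((t.choose s : ℕ) : ℝ≥0∞), hmul, mul_comm ((n.choose s : ℕ) : ℝ≥0∞) _,
      mul_assoc, ← mul_assoc, ENNReal.inv_mul_cancel hN (ENNReal.natCast_ne_top _), one_mul]

/-- One level of the recursion: the two selections from the first sample, and the iterations. -/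
theorem select_spec {plan : ℕ → Plan} {ncut : ℕ} {small : Finset ι → ℕ → Run ι}
    (hB : ∀ m, 0 ≤ B m) (hgap : ∀ n s, 0 ≤ gap n s) (hX : 2 ≤ X.card) (hcut : ncut < X.card)
    (hp : ValidPlan X.card (plan X.card))
    (hrec : SelectsBelow key (select key plan gap ncut small) B X.card) (hk : 1 ≤ k)
    (hkX : k ≤ X.card) {K : ℕ → ℝ}
    (hK : ∀ l, 1 ≤ l → l ≤ (plan X.card).lbar → ∀ W ⊆ X, W.card = (plan X.card).s (l + 1) →
      ∑ S ∈ W.powersetCard ((plan X.card).s l),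
        stepBound B key gap X.card k (plan X.card) l S W ≤
        (((plan X.card).s (l + 1)).choose ((plan X.card).s l) : ℝ) * K l) :
    (select key plan gap ncut small X k).AlmostSurely (IsKthSmallest key X k) ∧
      (select key plan gap ncut small X k).expectedComparisons ≤
        ENNReal.ofReal (B ((plan X.card).s 1)) + ENNReal.ofReal (B ((plan X.card).s 1)) +
          ∑ j ∈ Finset.range (plan X.card).lbar, ENNReal.ofReal (K (1 + j)) := by
  set p := plan X.card with hpdef
  let rec' : Finset ι → ℕ → Run ι := fun Y i =>
    if _h : Y.card < X.card then select key plan gap ncut small Y i else Run.diverge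
  have hrec' : SelectsBelow key rec' B X.card := by
    intro Y hY i h1 h2
    simp only [rec', dif_pos hY]
    exact hrec Y hY i h1 h2
  have hsel : select key plan gap ncut small X k =
      (Run.sample X (p.s 1)).bind fun S =>
      (rec' S (iu gap X.card k p 1)).bind fun u =>
      (rec' S (iv gap X.card k p 1)).bind fun v =>
      iterations key gap p rec' X k p.lbar 1 S u v := by
    rw [select, dif_neg (by omega), if_neg (by omega)]
  have hs := hp.lt
  have hij := iu_le_iv hgap hk hkX hp.one_le
  have hpiv : ∀ S : Finset ι, S.card = p.s 1 → ∀ i, 1 ≤ i → i ≤ p.s 1 →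
      (rec' S i).AlmostSurely (IsKthSmallest key S i) ∧
        (rec' S i).expectedComparisons ≤ ENNReal.ofReal (B (p.s 1)) := by
    intro S hS i h1 h2
    rw [← hS]
    exact hrec' S (by omega) i h1 (by omega)
  rw [hsel]
  constructor
  · refine (Run.almostSurely_sample X hs.le).bind fun S hS => ?_
    refine (hpiv S hS.2 _ one_le_iu (hij.trans iv_le)).1.bind fun u hu => ?_
    refine (hpiv S hS.2 _ (one_le_iu.trans hij) iv_le).1.bind fun v hv => ?_
    exact iterations_almostSurely hB hgap hp hrec' hk hkX _ 1 S u v le_rfl (by omega) hS.1 hS.2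
      hu hv
  · rw [Run.expectedComparisons_eq_costThen, Run.costThen_bind, Run.costThen_sample X hs.le]
    have hS : ∀ S ∈ X.powersetCard (p.s 1),
        ((rec' S (iu gap X.card k p 1)).bind fun u =>
          (rec' S (iv gap X.card k p 1)).bind fun v =>
          iterations key gap p rec' X k p.lbar 1 S u v).costThen (fun _ => 0) ≤
        (ENNReal.ofReal (B (p.s 1)) + ENNReal.ofReal (B (p.s 1))) +
          iterCost key gap p rec' X k p.lbar 1 S := by
      intro S hS
      rw [Finset.mem_powersetCard] at hS
      have hu := hpiv S hS.2 _ one_le_iu (hij.trans iv_le)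
      have hv := hpiv S hS.2 _ (one_le_iu.trans hij) iv_le
      rw [Run.costThen_bind, add_assoc]
      refine (Run.costThen_le hu.1 fun u hu' => ?_).trans (add_le_add_left hu.2 _)
      rw [Run.costThen_bind]
      refine (Run.costThen_le hv.1 fun v hv' => ?_).trans (add_le_add_left hv.2 _)
      rw [← Run.expectedComparisons_eq_costThen]
      exact le_iterCost hu' hv'
    refine (ENNReal.div_le_div_right (Finset.sum_le_sum hS) _).trans ?_
    rw [Finset.sum_add_distrib, Finset.sum_const, Finset.card_powersetCard, nsmul_eq_mul]
    refine ENNReal.div_le_of_le_mul' ?_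
    refine (add_le_add_right ?_ _).trans_eq (mul_add _ _ _).symm
    exact sum_iterCost_le hB hgap hp hrec' hk hkX hK _ 1 le_rfl (by omega)

end Recursion

/-! ### Uniform subsets: exchangeability -/

section Exchange

variable {ι : Type} [DecidableEq ι]

theorem sum_powersetCard_insert {M : Type*} [AddCommMonoid M] (W : Finset ι) (s : ℕ)
    (g : Finset ι → ι → M) :
    ∑ S ∈ W.powersetCard s, ∑ z ∈ W \ S, g S z =
      ∑ Y ∈ W.powersetCard (s + 1), ∑ z ∈ Y, g (Y.erase z) z := by
  rw [Finset.sum_sigma', Finset.sum_sigma']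
  refine Finset.sum_bij' (fun x _ => ⟨insert x.2 x.1, x.2⟩) (fun y _ => ⟨y.1.erase y.2, y.2⟩)
    ?_ ?_ ?_ ?_ ?_
  · rintro ⟨S, z⟩ h
    simp only [Finset.mem_sigma, Finset.mem_powersetCard, Finset.mem_sdiff] at h ⊢
    obtain ⟨⟨h1, h2⟩, h3, h4⟩ := h
    refine ⟨⟨Finset.insert_subset h3 h1, ?_⟩, Finset.mem_insert_self _ _⟩
    rw [Finset.card_insert_of_notMem h4, h2]
  · rintro ⟨Y, z⟩ h
    simp only [Finset.mem_sigma, Finset.mem_powersetCard, Finset.mem_sdiff] at h ⊢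
    obtain ⟨⟨h1, h2⟩, h3⟩ := h
    refine ⟨⟨(Finset.erase_subset _ _).trans h1, ?_⟩, h1 h3, Finset.notMem_erase _ _⟩
    rw [Finset.card_erase_of_mem h3, h2]
    omega
  · rintro ⟨S, z⟩ h
    simp only [Finset.mem_sigma, Finset.mem_powersetCard, Finset.mem_sdiff] at h
    simp [Finset.erase_insert h.2.2]
  · rintro ⟨Y, z⟩ h
    simp only [Finset.mem_sigma, Finset.mem_powersetCard] at h
    simp [Finset.insert_erase h.2]
  · rintro ⟨S, z⟩ h
    simp only [Finset.mem_sigma, Finset.mem_powersetCard, Finset.mem_sdiff] at h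
    simp [Finset.erase_insert h.2.2]

theorem succ_mul_sum_powersetCard_succ (W : Finset ι) (s : ℕ) (f : Finset ι → ℝ) :
    ((s : ℝ) + 1) * ∑ Y ∈ W.powersetCard (s + 1), f Y =
      ∑ S ∈ W.powersetCard s, ∑ z ∈ W \ S, f (insert z S) := by
  rw [sum_powersetCard_insert W s fun S z => f (insert z S), Finset.mul_sum]
  refine Finset.sum_congr rfl fun Y hY => ?_
  rw [Finset.mem_powersetCard] at hY
  rw [Finset.sum_congr rfl fun z hz => by rw [Finset.insert_erase hz], Finset.sum_const, hY.2,
    nsmul_eq_mul]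
  push_cast
  rfl

theorem choose_succ_mul_succ {s t : ℕ} (hst : s ≤ t) :
    (t.choose (s + 1) : ℝ) * ((s : ℝ) + 1) = t.choose s * ((t : ℝ) - s) := by
  have h := Nat.choose_succ_right_eq t s
  rw [← Nat.cast_sub hst]
  exact_mod_cast h

/-- If in each `(s + 1)`-set at most `c` items `z` are in relation to the set of the others, then
a uniform `s`-subset `S` of `W` is on average in relation to at most `(|W| - s) c / (s + 1)` of
the items outside of `S`: given `S ∪ {z}`, each of its items is equally likely to be `z`. -/
theorem sum_card_filter_sdiff_le {W : Finset ι} {s c : ℕ} (hs : s ≤ W.card)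
    (P : Finset ι → ι → Prop) [∀ S z, Decidable (P S z)]
    (h : ∀ Y : Finset ι, Y.card = s + 1 → {z ∈ Y | P (Y.erase z) z}.card ≤ c) :
    ∑ S ∈ W.powersetCard s, ({z ∈ W \ S | P S z}.card : ℝ) ≤
      (W.card.choose s : ℝ) * (((W.card : ℝ) - s) * c / ((s : ℝ) + 1)) := by
  have e := sum_powersetCard_insert W s fun S z => if P S z then 1 else 0
  simp only [← Finset.card_filter] at e
  have h2 : ∑ Y ∈ W.powersetCard (s + 1), {z ∈ Y | P (Y.erase z) z}.card ≤
      W.card.choose (s + 1) * c := by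
    rw [← Finset.card_powersetCard, ← smul_eq_mul]
    refine Finset.sum_le_card_nsmul _ _ _ fun Y hY => ?_
    exact h Y (Finset.mem_powersetCard.1 hY).2
  rw [← e] at h2
  have h3 : ∑ S ∈ W.powersetCard s, ({z ∈ W \ S | P S z}.card : ℝ) ≤
      (W.card.choose (s + 1) : ℝ) * c := by exact_mod_cast h2
  refine h3.trans (le_of_eq ?_)
  have h4 := choose_succ_mul_succ hs
  have h5 : (s : ℝ) + 1 ≠ 0 := by positivity
  field_simp
  linear_combination (c : ℝ) * h4

variable {T : Type*} [LinearOrder T] {key : ι → T}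

theorem sum_card_lowerPart_sdiff_le {W : Finset ι} {s : ℕ} (hs : s ≤ W.card) (i : ℕ) :
    ∑ S ∈ W.powersetCard s, ((lowerPart key S i (W \ S)).card : ℝ) ≤
      (W.card.choose s : ℝ) * (((W.card : ℝ) - s) * i / ((s : ℝ) + 1)) := by
  refine sum_card_filter_sdiff_le hs (fun S z => {w ∈ S | key w ≤ key z}.card < i) fun Y _ => ?_
  rcases Finset.eq_empty_or_nonempty
    {z ∈ Y | {w ∈ Y.erase z | key w ≤ key z}.card < i} with h | h
  · simp [h]
  obtain ⟨z, hz, hmax⟩ := Finset.exists_max_image _ key h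
  have hsub : {z ∈ Y | {w ∈ Y.erase z | key w ≤ key z}.card < i} ⊆
      insert z {w ∈ Y.erase z | key w ≤ key z} := by
    intro x hx
    rcases eq_or_ne x z with rfl | hxz
    · exact Finset.mem_insert_self _ _
    · refine Finset.mem_insert_of_mem (Finset.mem_filter.2 ⟨?_, hmax x hx⟩)
      exact Finset.mem_erase.2 ⟨hxz, (Finset.mem_filter.1 hx).1⟩
  have h1 := Finset.card_le_card hsub
  have h2 := Finset.card_insert_le z {w ∈ Y.erase z | key w ≤ key z}
  have h3 := (Finset.mem_filter.1 hz).2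
  omega

theorem sum_card_upperPart_sdiff_le {W : Finset ι} {s : ℕ} (hs : s ≤ W.card) (i : ℕ) :
    ∑ S ∈ W.powersetCard s, ((upperPart key S i (W \ S)).card : ℝ) ≤
      (W.card.choose s : ℝ) * (((W.card : ℝ) - s) * (s + 1 - i : ℕ) / ((s : ℝ) + 1)) := by
  refine sum_card_filter_sdiff_le hs (fun S z => i ≤ {w ∈ S | key w < key z}.card) fun Y hY => ?_
  rcases Finset.eq_empty_or_nonempty
    {z ∈ Y | i ≤ {w ∈ Y.erase z | key w < key z}.card} with h | h
  · simp [h]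
  obtain ⟨z, hz, hmin⟩ := Finset.exists_min_image _ key h
  have hdisj : Disjoint {z ∈ Y | i ≤ {w ∈ Y.erase z | key w < key z}.card}
      {w ∈ Y.erase z | key w < key z} := by
    refine Finset.disjoint_left.2 fun x hx hx' => ?_
    exact absurd (hmin x hx) (not_le.2 (Finset.mem_filter.1 hx').2)
  have h1 := Finset.card_le_card (Finset.union_subset (Finset.filter_subset _ Y)
    ((Finset.filter_subset (fun w => key w < key z) _).trans (Finset.erase_subset z Y)) :
      {z ∈ Y | i ≤ {w ∈ Y.erase z | key w < key z}.card} ∪ _ ⊆ Y)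
  rw [Finset.card_union_of_disjoint hdisj] at h1
  have h3 := (Finset.mem_filter.1 hz).2
  omega

theorem sum_card_midPart_sdiff_le {W : Finset ι} {s : ℕ} (hs : s ≤ W.card) (i j : ℕ) :
    ∑ S ∈ W.powersetCard s, ((midPart key S i j (W \ S)).card : ℝ) ≤
      (W.card.choose s : ℝ) * (((W.card : ℝ) - s) * (j - i : ℕ) / ((s : ℝ) + 1)) := by
  refine sum_card_filter_sdiff_le hs (fun S z => i ≤ {w ∈ S | key w < key z}.card ∧
    {w ∈ S | key w ≤ key z}.card < j) fun Y _ => ?_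
  set Z := {z ∈ Y | i ≤ {w ∈ Y.erase z | key w < key z}.card ∧
    {w ∈ Y.erase z | key w ≤ key z}.card < j} with hZ
  rcases Finset.eq_empty_or_nonempty Z with h | h
  · simp [h]
  obtain ⟨z, hz, hmin⟩ := Finset.exists_min_image _ key h
  obtain ⟨y, hy, hmax⟩ := Finset.exists_max_image _ key h
  have hdisj : Disjoint Z {w ∈ Y.erase z | key w < key z} := by
    refine Finset.disjoint_left.2 fun x hx hx' => ?_
    exact absurd (hmin x hx) (not_le.2 (Finset.mem_filter.1 hx').2)
  have hmem : ∀ x ∈ Y, key x ≤ key y → x ∈ insert y {w ∈ Y.erase y | key w ≤ key y} := by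
    intro x hx hxy
    rcases eq_or_ne x y with rfl | hne
    · exact Finset.mem_insert_self _ _
    · exact Finset.mem_insert_of_mem (Finset.mem_filter.2 ⟨Finset.mem_erase.2 ⟨hne, hx⟩, hxy⟩)
  have h1 : (Z ∪ {w ∈ Y.erase z | key w < key z}).card ≤
      (insert y {w ∈ Y.erase y | key w ≤ key y}).card := by
    refine Finset.card_le_card (Finset.union_subset (fun x hx => ?_) fun x hx => ?_)
    · exact hmem x (Finset.mem_filter.1 hx).1 (hmax x hx)
    · rw [Finset.mem_filter] at hx
      exact hmem x (Finset.mem_of_mem_erase hx.1) (hx.2.le.trans (hmax z hz))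
  rw [Finset.card_union_of_disjoint hdisj] at h1
  have h2 := Finset.card_insert_le y {w ∈ Y.erase y | key w ≤ key y}
  have h3 := (Finset.mem_filter.1 hz).2
  have h4 := (Finset.mem_filter.1 hy).2
  omega

omit [DecidableEq ι] in
theorem card_midPart_self_le (S : Finset ι) (i j : ℕ) :
    (midPart key S i j S).card ≤ j - i := by
  rcases Finset.eq_empty_or_nonempty (midPart key S i j S) with h | h
  · simp [h]
  classical
  obtain ⟨z, hz, hmin⟩ := Finset.exists_min_image _ key h
  obtain ⟨y, hy, hmax⟩ := Finset.exists_max_image _ key h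
  have hdisj : Disjoint (midPart key S i j S) {w ∈ S | key w < key z} := by
    refine Finset.disjoint_left.2 fun x hx hx' => ?_
    exact absurd (hmin x hx) (not_le.2 (Finset.mem_filter.1 hx').2)
  have h1 : (midPart key S i j S ∪ {w ∈ S | key w < key z}).card ≤
      {w ∈ S | key w ≤ key y}.card := by
    refine Finset.card_le_card (Finset.union_subset (fun x hx => ?_) fun x hx => ?_)
    · exact Finset.mem_filter.2 ⟨(Finset.mem_filter.1 hx).1, hmax x hx⟩
    · rw [Finset.mem_filter] at hx
      exact Finset.mem_filter.2 ⟨hx.1, hx.2.le.trans (hmax z hz)⟩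
  rw [Finset.card_union_of_disjoint hdisj] at h1
  have h3 := (Finset.mem_filter.1 hz).2
  have h4 := (Finset.mem_filter.1 hy).2
  omega

theorem sum_card_midPart_le {W : Finset ι} {s : ℕ} (hs : s ≤ W.card) (i j : ℕ) :
    ∑ S ∈ W.powersetCard s, ((midPart key S i j W).card : ℝ) ≤
      (W.card.choose s : ℝ) * (((W.card : ℝ) + 1) / ((s : ℝ) + 1) * (j - i : ℕ)) := by
  have h : ∀ S ∈ W.powersetCard s, ((midPart key S i j W).card : ℝ) ≤
      (midPart key S i j (W \ S)).card + (j - i : ℕ) := by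
    intro S hS
    rw [Finset.mem_powersetCard] at hS
    have h1 := card_midPart_self_le (key := key) S i j
    have h2 : (midPart key S i j W).card ≤
        (midPart key S i j (W \ S)).card + (midPart key S i j S).card := by
      refine (Finset.card_le_card ?_).trans (Finset.card_union_le _ _)
      intro x hx
      simp only [midPart, Finset.mem_union, Finset.mem_filter, Finset.mem_sdiff] at hx ⊢
      tauto
    exact_mod_cast h2.trans (by omega)
  refine (Finset.sum_le_sum h).trans ?_
  rw [Finset.sum_add_distrib, Finset.sum_const, Finset.card_powersetCard, nsmul_eq_mul]
  refine (add_le_add_left (sum_card_midPart_sdiff_le hs i j) _).trans (le_of_eq ?_)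
  have h5 : (s : ℝ) + 1 ≠ 0 := by positivity
  field_simp
  ring

/-- On average, few items are below the whole sample. -/
theorem sum_card_lowerPart_one_le {W : Finset ι} {s : ℕ} (hs : s ≤ W.card) :
    ∑ S ∈ W.powersetCard s, ((lowerPart key S 1 W).card : ℝ) ≤
      (W.card.choose s : ℝ) * (((W.card : ℝ) - s) / ((s : ℝ) + 1)) := by
  have h := sum_card_lowerPart_sdiff_le (key := key) hs 1
  rw [Nat.cast_one, mul_one] at h
  refine (Finset.sum_le_sum fun S _ => ?_).trans h
  refine Nat.cast_le.2 (Finset.card_le_card fun z hz => ?_)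
  simp only [lowerPart, Finset.mem_filter, Finset.mem_sdiff, Nat.lt_one_iff,
    Finset.card_eq_zero] at hz ⊢
  refine ⟨⟨hz.1, fun hzS => ?_⟩, hz.2⟩
  exact Finset.notMem_empty z (hz.2 ▸ Finset.mem_filter.2 ⟨hzS, le_rfl⟩)

/-- On average, few items are above the whole sample. -/
theorem sum_card_upperPart_card_le {W : Finset ι} {s : ℕ} (hs : s ≤ W.card) :
    ∑ S ∈ W.powersetCard s, ((upperPart key S s W).card : ℝ) ≤
      (W.card.choose s : ℝ) * (((W.card : ℝ) - s) / ((s : ℝ) + 1)) := by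
  have h := sum_card_upperPart_sdiff_le (key := key) hs s
  rw [Nat.add_sub_cancel_left, Nat.cast_one, mul_one] at h
  refine (Finset.sum_le_sum fun S hS => ?_).trans h
  refine Nat.cast_le.2 (Finset.card_le_card fun z hz => ?_)
  rw [Finset.mem_powersetCard] at hS
  simp only [upperPart, Finset.mem_filter, Finset.mem_sdiff] at hz ⊢
  refine ⟨⟨hz.1, fun hzS => ?_⟩, hz.2⟩
  have : {w ∈ S | key w < key z}.card < S.card :=
    Finset.card_lt_card (Finset.filter_ssubset.2 ⟨z, hzS, lt_irrefl _⟩)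
  omega

/-! ### Uniform subsets: tail bounds -/

variable {W A : Finset ι}

omit [LinearOrder T] in
theorem sum_sdiff_ite (hA : A ⊆ W) (S : Finset ι) :
    ∑ z ∈ W \ S, (if z ∈ A then (1 : ℝ) else 0) = (A.card : ℝ) - (S ∩ A).card := by
  rw [← Finset.sum_filter, Finset.sum_const, nsmul_eq_mul, mul_one, Finset.filter_mem_eq_inter]
  have h : (W \ S) ∩ A = A \ (S ∩ A) := by
    ext x
    simp only [Finset.mem_inter, Finset.mem_sdiff]
    exact ⟨fun h => ⟨h.2, fun h' => h.1.2 h'.1⟩, fun h => ⟨⟨hA h.1, fun h' => h.2 ⟨h', h.1⟩⟩, h.1⟩⟩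
  rw [h, Finset.cast_card_sdiff Finset.inter_subset_right]

theorem card_insert_inter {S : Finset ι} {z : ι} (hz : z ∉ S) :
    (insert z S ∩ A).card = (S ∩ A).card + if z ∈ A then 1 else 0 := by
  split_ifs with h
  · rw [Finset.insert_inter_of_mem h, Finset.card_insert_of_notMem]
    exact fun h' => hz (Finset.mem_of_mem_inter_left h')
  · rw [Finset.insert_inter_of_notMem h, add_zero]

theorem sum_card_inter (hA : A ⊆ W) {s : ℕ} (hs : s ≤ W.card) :
    (W.card : ℝ) * ∑ S ∈ W.powersetCard s, ((S ∩ A).card : ℝ) =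
      (W.card.choose s : ℝ) * (s * A.card) := by
  induction s with
  | zero => simp
  | succ s ih =>
    have h1 := succ_mul_sum_powersetCard_succ W s fun S => ((S ∩ A).card : ℝ)
    have h2 : ∀ S ∈ W.powersetCard s, ∑ z ∈ W \ S, ((insert z S ∩ A).card : ℝ) =
        ((W.card : ℝ) - s - 1) * (S ∩ A).card + A.card := by
      intro S hS
      rw [Finset.mem_powersetCard] at hS
      rw [Finset.sum_congr rfl fun z hz => by
        rw [card_insert_inter (Finset.mem_sdiff.1 hz).2]]
      push_cast
      rw [Finset.sum_add_distrib, sum_sdiff_ite hA S, Finset.sum_const, nsmul_eq_mul,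
        Finset.cast_card_sdiff hS.1, hS.2]
      ring
    rw [Finset.sum_congr rfl h2, Finset.sum_add_distrib, ← Finset.mul_sum, Finset.sum_const,
      Finset.card_powersetCard, nsmul_eq_mul] at h1
    have h3 := ih (by omega)
    have h4 := choose_succ_mul_succ (show s ≤ W.card by omega)
    have h5 : (s : ℝ) + 1 ≠ 0 := by positivity
    refine mul_left_cancel₀ h5 ?_
    push_cast
    linear_combination (W.card : ℝ) * h1 + ((W.card : ℝ) - s - 1) * h3 -
      ((s : ℝ) + 1) * A.card * h4

/-- The moment generating function of the number of items of `A` in a uniform subset is at most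
that for sampling with replacement. The proof adds one item at a time: the more items of `A` the
sample has, the less likely the next item is in `A`. -/
theorem sum_pow_card_inter_le (hA : A ⊆ W) {x : ℝ} (hx : 0 ≤ x) {s : ℕ} (hs : s ≤ W.card) :
    ∑ S ∈ W.powersetCard s, (1 + x) ^ (S ∩ A).card ≤
      (W.card.choose s : ℝ) * (1 + A.card / W.card * x) ^ s := by
  induction s with
  | zero => simp
  | succ s ih =>
    have ht : (0 : ℝ) < W.card := by exact_mod_cast (by omega : 0 < W.card)
    have hsW : s ≤ W.card := by omega
    have h1 := succ_mul_sum_powersetCard_succ W s fun S => (1 + x) ^ (S ∩ A).card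
    have h2 : ∀ S ∈ W.powersetCard s, ∑ z ∈ W \ S, (1 + x) ^ (insert z S ∩ A).card =
        (1 + x) ^ (S ∩ A).card *
          (((W.card : ℝ) - s) + x * ((A.card : ℝ) - (S ∩ A).card)) := by
      intro S hS
      rw [Finset.mem_powersetCard] at hS
      have h : ∀ z ∈ W \ S, (1 + x) ^ (insert z S ∩ A).card =
          (1 + x) ^ (S ∩ A).card * (1 + x * if z ∈ A then (1 : ℝ) else 0) := by
        intro z hz
        rw [card_insert_inter (Finset.mem_sdiff.1 hz).2, pow_add]
        split_ifs <;> simp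
      rw [Finset.sum_congr rfl h, ← Finset.mul_sum, Finset.sum_add_distrib, ← Finset.mul_sum,
        sum_sdiff_ite hA S, Finset.sum_const, nsmul_eq_mul, mul_one,
        Finset.cast_card_sdiff hS.1, hS.2]
    rw [Finset.sum_congr rfl h2] at h1
    -- the two factors are oppositely ordered, so that their means can be separated
    have hanti : AntivaryOn (fun S : Finset ι => (1 + x) ^ (S ∩ A).card)
        (fun S : Finset ι => ((W.card : ℝ) - s) + x * ((A.card : ℝ) - (S ∩ A).card))
        (W.powersetCard s) := by
      intro S _ S' _ hlt
      have : x * (S' ∩ A).card < x * (S ∩ A).card := by simp only at hlt; linarith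
      have hc : (S' ∩ A).card ≤ (S ∩ A).card := by
        exact_mod_cast (lt_of_mul_lt_mul_left this hx).le
      exact pow_le_pow_right₀ (by linarith) hc
    have h3 := hanti.card_mul_sum_le_sum_mul_sum
    have hsum : ∑ S ∈ W.powersetCard s,
        (((W.card : ℝ) - s) + x * ((A.card : ℝ) - (S ∩ A).card)) =
        (W.card.choose s : ℝ) * ((W.card : ℝ) - s) * (1 + A.card / W.card * x) := by
      have h4 := sum_card_inter hA hsW
      rw [Finset.sum_add_distrib, ← Finset.mul_sum]
      simp only [Finset.sum_sub_distrib, Finset.sum_const, Finset.card_powersetCard, nsmul_eq_mul]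
      field_simp
      linear_combination (-x) * h4
    rw [hsum, Finset.card_powersetCard, ← h1] at h3
    have hC : (0 : ℝ) < W.card.choose s := by exact_mod_cast Nat.choose_pos hsW
    have hsub : (0 : ℝ) ≤ (W.card : ℝ) - s := sub_nonneg.2 (by exact_mod_cast hsW)
    have hp : (0 : ℝ) ≤ 1 + A.card / W.card * x := by positivity
    have h5 := choose_succ_mul_succ hsW
    have h6 := ih hsW
    have hs1 : (0 : ℝ) < (s : ℝ) + 1 := by positivity
    refine le_of_mul_le_mul_left ?_ hs1
    refine le_of_mul_le_mul_left (h3.trans ?_) hC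
    calc _ ≤ ((W.card.choose s : ℝ) * (1 + A.card / W.card * x) ^ s) *
          ((W.card.choose s : ℝ) * ((W.card : ℝ) - s) * (1 + A.card / W.card * x)) := by
            gcongr
      _ = _ := by
        rw [pow_succ]
        linear_combination (-(W.card.choose s : ℝ)) * (1 + A.card / W.card * x) ^ s *
          (1 + A.card / W.card * x) * h5

open MeasureTheory ProbabilityTheory in
/-- Hoeffding's lemma for a Bernoulli variable. -/
theorem bernoulli_mgf_le {p : ℝ} (hp : 0 ≤ p) (hp' : p ≤ 1) (c : ℝ) :
    1 + p * (Real.exp c - 1) ≤ Real.exp (c * p + c ^ 2 / 8) := by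
  set μ : Measure ℝ := ENNReal.ofReal p • Measure.dirac 1 + ENNReal.ofReal (1 - p) • Measure.dirac 0
    with hμ
  have hprob : IsProbabilityMeasure μ := ⟨by
    simp only [hμ, Measure.add_apply, Measure.smul_apply, measure_univ, smul_eq_mul, mul_one]
    rw [← ENNReal.ofReal_add hp (by linarith)]
    simp⟩
  have hint : ∀ f : ℝ → ℝ, ∫ x, f x ∂μ = p * f 1 + (1 - p) * f 0 := by
    intro f
    have hi : ∀ (q a : ℝ), Integrable f (ENNReal.ofReal q • Measure.dirac a) := fun q a =>
      (integrable_dirac (by simp)).smul_measure ENNReal.ofReal_ne_top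
    rw [hμ, integral_add_measure (hi _ _) (hi _ _), integral_smul_measure, integral_smul_measure,
      integral_dirac, integral_dirac, ENNReal.toReal_ofReal hp,
      ENNReal.toReal_ofReal (by linarith), smul_eq_mul, smul_eq_mul]
  have hb : ∀ᵐ x ∂μ, (fun x : ℝ => x) x ∈ Set.Icc (0 : ℝ) 1 := by
    rw [hμ, ae_add_measure_iff]
    constructor
    · refine Measure.ae_smul_measure ?_ _
      simp [ae_dirac_eq]
    · refine Measure.ae_smul_measure ?_ _
      simp [ae_dirac_eq]
  have h := (hasSubgaussianMGF_of_mem_Icc (μ := μ) (X := fun x : ℝ => x)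
    aemeasurable_id hb).mgf_le c
  unfold mgf at h
  rw [hint, hint] at h
  simp only [mul_one, mul_zero, add_zero] at h
  have e1 : Real.exp (c * (1 - p)) = Real.exp c * Real.exp (-(c * p)) := by
    rw [← Real.exp_add]; ring_nf
  have e2 : Real.exp (c * (0 - p)) = Real.exp (-(c * p)) := by ring_nf
  rw [e1, e2] at h
  have e3 : Real.exp (c * p + c ^ 2 / 8) = Real.exp (c * p) * Real.exp (c ^ 2 / 8) :=
    Real.exp_add _ _
  have h' : (1 + p * (Real.exp c - 1)) * Real.exp (-(c * p)) ≤ Real.exp (c ^ 2 / 8) := by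
    refine le_trans (le_of_eq ?_) (h.trans (le_of_eq ?_))
    · ring
    · congr 1
      norm_num
      ring
  rw [e3]
  have hpos := Real.exp_pos (c * p)
  calc _ = Real.exp (c * p) * ((1 + p * (Real.exp c - 1)) * Real.exp (-(c * p))) := by
        rw [Real.exp_neg]; field_simp
    _ ≤ _ := by gcongr

/-- Hoeffding's bound for sampling without replacement, upper tail. -/
theorem card_filter_le_card_inter_le (hA : A ⊆ W) {s : ℕ} (hs : 1 ≤ s) (hsW : s ≤ W.card) {τ : ℝ}
    (hτ : 0 ≤ τ) :
    ({S ∈ W.powersetCard s | (s : ℝ) * (A.card / W.card) + τ ≤ (S ∩ A).card}.card : ℝ) ≤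
      (W.card.choose s : ℝ) * Real.exp (-(2 * τ ^ 2 / s)) := by
  set p : ℝ := A.card / W.card with hp
  have ht : (0 : ℝ) < W.card := by exact_mod_cast (by omega : 0 < W.card)
  have hs0 : (0 : ℝ) < s := by exact_mod_cast hs
  have hp0 : 0 ≤ p := by positivity
  have hp1 : p ≤ 1 := (div_le_one ht).2 (by exact_mod_cast Finset.card_le_card hA)
  -- the exponent that is optimal in the exponential moment bound
  set c : ℝ := 4 * τ / s with hc
  have hc0 : 0 ≤ c := by positivity
  have h1 := sum_pow_card_inter_le hA (x := Real.exp c - 1)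
    (by linarith [Real.add_one_le_exp c]) hsW
  rw [← hp] at h1
  have h2 : (1 + p * (Real.exp c - 1)) ^ s ≤ Real.exp (s * (c * p + c ^ 2 / 8)) := by
    rw [Real.exp_nat_mul]
    refine pow_le_pow_left₀ ?_ (bernoulli_mgf_le hp0 hp1 c) s
    nlinarith [Real.add_one_le_exp c]
  have h3 : ({S ∈ W.powersetCard s | (s : ℝ) * p + τ ≤ (S ∩ A).card}.card : ℝ) *
      Real.exp (c * (s * p + τ)) ≤
      ∑ S ∈ W.powersetCard s, (1 + (Real.exp c - 1)) ^ (S ∩ A).card := by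
    rw [← nsmul_eq_mul]
    refine (Finset.card_nsmul_le_sum _ (fun S => (1 + (Real.exp c - 1)) ^ (S ∩ A).card) _
      fun S hS => ?_).trans (Finset.sum_le_sum_of_subset_of_nonneg (Finset.filter_subset _ _)
        fun S _ _ => by rw [add_sub_cancel]; positivity)
    rw [add_sub_cancel, ← Real.exp_nat_mul, Real.exp_le_exp, mul_comm]
    exact mul_le_mul_of_nonneg_right (Finset.mem_filter.1 hS).2 hc0
  have h4 := h3.trans (h1.trans (mul_le_mul_of_nonneg_left h2 (by positivity)))
  refine le_of_mul_le_mul_right (h4.trans (le_of_eq ?_)) (Real.exp_pos (c * (s * p + τ)))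
  rw [mul_assoc, ← Real.exp_add]
  congr 2
  rw [hc]
  field_simp
  ring

/-- Hoeffding's bound for sampling without replacement, lower tail. -/
theorem card_filter_card_inter_le_le (hA : A ⊆ W) {s : ℕ} (hs : 1 ≤ s) (hsW : s ≤ W.card) {τ : ℝ}
    (hτ : 0 ≤ τ) :
    ({S ∈ W.powersetCard s | ((S ∩ A).card : ℝ) ≤ s * (A.card / W.card) - τ}.card : ℝ) ≤
      (W.card.choose s : ℝ) * Real.exp (-(2 * τ ^ 2 / s)) := by
  have ht : (0 : ℝ) < W.card := by exact_mod_cast (by omega : 0 < W.card)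
  refine le_trans ?_ (card_filter_le_card_inter_le (A := W \ A) Finset.sdiff_subset hs hsW hτ)
  refine Nat.cast_le.2 (Finset.card_le_card fun S hS => ?_)
  rw [Finset.mem_filter, Finset.mem_powersetCard] at hS
  refine Finset.mem_filter.2 ⟨Finset.mem_powersetCard.2 hS.1, ?_⟩
  have h1 : S ∩ (W \ A) = S \ (S ∩ A) := by
    ext x
    simp only [Finset.mem_inter, Finset.mem_sdiff]
    exact ⟨fun h => ⟨h.1, fun h' => h.2.2 h'.2⟩, fun h => ⟨h.1, hS.1.1 h.1, fun h' => h.2 ⟨h.1, h'⟩⟩⟩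
  rw [h1, Finset.cast_card_sdiff Finset.inter_subset_left, Finset.cast_card_sdiff hA, hS.1.2,
    sub_div, div_self ht.ne']
  linarith [hS.2]

end Exchange

/-! ### The expected cost of one iteration -/

section Step

variable {ι : Type} [DecidableEq ι] {T : Type*} [LinearOrder T] {key : ι → T}
  {W : Finset ι} {s i j q : ℕ} {θ g g' b : ℝ} {B : ℕ → ℝ}

/-- A new pivot, the `q`th smallest item of `W`, rarely is below the lower pivot of the sample.
If `θ s - g > 0`, this means that the sample has too few items among the `q` smallest ones of
`W`. Otherwise the lower pivot is the least item of the sample, and few items of `W` are below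
it. -/
theorem sum_lowerPart_cost_le (hs : 1 ≤ s) (hsW : s ≤ W.card) (hB : ∀ m, 0 ≤ B m)
    (hBmono : Monotone B) (hb : 0 ≤ b) (hBb : ∀ m, B m ≤ b * m) (hi : i = max ⌈θ * s - g⌉₊ 1)
    (hq : 1 ≤ q) (hqW : q ≤ W.card) (hqθ : θ * W.card - g' ≤ q) (hg : g' * s / W.card ≤ g) :
    ∑ S ∈ W.powersetCard s,
        (if q ≤ (lowerPart key S i W).card then B (lowerPart key S i W).card else 0) ≤
      (W.card.choose s : ℝ) *
        (Real.exp (-(2 * (g - g' * s / W.card) ^ 2 / s)) * B W.card +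
          b * (((W.card : ℝ) - s) / ((s : ℝ) + 1))) := by
  have ht : (0 : ℝ) < W.card := by exact_mod_cast (by omega : 0 < W.card)
  have hsub : (0 : ℝ) ≤ (W.card : ℝ) - s := sub_nonneg.2 (by exact_mod_cast hsW)
  rcases le_or_gt (θ * s - g) 0 with h0 | h0
  · rw [Nat.ceil_eq_zero.2 h0, max_eq_right zero_le_one] at hi
    subst hi
    have h1 : ∀ S ∈ W.powersetCard s,
        (if q ≤ (lowerPart key S 1 W).card then B (lowerPart key S 1 W).card else 0) ≤
          b * (lowerPart key S 1 W).card := by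
      intro S _
      split_ifs
      · exact hBb _
      · positivity
    refine (Finset.sum_le_sum h1).trans ?_
    rw [← Finset.mul_sum]
    refine (mul_le_mul_of_nonneg_left (sum_card_lowerPart_one_le hsW) hb).trans ?_
    rw [mul_left_comm]
    gcongr
    have := hB W.card
    exact le_add_of_nonneg_left (by positivity)
  · rw [max_eq_left (Nat.one_le_iff_ne_zero.2 (Nat.ceil_pos.2 h0).ne')] at hi
    obtain ⟨y, hyW, hy1, hy2⟩ := exists_isKthSmallest key W hq hqW
    set A := {z ∈ W | key z ≤ key y} with hA
    have h1 : ∀ S ∈ W.powersetCard s,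
        (if q ≤ (lowerPart key S i W).card then B (lowerPart key S i W).card else 0) ≤
          if ((S ∩ A).card : ℝ) ≤ s * (A.card / W.card) - (g - g' * s / W.card)
          then B W.card else 0 := by
      intro S hS
      rw [Finset.mem_powersetCard] at hS
      split_ifs with c1 c2 c2
      · exact hBmono (Finset.card_le_card (Finset.filter_subset _ _))
      · refine absurd ?_ c2
        have h2 : {w ∈ S | key w ≤ key y}.card < i := by
          by_contra! hle
          refine absurd (c1.trans (Finset.card_le_card fun z hz => ?_)) (not_le.2 hy1)
          simp only [lowerPart, Finset.mem_filter] at hz ⊢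
          refine ⟨hz.1, not_le.1 fun hyz => absurd (hle.trans (Finset.card_le_card ?_))
            (not_le.2 hz.2)⟩
          exact Finset.monotone_filter_right _ fun w _ hw => hw.trans hyz
        have h3 : S ∩ A = {w ∈ S | key w ≤ key y} := by
          ext w
          simp only [hA, Finset.mem_inter, Finset.mem_filter]
          exact ⟨fun h => ⟨h.1, h.2.2⟩, fun h => ⟨h.1, hS.1 h.1, h.2⟩⟩
        rw [← h3, hi, Nat.lt_ceil] at h2
        have h4 : θ * W.card - g' ≤ A.card := hqθ.trans (by exact_mod_cast hy2)
        have h5 : (s : ℝ) * ((θ * W.card - g') / W.card) ≤ s * (A.card / W.card) := by gcongr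
        have h6 : (s : ℝ) * ((θ * W.card - g') / W.card) = θ * s - g' * s / W.card := by
          field_simp
        linarith
      · exact hB _
      · exact le_rfl
    refine (Finset.sum_le_sum h1).trans ?_
    rw [← Finset.sum_filter, Finset.sum_const, nsmul_eq_mul]
    refine (mul_le_mul_of_nonneg_right (card_filter_card_inter_le_le
      (Finset.filter_subset _ W) hs hsW (sub_nonneg.2 hg)) (hB _)).trans ?_
    rw [mul_assoc]
    gcongr
    exact le_add_of_nonneg_right (by positivity)

/-- A new pivot rarely is above the upper pivot of the sample. -/
theorem sum_upperPart_cost_le (hs : 1 ≤ s) (hsW : s ≤ W.card) (hB : ∀ m, 0 ≤ B m)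
    (hBmono : Monotone B) (hb : 0 ≤ b) (hBb : ∀ m, B m ≤ b * m) (hj : j = min ⌈θ * s + g⌉₊ s)
    (hq : 1 ≤ q) (hqW : q ≤ W.card) (hqθ : (q : ℝ) ≤ θ * W.card + g' + 1)
    (hg : g' * s / W.card ≤ g) :
    ∑ S ∈ W.powersetCard s,
        (if W.card < q + (upperPart key S j W).card then B (upperPart key S j W).card else 0) ≤
      (W.card.choose s : ℝ) *
        (Real.exp (-(2 * (g - g' * s / W.card) ^ 2 / s)) * B W.card +
          b * (((W.card : ℝ) - s) / ((s : ℝ) + 1))) := by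
  have ht : (0 : ℝ) < W.card := by exact_mod_cast (by omega : 0 < W.card)
  have hsub : (0 : ℝ) ≤ (W.card : ℝ) - s := sub_nonneg.2 (by exact_mod_cast hsW)
  rcases le_or_gt s ⌈θ * s + g⌉₊ with h0 | h0
  · rw [min_eq_right h0] at hj
    subst hj
    have h1 : ∀ S ∈ W.powersetCard j,
        (if W.card < q + (upperPart key S j W).card then B (upperPart key S j W).card else 0) ≤
          b * (upperPart key S j W).card := by
      intro S _
      split_ifs
      · exact hBb _
      · positivity
    refine (Finset.sum_le_sum h1).trans ?_
    rw [← Finset.mul_sum]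
    refine (mul_le_mul_of_nonneg_left (sum_card_upperPart_card_le hsW) hb).trans ?_
    rw [mul_left_comm]
    gcongr
    have := hB W.card
    exact le_add_of_nonneg_left (by positivity)
  · rw [min_eq_left h0.le] at hj
    obtain ⟨y, hyW, hy1, hy2⟩ := exists_isKthSmallest key W hq hqW
    set A := {z ∈ W | key z < key y} with hA
    have h1 : ∀ S ∈ W.powersetCard s,
        (if W.card < q + (upperPart key S j W).card then B (upperPart key S j W).card else 0) ≤
          if (s : ℝ) * (A.card / W.card) + (g - g' * s / W.card) ≤ (S ∩ A).card
          then B W.card else 0 := by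
      intro S hS
      rw [Finset.mem_powersetCard] at hS
      split_ifs with c1 c2 c2
      · exact hBmono (Finset.card_le_card (Finset.filter_subset _ _))
      · refine absurd ?_ c2
        have h2 : j ≤ {w ∈ S | key w < key y}.card := by
          by_contra! hlt
          have hdisj : Disjoint {z ∈ W | key z ≤ key y} (upperPart key S j W) := by
            refine Finset.disjoint_left.2 fun z hz hz' => ?_
            simp only [upperPart, Finset.mem_filter] at hz hz'
            refine absurd (hz'.2.trans (Finset.card_le_card ?_)) (not_le.2 hlt)
            exact Finset.monotone_filter_right _ fun w _ hw => hw.trans_le hz.2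
          have h3 : ({z ∈ W | key z ≤ key y} ∪ upperPart key S j W).card ≤ W.card :=
            Finset.card_le_card (Finset.union_subset (Finset.filter_subset _ W)
              (Finset.filter_subset _ W))
          rw [Finset.card_union_of_disjoint hdisj] at h3
          omega
        have h3 : S ∩ A = {w ∈ S | key w < key y} := by
          ext w
          simp only [hA, Finset.mem_inter, Finset.mem_filter]
          exact ⟨fun h => ⟨h.1, h.2.2⟩, fun h => ⟨h.1, hS.1 h.1, h.2⟩⟩
        rw [← h3, hj, Nat.ceil_le] at h2
        have h4 : (A.card : ℝ) ≤ θ * W.card + g' := by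
          have : (A.card : ℝ) + 1 ≤ q := by exact_mod_cast hy1
          linarith
        have h5 : (s : ℝ) * (A.card / W.card) ≤ s * ((θ * W.card + g') / W.card) := by gcongr
        have h6 : (s : ℝ) * ((θ * W.card + g') / W.card) = θ * s + g' * s / W.card := by
          field_simp
        linarith
      · exact hB _
      · exact le_rfl
    refine (Finset.sum_le_sum h1).trans ?_
    rw [← Finset.sum_filter, Finset.sum_const, nsmul_eq_mul]
    refine (mul_le_mul_of_nonneg_right (card_filter_le_card_inter_le
      (Finset.filter_subset _ W) hs hsW (sub_nonneg.2 hg)) (hB _)).trans ?_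
    rw [mul_assoc]
    gcongr
    exact le_add_of_nonneg_right (by positivity)

theorem sub_div_succ_le {a : ℝ} {t : ℕ} (ha : (t : ℝ) ≤ a * s) (ha1 : 1 ≤ a) :
    ((t : ℝ) - s) / ((s : ℝ) + 1) ≤ a := by
  have hs : (0 : ℝ) ≤ s := s.cast_nonneg
  rw [div_le_iff₀ (by positivity)]
  nlinarith

theorem sum_findBound_le {a b₀ b₁ : ℝ} (ha1 : 1 ≤ a) (hs : 1 ≤ s) (hsW : s ≤ W.card)
    (hsa : (W.card : ℝ) ≤ a * s) (hB : ∀ m, 0 ≤ B m) (hBmono : Monotone B) (hb : 0 ≤ b)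
    (hBb : ∀ m, B m ≤ b * m) (hb₁ : 0 ≤ b₁) (hBb' : ∀ m ≤ W.card, B m ≤ b₁ * m + b₀)
    (hg0 : 0 ≤ g) (hi : i = max ⌈θ * s - g⌉₊ 1) (hj : j = min ⌈θ * s + g⌉₊ s) (hθ : 0 ≤ θ)
    (hq : 1 ≤ q) (hqW : q ≤ W.card) (hq1 : θ * W.card - g' ≤ q)
    (hq2 : (q : ℝ) ≤ θ * W.card + g' + 1) (hg : g' * s / W.card ≤ g)
    (htail : Real.exp (-(2 * (g - g' * s / W.card) ^ 2 / s)) ≤ a / √s) :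
    ∑ S ∈ W.powersetCard s, findBound B key S i j W q ≤
      (W.card.choose s : ℝ) *
        (b₁ * (a * (2 * g + 1)) + b₀ + 2 * (a / √s * B W.card + b * a)) := by
  unfold findBound
  rw [Finset.sum_add_distrib, Finset.sum_add_distrib]
  have h1 : ∑ S ∈ W.powersetCard s, B (midPart key S i j W).card ≤
      (W.card.choose s : ℝ) * (b₁ * (a * (2 * g + 1)) + b₀) := by
    have h2 : ∀ S ∈ W.powersetCard s, B (midPart key S i j W).card ≤
        b₁ * (midPart key S i j W).card + b₀ := fun S _ =>
      hBb' _ (Finset.card_le_card (Finset.filter_subset _ _))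
    refine (Finset.sum_le_sum h2).trans ?_
    rw [Finset.sum_add_distrib, ← Finset.mul_sum, Finset.sum_const, Finset.card_powersetCard,
      nsmul_eq_mul, mul_add]
    refine add_le_add_left ?_ _
    refine (mul_le_mul_of_nonneg_left (sum_card_midPart_le hsW i j) hb₁).trans ?_
    rw [mul_left_comm]
    have h3 : ((j - i : ℕ) : ℝ) ≤ 2 * g + 1 := by
      rcases le_total j i with hji | hij
      · rw [Nat.sub_eq_zero_of_le hji]
        push_cast
        linarith
      · rw [Nat.cast_sub hij]
        have h4 : (j : ℝ) ≤ θ * s + g + 1 := by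
          have : (j : ℝ) ≤ ⌈θ * s + g⌉₊ := by
            rw [hj]; exact_mod_cast min_le_left _ _
          exact this.trans (Nat.ceil_lt_add_one (by positivity)).le
        have h5 : θ * s - g ≤ i := by
          refine (Nat.le_ceil _).trans ?_
          rw [hi]; exact_mod_cast le_max_left _ _
        linarith
    have h4 : ((W.card : ℝ) + 1) / ((s : ℝ) + 1) ≤ a := by
      rw [div_le_iff₀ (by positivity)]
      linarith
    gcongr
  have h2 := sub_div_succ_le hsa ha1
  have h3 : (W.card.choose s : ℝ) *
        (Real.exp (-(2 * (g - g' * s / W.card) ^ 2 / s)) * B W.card +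
          b * (((W.card : ℝ) - s) / ((s : ℝ) + 1))) ≤
      (W.card.choose s : ℝ) * (a / √s * B W.card + b * a) := by
    have := hB W.card
    gcongr
  have h4 := (sum_lowerPart_cost_le (key := key) hs hsW hB hBmono hb hBb hi hq hqW hq1 hg).trans h3
  have h5 := (sum_upperPart_cost_le (key := key) hs hsW hB hBmono hb hBb hj hq hqW hq2 hg).trans h3
  refine (add_le_add (add_le_add h1 h4) h5).trans (le_of_eq ?_)
  ring

theorem sum_partitionBound_le {a : ℝ} (ha1 : 1 ≤ a) (hsW : s ≤ W.card)
    (hsa : (W.card : ℝ) ≤ a * s) (hg0 : 0 ≤ g) (hi : i = max ⌈θ * s - g⌉₊ 1) (his : i ≤ s)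
    (hj : j = min ⌈θ * s + g⌉₊ s) (hθ : 0 ≤ θ) (hθ1 : θ ≤ 1) :
    ∑ S ∈ W.powersetCard s, partitionBound key θ S i j W ≤
      (W.card.choose s : ℝ) *
        (((W.card : ℝ) - s) * (1 + min θ (1 - θ)) + a * (g + 1)) := by
  have hsub : (0 : ℝ) ≤ (W.card : ℝ) - s := sub_nonneg.2 (by exact_mod_cast hsW)
  have h1 : ∀ S ∈ W.powersetCard s, ((W \ S).card : ℝ) = (W.card : ℝ) - s := by
    intro S hS
    rw [Finset.mem_powersetCard] at hS
    rw [Finset.cast_card_sdiff hS.1, hS.2]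
  have h2 := sub_div_succ_le hsa ha1
  have hfrac : ∀ (φ : ℝ) (e : ℝ), 0 ≤ φ → e ≤ φ * s + (g + 1) →
      ((W.card : ℝ) - s) * e / ((s : ℝ) + 1) ≤ ((W.card : ℝ) - s) * φ + a * (g + 1) := by
    intro φ e hφ he
    calc ((W.card : ℝ) - s) * e / ((s : ℝ) + 1)
        ≤ ((W.card : ℝ) - s) * (φ * (s + 1) + (g + 1)) / ((s : ℝ) + 1) := by
          gcongr
          linarith
      _ = ((W.card : ℝ) - s) * φ + ((W.card : ℝ) - s) / ((s : ℝ) + 1) * (g + 1) := by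
          field_simp
      _ ≤ _ := by gcongr
  unfold partitionBound
  rw [Finset.sum_add_distrib, Finset.sum_congr rfl h1, Finset.sum_const, Finset.card_powersetCard,
    nsmul_eq_mul]
  split_ifs with hc
  · refine (add_le_add_right (sum_card_lowerPart_sdiff_le hsW j) _).trans ?_
    rw [← mul_add, min_eq_left (by linarith)]
    refine mul_le_mul_of_nonneg_left ?_ (by positivity)
    have h3 : (j : ℝ) ≤ θ * s + (g + 1) := by
      have : (j : ℝ) ≤ ⌈θ * s + g⌉₊ := by
        rw [hj]; exact_mod_cast min_le_left _ _
      have := this.trans (Nat.ceil_lt_add_one (by positivity)).le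
      linarith
    linarith [hfrac θ j hθ h3]
  · refine (add_le_add_right (sum_card_upperPart_sdiff_le hsW i) _).trans ?_
    rw [← mul_add, min_eq_right (by linarith)]
    refine mul_le_mul_of_nonneg_left ?_ (by positivity)
    have h3 : ((s + 1 - i : ℕ) : ℝ) ≤ (1 - θ) * s + (g + 1) := by
      have h5 : θ * s - g ≤ i := by
        refine (Nat.le_ceil _).trans ?_
        rw [hi]; exact_mod_cast le_max_left _ _
      rw [Nat.cast_sub (by omega)]
      push_cast
      linarith
    linarith [hfrac (1 - θ) _ (by linarith) h3]

end Step

/-! ### Sample sizes grow geometrically -/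

/-- One of the three rules for the sample sizes is followed for inputs of size `n`. -/
def Admissible (α r η : ℝ) (n : ℕ) (p : Plan) : Prop :=
  NonroundedSizes α r n p ∨ RoundedSizes α r n p ∨ ReducedRoundedSizes α r η n p

section Sizes

variable {α r η : ℝ} {n : ℕ} {p : Plan}

theorem one_le_rpow_size (hα : 0 < α) (hn : 2 ≤ n) : 1 ≤ (n : ℝ) ^ α :=
  Real.one_le_rpow (by exact_mod_cast (by omega : 1 ≤ n)) hα.le

theorem rpow_size_le_sqrt (hα' : α ≤ 1 / 2) (hn : 2 ≤ n) : (n : ℝ) ^ α ≤ √n := by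
  rw [Real.sqrt_eq_rpow]
  exact Real.rpow_le_rpow_of_exponent_le (by exact_mod_cast (by omega : 1 ≤ n)) hα'

theorem sqrt_lt_size (hn : 2 ≤ n) : √(n : ℝ) < n := by
  have h : (2 : ℝ) ≤ n := by exact_mod_cast hn
  rw [Real.sqrt_lt' (by linarith)]
  nlinarith

theorem ceil_rpow_size_lt (hα' : α ≤ 1 / 2) (hn : 3 ≤ n) : ⌈(n : ℝ) ^ α⌉₊ < n := by
  have h : (3 : ℝ) ≤ n := by exact_mod_cast hn
  have h1 : √(n : ℝ) ≤ n - 1 := by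
    rw [Real.sqrt_le_left (by linarith)]
    nlinarith
  have h2 : ⌈(n : ℝ) ^ α⌉₊ ≤ n - 1 := by
    rw [Nat.ceil_le, Nat.cast_sub (by omega), Nat.cast_one]
    exact (rpow_size_le_sqrt hα' (by omega)).trans h1
  omega

theorem size_eq_min (h1 : p.s 1 < n)
    (hstep : ∀ l, 1 ≤ l → l ≤ p.lbar →
      (p.s (l + 1) : ℝ) = min (r ^ (2 * l) * (p.s 1 : ℝ)) (n : ℝ)) {l : ℕ} (hl : l ≤ p.lbar) :
    (p.s (l + 1) : ℝ) = min (r ^ (2 * l) * (p.s 1 : ℝ)) (n : ℝ) := by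
  rcases Nat.eq_zero_or_pos l with rfl | h
  · rw [mul_zero, pow_zero, one_mul, min_eq_left (by exact_mod_cast h1.le)]
  · exact hstep l h hl

theorem validPlan_of_step (hr : 1 < r) (h0 : 1 ≤ p.s 1) (h1 : p.s 1 < n)
    (hstep : ∀ l, 1 ≤ l → l ≤ p.lbar →
      (p.s (l + 1) : ℝ) = min (r ^ (2 * l) * (p.s 1 : ℝ)) (n : ℝ))
    (hlast : (n : ℝ) ≤ r ^ (2 * p.lbar) * (p.s 1 : ℝ)) : ValidPlan n p where
  one_le := h0
  lt := h1
  mono l hl hlb := by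
    have e1 := size_eq_min h1 hstep hlb
    have e2 := size_eq_min h1 hstep (show l - 1 ≤ p.lbar by omega)
    rw [Nat.sub_add_cancel hl] at e2
    have : (p.s l : ℝ) ≤ p.s (l + 1) := by
      rw [e1, e2]
      gcongr
      · exact hr.le
      · omega
    exact_mod_cast this
  last := by
    have e := size_eq_min h1 hstep le_rfl
    rw [min_eq_right hlast] at e
    exact_mod_cast e

theorem NonroundedSizes.one_le_lbar (h : NonroundedSizes α r n p) (hα' : α ≤ 1 / 2) (hn : 2 ≤ n) :
    1 ≤ p.lbar := by
  by_contra! h0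
  have h1 := h.lbar_least.1
  rw [show p.lbar = 0 by omega] at h1
  simp only [Set.mem_ofPred_eq, mul_zero, pow_zero, one_mul] at h1
  exact absurd (h1.trans (rpow_size_le_sqrt hα' hn)) (not_le.2 (sqrt_lt_size hn))

theorem NonroundedSizes.validPlan (h : NonroundedSizes α r n p) (hα : 0 < α) (hα' : α ≤ 1 / 2)
    (hn : 2 ≤ n) : ValidPlan n p where
  one_le := by
    have h1 := h.size 1 le_rfl (h.one_le_lbar hα' hn)
    have h2 := one_le_rpow_size hα hn
    simp only [Nat.sub_self, mul_zero, pow_zero, one_mul] at h1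
    rcases h1 with h1 | h1 <;> rw [h1]
    · exact Nat.le_floor (by simpa using h2)
    · exact Nat.one_le_iff_ne_zero.2 (Nat.ceil_pos.2 (by linarith)).ne'
  lt := h.lt 1 le_rfl (h.one_le_lbar hα' hn)
  mono := h.mono
  last := h.last

theorem RoundedSizes.first_bounds (h : RoundedSizes α r n p) (hα : 0 < α) (hn : 2 ≤ n) :
    1 ≤ p.s 1 ∧ p.s 1 < n := by
  rw [h.first]
  have h2 := one_le_rpow_size hα hn
  refine ⟨le_min ?_ (by omega), (min_le_right _ _).trans_lt (by omega)⟩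
  exact Nat.one_le_iff_ne_zero.2 (Nat.ceil_pos.2 (by linarith)).ne'

theorem RoundedSizes.validPlan (h : RoundedSizes α r n p) (hα : 0 < α) (hr : 1 < r)
    (hn : 2 ≤ n) : ValidPlan n p :=
  validPlan_of_step hr (h.first_bounds hα hn).1 (h.first_bounds hα hn).2 h.step h.lbar_least.1

theorem RoundedSizes.one_le_lbar (h : RoundedSizes α r n p) (hα : 0 < α) (hn : 2 ≤ n) :
    1 ≤ p.lbar := by
  by_contra! h0
  have h1 := h.lbar_least.1
  rw [show p.lbar = 0 by omega] at h1
  simp only [Set.mem_ofPred_eq, mul_zero, pow_zero, one_mul] at h1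
  have h2 := (h.first_bounds hα hn).2
  exact absurd h1 (not_le.2 (by exact_mod_cast h2))

theorem ReducedSizes.one_le_lbar (h : ReducedSizes α r n p) (hα' : α ≤ 1 / 2) (hn : 2 ≤ n) :
    1 ≤ p.lbar := by
  by_contra! h0
  have h1 := h.lbar_least.1
  rw [show p.lbar = 0 by omega] at h1
  simp only [Set.mem_ofPred_eq, mul_zero, pow_zero, one_mul] at h1
  exact absurd (h1.trans (rpow_size_le_sqrt hα' hn)) (not_le.2 (sqrt_lt_size hn))

theorem ReducedSizes.first_le (h : ReducedSizes α r n p) (hr : 1 < r) :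
    p.s 1 ≤ ⌈(n : ℝ) ^ α⌉₊ := by
  rw [h.first]
  refine Nat.ceil_mono ?_
  rw [div_le_iff₀ (by positivity), mul_comm]
  exact h.lbar_least.1

theorem ReducedSizes.last_le (h : ReducedSizes α r n p) (hr : 1 < r) :
    (n : ℝ) ≤ r ^ (2 * p.lbar) * (p.s 1 : ℝ) := by
  rw [h.first, ← div_le_iff₀' (by positivity)]
  exact Nat.le_ceil _

theorem ReducedSizes.validPlan (h : ReducedSizes α r n p) (hα' : α ≤ 1 / 2) (hr : 1 < r)
    (hn : 3 ≤ n) : ValidPlan n p := by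
  refine validPlan_of_step hr ?_ ((h.first_le hr).trans_lt (ceil_rpow_size_lt hα' hn)) h.step
    (h.last_le hr)
  have hn0 : (0 : ℝ) < n := by exact_mod_cast (by omega : 0 < n)
  rw [h.first]
  exact Nat.one_le_iff_ne_zero.2 (Nat.ceil_pos.2 (by positivity)).ne'

theorem Admissible.cases (h : Admissible α r η n p) :
    NonroundedSizes α r n p ∨ RoundedSizes α r n p ∨ (ReducedSizes α r n p ∧ 3 ≤ n) := by
  rcases h with h | h | h
  · exact Or.inl h
  · exact Or.inr (Or.inl h)
  · rcases le_or_gt (max ((r ^ 2 / (η * r ^ 2 - 1)) ^ (1 / α)) 3) (n : ℝ) with hc | hc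
    · refine Or.inr (Or.inr ⟨h.1 hc, ?_⟩)
      exact_mod_cast (le_max_right _ _).trans hc
    · exact Or.inr (Or.inl (h.2 hc))

theorem Admissible.validPlan (h : Admissible α r η n p) (hα : 0 < α) (hα' : α ≤ 1 / 2)
    (hr : 1 < r) (hn : 2 ≤ n) : ValidPlan n p := by
  rcases h.cases with h | h | ⟨h, h3⟩
  · exact h.validPlan hα hα' hn
  · exact h.validPlan hα hr hn
  · exact h.validPlan hα' hr h3

theorem Admissible.lbar_le (h : Admissible α r η n p) (hα : 0 < α) (hr : 1 < r) (hn : 2 ≤ n)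
    {m : ℕ} (hm : (n : ℝ) ≤ r ^ (2 * m)) : p.lbar ≤ m := by
  have h1 : (n : ℝ) ≤ r ^ (2 * m) * (n : ℝ) ^ α :=
    hm.trans (le_mul_of_one_le_right (by positivity) (one_le_rpow_size hα hn))
  rcases h.cases with h | h | ⟨h, -⟩
  · exact h.lbar_least.2 h1
  · refine h.lbar_least.2 (hm.trans (le_mul_of_one_le_right (by positivity) ?_))
    exact_mod_cast (h.first_bounds hα hn).1
  · exact h.lbar_least.2 h1

/-- Sample sizes that are within `1` of the geometric progression `y r ^ (2 (l - 1))`. -/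
structure GeometricPlan (α r : ℝ) (n : ℕ) (p : Plan) (y : ℝ) : Prop where
  valid : ValidPlan n p
  one_le_lbar : 1 ≤ p.lbar
  size_le : ∀ l, l + 1 ≤ p.lbar → (p.s (l + 1) : ℝ) ≤ y * r ^ (2 * l) + 1
  le_size : ∀ l, l + 1 ≤ p.lbar → y * r ^ (2 * l) ≤ (p.s (l + 1) : ℝ) + 1
  le_last : (n : ℝ) ≤ y * r ^ (2 * p.lbar)
  last_le : y * r ^ (2 * (p.lbar - 1)) ≤ n
  le_first : (n : ℝ) ^ α ≤ r ^ 2 * y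
  first_le : (p.s 1 : ℝ) ≤ 2 * √n

theorem geometricPlan_of_step (hr : 1 < r) (hv : ValidPlan n p) (hb : 1 ≤ p.lbar)
    (hstep : ∀ l, 1 ≤ l → l ≤ p.lbar →
      (p.s (l + 1) : ℝ) = min (r ^ (2 * l) * (p.s 1 : ℝ)) (n : ℝ))
    (hlast : (n : ℝ) ≤ r ^ (2 * p.lbar) * (p.s 1 : ℝ))
    (hlast' : r ^ (2 * (p.lbar - 1)) * (p.s 1 : ℝ) ≤ n)
    (hfirst : (n : ℝ) ^ α ≤ r ^ 2 * p.s 1) (hfirst' : (p.s 1 : ℝ) ≤ 2 * √n) :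
    GeometricPlan α r n p (p.s 1) := by
  have hsize : ∀ l, l + 1 ≤ p.lbar → (p.s (l + 1) : ℝ) = (p.s 1 : ℝ) * r ^ (2 * l) := by
    intro l hl
    rw [size_eq_min hv.lt hstep (by omega), mul_comm, min_eq_left]
    refine le_trans ?_ hlast'
    rw [mul_comm]
    gcongr
    · exact hr.le
    · omega
  exact
    { valid := hv
      one_le_lbar := hb
      size_le := fun l hl => by rw [hsize l hl]; linarith
      le_size := fun l hl => by rw [hsize l hl]; linarith
      le_last := by rwa [mul_comm]
      last_le := by rwa [mul_comm]
      le_first := hfirst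
      first_le := hfirst' }

theorem Admissible.geometric (h : Admissible α r η n p) (hα : 0 < α) (hα' : α ≤ 1 / 2)
    (hr : 1 < r) (hn : 3 ≤ n) (hlarge : r ^ 2 / (r ^ 2 - 1) ≤ (n : ℝ) ^ α) :
    ∃ y, GeometricPlan α r n p y := by
  have hv := h.validPlan hα hα' hr (by omega)
  have hn1 : (1 : ℝ) ≤ n := by exact_mod_cast (by omega : 1 ≤ n)
  have hpow := one_le_rpow_size hα (show 2 ≤ n by omega)
  have hsqrt := rpow_size_le_sqrt hα' (show 2 ≤ n by omega)
  have hceil : (⌈(n : ℝ) ^ α⌉₊ : ℝ) ≤ 2 * √n := by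
    have := Nat.ceil_lt_add_one (show (0 : ℝ) ≤ (n : ℝ) ^ α by positivity)
    linarith
  have hr2 : 1 < r ^ 2 := one_lt_pow₀ hr two_ne_zero
  rcases h.cases with h | h | ⟨h, -⟩
  · have hb := h.one_le_lbar hα' (by omega)
    have hsize := fun l (hl : l + 1 ≤ p.lbar) => h.size (l + 1) (by omega) hl
    simp only [Nat.add_sub_cancel] at hsize
    refine ⟨(n : ℝ) ^ α, hv, hb, fun l hl => ?_, fun l hl => ?_, ?_, ?_, ?_, ?_⟩
    · rw [mul_comm ((n : ℝ) ^ α)]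
      have hx : 0 ≤ r ^ (2 * l) * (n : ℝ) ^ α := by positivity
      rcases hsize l hl with e | e <;> rw [e]
      · exact (Nat.floor_le hx).trans (by linarith)
      · exact (Nat.ceil_lt_add_one hx).le
    · rw [mul_comm ((n : ℝ) ^ α)]
      rcases hsize l hl with e | e <;> rw [e]
      · exact (Nat.lt_floor_add_one _).le
      · exact (Nat.le_ceil _).trans (by linarith)
    · rw [mul_comm]; exact h.lbar_least.1
    · rw [mul_comm]
      by_contra! hlt
      have := h.lbar_least.2 (show p.lbar - 1 ∈ _ from hlt.le)
      omega
    · exact le_mul_of_one_le_left (by positivity) hr2.le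
    · have e := hsize 0 hb
      simp only [mul_zero, pow_zero, one_mul, zero_add] at e
      refine le_trans ?_ hceil
      rcases e with e | e <;> rw [e]
      exact_mod_cast Nat.floor_le_ceil _
  · refine ⟨_, geometricPlan_of_step hr hv (h.one_le_lbar hα (by omega)) h.step h.lbar_least.1
      ?_ ?_ ?_⟩
    · by_contra! hlt
      have := h.lbar_least.2 (show p.lbar - 1 ∈ _ from hlt.le)
      have := h.one_le_lbar hα (by omega)
      omega
    · have hle : (n : ℝ) ^ α ≤ p.s 1 := by
        have := ceil_rpow_size_lt hα' hn
        rw [h.first, min_eq_left (by omega)]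
        exact Nat.le_ceil _
      nlinarith
    · refine le_trans ?_ hceil
      rw [h.first]
      exact_mod_cast min_le_left _ _
  · have hb := h.one_le_lbar hα' (by omega)
    have hlt : r ^ (2 * (p.lbar - 1)) * (n : ℝ) ^ α < n := by
      by_contra! hle
      have := h.lbar_least.2 (show p.lbar - 1 ∈ _ from hle)
      omega
    have hrpow : r ^ (2 * p.lbar) = r ^ 2 * r ^ (2 * (p.lbar - 1)) := by
      rw [← pow_add]; congr 1; omega
    have hpos : 0 < r ^ (2 * (p.lbar - 1)) := by positivity
    refine ⟨_, geometricPlan_of_step hr hv hb h.step (h.last_le hr) ?_ ?_ ?_⟩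
    · have h1 : (p.s 1 : ℝ) ≤ n / r ^ (2 * p.lbar) + 1 := by
        rw [h.first]
        exact (Nat.ceil_lt_add_one (by positivity)).le
      rw [div_le_iff₀ (by linarith)] at hlarge
      calc r ^ (2 * (p.lbar - 1)) * (p.s 1 : ℝ)
          ≤ r ^ (2 * (p.lbar - 1)) * (n / r ^ (2 * p.lbar) + 1) := by gcongr
        _ = n / r ^ 2 + r ^ (2 * (p.lbar - 1)) := by
          rw [hrpow]; field_simp
        _ ≤ n := by
          have h2 : r ^ 2 * r ^ (2 * (p.lbar - 1)) ≤ (r ^ 2 - 1) * n := by nlinarith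
          have h3 : r ^ (2 * (p.lbar - 1)) ≤ (r ^ 2 - 1) * n / r ^ 2 := by
            rw [le_div_iff₀ (by positivity)]; linarith
          have h4 : (r ^ 2 - 1) * n / r ^ 2 = n - n / r ^ 2 := by field_simp
          linarith
    · have h1 := h.last_le hr
      rw [hrpow] at h1
      by_contra! hc
      nlinarith
    · exact (Nat.cast_le.2 (h.first_le hr)).trans hceil

namespace GeometricPlan

variable {y : ℝ}

theorem size_le_mul (h : GeometricPlan α r n p y) (hr : 1 < r) {l : ℕ} (hl : 1 ≤ l)
    (hlb : l ≤ p.lbar) : (p.s (l + 1) : ℝ) ≤ 3 * r ^ 2 * p.s l := by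
  obtain ⟨l, rfl⟩ := Nat.exists_eq_add_of_le' hl
  have h1 := h.le_size l hlb
  have h2 : (1 : ℝ) ≤ p.s (l + 1) := by
    exact_mod_cast h.valid.one_le_size hl (by omega)
  have hr2 : 1 < r ^ 2 := one_lt_pow₀ hr two_ne_zero
  have e : r ^ (2 * (l + 1)) = r ^ 2 * r ^ (2 * l) := by rw [← pow_add]; congr 1; omega
  have h3 : y * r ^ (2 * (l + 1)) ≤ r ^ 2 * (p.s (l + 1) + 1) := by
    rw [e, mul_left_comm]
    gcongr
  rcases hlb.eq_or_lt with hlast | hlt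
  · rw [hlast, h.valid.last, ← hlast]
    have h4 := h.le_last
    rw [← hlast] at h4
    nlinarith
  · have h4 := h.size_le (l + 1) hlt
    nlinarith

theorem mul_size_le (h : GeometricPlan α r n p y) {l : ℕ} (hl : 1 ≤ l)
    (hlb : l + 1 ≤ p.lbar) : r ^ 2 * (p.s l : ℝ) ≤ p.s (l + 1) + (r ^ 2 + 1) := by
  obtain ⟨l, rfl⟩ := Nat.exists_eq_add_of_le' hl
  have h1 := h.size_le l (by omega)
  have h2 := h.le_size (l + 1) hlb
  have e : r ^ (2 * (l + 1)) = r ^ 2 * r ^ (2 * l) := by rw [← pow_add]; congr 1; omega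
  rw [e] at h2
  nlinarith [sq_nonneg r]

theorem le_size_of_large (h : GeometricPlan α r n p y) (hr : 1 < r) (hn : 2 * r ^ 2 ≤ (n : ℝ) ^ α)
    {l : ℕ} (hl : 1 ≤ l) (hlb : l ≤ p.lbar + 1) : (n : ℝ) ^ α / (2 * r ^ 2) ≤ p.s l := by
  have h1 := h.le_size 0 h.one_le_lbar
  have h2 : (p.s 1 : ℝ) ≤ p.s l := by exact_mod_cast h.valid.size_mono le_rfl hl hlb
  simp only [mul_zero, pow_zero, mul_one, zero_add] at h1
  have h3 := h.le_first
  have hr2 : 0 < r ^ 2 := by positivity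
  rw [div_le_iff₀ (by positivity)]
  have h4 : 2 ≤ y := by
    by_contra! hlt
    nlinarith
  nlinarith

theorem sum_sqrt_le (h : GeometricPlan α r n p y) (hr : 1 < r) (hy : 1 ≤ y) :
    ∑ j ∈ Finset.range p.lbar, √(p.s (1 + j) : ℝ) ≤ 2 * r / (r - 1) * √n := by
  have hr1 : 0 < r - 1 := by linarith
  have h1 : ∀ j ∈ Finset.range p.lbar, √(p.s (1 + j) : ℝ) ≤ 2 * √y * r ^ j := by
    intro j hj
    have h2 := h.size_le j (Finset.mem_range.1 hj)
    rw [add_comm 1 j, Real.sqrt_le_left (by positivity), mul_pow, mul_pow, Real.sq_sqrt (by linarith),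
      ← pow_mul, mul_comm j 2]
    have h3 : 1 ≤ r ^ (2 * j) := one_le_pow₀ hr.le
    nlinarith
  refine (Finset.sum_le_sum h1).trans ?_
  rw [← Finset.mul_sum, geom_sum_eq hr.ne']
  have h4 : √y * r ^ p.lbar ≤ r * √n := by
    have e : r ^ p.lbar = r * r ^ (p.lbar - 1) := by
      rw [← pow_succ']; congr 1; have := h.one_le_lbar; omega
    rw [e, mul_left_comm]
    gcongr
    refine Real.le_sqrt_of_sq_le ?_
    rw [mul_pow, Real.sq_sqrt (by linarith), ← pow_mul, mul_comm _ 2]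
    exact h.last_le
  have h5 : 0 ≤ √y := Real.sqrt_nonneg _
  calc 2 * √y * ((r ^ p.lbar - 1) / (r - 1)) = 2 * (√y * r ^ p.lbar - √y) / (r - 1) := by ring
    _ ≤ 2 * (r * √n) / (r - 1) := by gcongr; linarith
    _ = _ := by ring

theorem lbar_le (h : GeometricPlan α r n p y) (hr : 1 < r) (hn0 : 1 ≤ n)
    (hn : 2 * r ^ 2 ≤ (n : ℝ) ^ α) :
    (p.lbar : ℝ) ≤ 4 * r ^ 2 / (r - 1) * (n : ℝ) ^ (1 / 2 - α / 2) := by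
  have hr1 : 0 < r - 1 := by linarith
  have hnpos : (0 : ℝ) < n := by exact_mod_cast hn0
  have hy : 1 ≤ y := by
    have h3 := h.le_first
    by_contra! hlt
    nlinarith [sq_nonneg r]
  have hpow : (n : ℝ) ^ (α / 2) / (2 * r) ≤ √((n : ℝ) ^ α / (2 * r ^ 2)) := by
    refine Real.le_sqrt_of_sq_le ?_
    rw [div_pow, ← Real.rpow_natCast, ← Real.rpow_mul hnpos.le]
    norm_num
    rw [mul_pow]
    gcongr
    norm_num
  have h1 : ∀ j ∈ Finset.range p.lbar, (n : ℝ) ^ (α / 2) / (2 * r) ≤ √(p.s (1 + j) : ℝ) := by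
    intro j hj
    refine hpow.trans (Real.sqrt_le_sqrt ?_)
    exact h.le_size_of_large hr hn (by omega) (by have := Finset.mem_range.1 hj; omega)
  have h2 := (Finset.card_nsmul_le_sum _ _ _ h1).trans (h.sum_sqrt_le hr hy)
  rw [Finset.card_range, nsmul_eq_mul] at h2
  have hP : 0 < (n : ℝ) ^ (α / 2) := by positivity
  have e : √(n : ℝ) = (n : ℝ) ^ (1 / 2 - α / 2) * (n : ℝ) ^ (α / 2) := by
    rw [← Real.rpow_add hnpos, Real.sqrt_eq_rpow]; congr 1; ring
  rw [e] at h2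
  refine le_of_mul_le_mul_right ?_ (show 0 < (n : ℝ) ^ (α / 2) / (2 * r) by positivity)
  refine h2.trans (le_of_eq ?_)
  field_simp
  ring

end GeometricPlan

end Sizes

/-! ### The gaps make failures rare -/

theorem gap_scaling {s t β ℓ ℓ' ρ : ℝ} (hs : 0 < s) (ht : 0 < t) (hβ : 0 ≤ β) (hℓ : 0 ≤ ℓ)
    (hρ : 0 ≤ ρ) (hρ1 : ρ ≤ 1) (h : s * ℓ' ≤ ρ ^ 2 * ℓ * t) :
    √(β * t * ℓ') * s / t ≤ √(β * s * ℓ) ∧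
      2 * (1 - ρ) ^ 2 * β * ℓ ≤ 2 * (√(β * s * ℓ) - √(β * t * ℓ') * s / t) ^ 2 / s := by
  have hg : 0 ≤ √(β * s * ℓ) := Real.sqrt_nonneg _
  have h1 : √(β * t * ℓ') * s / t ≤ ρ * √(β * s * ℓ) := by
    have e1 : √(β * t * ℓ') * s / t = √(β * t * ℓ' * (s / t) ^ 2) := by
      rw [Real.sqrt_mul' _ (sq_nonneg _), Real.sqrt_sq (by positivity), mul_div_assoc]
    have e2 : ρ * √(β * s * ℓ) = √(ρ ^ 2 * (β * s * ℓ)) := by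
      rw [Real.sqrt_mul (sq_nonneg _), Real.sqrt_sq hρ]
    rw [e1, e2]
    refine Real.sqrt_le_sqrt ?_
    have e3 : β * t * ℓ' * (s / t) ^ 2 = β * s * (s * ℓ') / t := by field_simp
    rw [e3, div_le_iff₀ ht]
    have := mul_le_mul_of_nonneg_left h (show 0 ≤ β * s by positivity)
    linarith
  refine ⟨h1.trans (mul_le_of_le_one_left hg hρ1), ?_⟩
  rw [le_div_iff₀ hs]
  have h2 : (1 - ρ) * √(β * s * ℓ) ≤ √(β * s * ℓ) - √(β * t * ℓ') * s / t := by linarith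
  have h3 : ((1 - ρ) * √(β * s * ℓ)) ^ 2 ≤ (√(β * s * ℓ) - √(β * t * ℓ') * s / t) ^ 2 :=
    pow_le_pow_left₀ (mul_nonneg (by linarith) hg) h2 2
  rw [mul_pow, Real.sq_sqrt (by positivity)] at h3
  linarith

theorem exp_neg_le_div_sqrt {s c x : ℝ} (hs : 0 < s) (h : Real.log s / 2 - c ≤ x) :
    Real.exp (-x) ≤ Real.exp c / √s := by
  have e : Real.exp c / √s = Real.exp (c - Real.log s / 2) := by
    rw [Real.exp_sub, Real.exp_half, Real.exp_log hs]
  rw [e]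
  exact Real.exp_le_exp.2 (by linarith)

/-- The properties of the sample sizes and gaps that the cost estimate needs, with a constant `a`
that does not depend on the input size `n`. -/
structure GoodPlan (α a : ℝ) (n : ℕ) (p : Plan) (gap : ℕ → ℕ → ℝ) : Prop where
  valid : ValidPlan n p
  first_le : (p.s 1 : ℝ) ≤ 2 * √n
  size_le : ∀ l, 1 ≤ l → l ≤ p.lbar → (p.s (l + 1) : ℝ) ≤ a * p.s l
  sum_sqrt_le : ∑ j ∈ Finset.range p.lbar, √(p.s (1 + j) : ℝ) ≤ a * √n
  lbar_le : (p.lbar : ℝ) ≤ a * (n : ℝ) ^ (1 / 2 - α / 2)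
  gap_le : ∀ l, 1 ≤ l → l ≤ p.lbar → gap n (p.s l) ≤ a * √(p.s l * Real.log n)
  next_gap_le : ∀ l, 1 ≤ l → l ≤ p.lbar →
    gapAt gap n p (l + 1) * p.s l / p.s (l + 1) ≤ gap n (p.s l)
  tail_le : ∀ l, 1 ≤ l → l ≤ p.lbar →
    Real.exp (-(2 * (gap n (p.s l) - gapAt gap n p (l + 1) * p.s l / p.s (l + 1)) ^ 2 / p.s l)) ≤
      a / √(p.s l)

section Gaps

variable {α r η β : ℝ}

theorem quarter_le_of_gap (hr : 1 < r) (hβ : 1 / (4 * (1 - 1 / r) ^ 2) ≤ β) :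
    1 / 4 ≤ β ∧ 1 / 4 ≤ β * (1 - 1 / r) ^ 2 := by
  have h1 : 1 / r < 1 := (div_lt_one (by linarith)).2 hr
  have h2 : 0 < 1 / r := by positivity
  have h3 : 0 < (1 - 1 / r) ^ 2 := by
    have : 0 < 1 - 1 / r := by linarith
    positivity
  rw [div_le_iff₀ (by positivity)] at hβ
  have h4 : 1 / 4 ≤ β * (1 - 1 / r) ^ 2 := by linarith
  have h5 : (1 - 1 / r) ^ 2 ≤ 1 := pow_le_one₀ (by linarith) (by linarith)
  have hβ0 : 0 < β := by
    by_contra! h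
    nlinarith
  exact ⟨by nlinarith, h4⟩

/-- The gaps `√(β s ln n)`. The ratio of consecutive sample sizes is only within `O(1 / s)` of
`r ^ 2`, which costs a constant factor in the probability because of `ln n ≤ s`. -/
theorem gapN_tail (hr : 1 < r) (hβ : 1 / (4 * (1 - 1 / r) ^ 2) ≤ β) {n s t : ℕ}
    (hs : 1 ≤ s) (hst : s ≤ t) (htn : t ≤ n) (hrt : r ^ 2 * (s : ℝ) ≤ t + (r ^ 2 + 1))
    (hlarge : (r ^ 2 + 1) / (r - 1) ≤ (s : ℝ)) (hlog : Real.log n ≤ s) :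
    gapN β n t * s / t ≤ gapN β n s ∧
      Real.exp (-(2 * (gapN β n s - gapN β n t * s / t) ^ 2 / s)) ≤
        Real.exp (4 * β * (r ^ 2 + 1)) / √s := by
  obtain ⟨hβ1, hβ2⟩ := quarter_le_of_gap hr hβ
  have hs0 : (0 : ℝ) < s := by exact_mod_cast hs
  have ht0 : (0 : ℝ) < t := by exact_mod_cast (by omega : 0 < t)
  have hst' : (s : ℝ) ≤ t := by exact_mod_cast hst
  have hsn : (s : ℝ) ≤ n := by exact_mod_cast hst.trans htn
  have hL : 0 ≤ Real.log n := Real.log_natCast_nonneg n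
  have hr1 : 0 < r - 1 := by linarith
  have hκ0 : 0 < 1 / r := by positivity
  have hκ1 : 1 / r < 1 := (div_lt_one (by linarith)).2 hr
  set x : ℝ := (r ^ 2 + 1) / t with hx
  have hx0 : 0 ≤ x := by positivity
  have hxr : x ≤ r - 1 := by
    rw [hx, div_le_iff₀ ht0]
    rw [div_le_iff₀ hr1] at hlarge
    nlinarith
  set ρ : ℝ := 1 / r * (1 + x) with hρ
  have hρ0 : 0 ≤ ρ := by positivity
  have hρ1 : ρ ≤ 1 := by
    rw [hρ, div_mul_eq_mul_div, one_mul, div_le_one (by linarith)]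
    linarith
  have hscale : (s : ℝ) * Real.log n ≤ ρ ^ 2 * Real.log n * t := by
    have h1 : (s : ℝ) ≤ ρ ^ 2 * t := by
      have e1 : ρ ^ 2 * t = (1 + x) * (t + (r ^ 2 + 1)) / r ^ 2 := by
        rw [hρ, hx]; field_simp
      rw [e1, le_div_iff₀ (by positivity)]
      nlinarith
    nlinarith
  obtain ⟨h1, h2⟩ := gap_scaling (β := β) hs0 ht0 (by linarith) hL hρ0 hρ1 hscale
  refine ⟨h1, exp_neg_le_div_sqrt hs0 (le_trans ?_ h2)⟩
  have h3 : (1 - 1 / r) ^ 2 - 2 * x ≤ (1 - ρ) ^ 2 := by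
    have h4 : 1 - ρ = (1 - 1 / r) - 1 / r * x := by rw [hρ]; ring
    rw [h4]
    have h5 : (1 - 1 / r) * (1 / r * x) ≤ x := by
      have : (1 - 1 / r) * (1 / r) ≤ 1 := by nlinarith
      nlinarith
    nlinarith [sq_nonneg (1 / r * x)]
  have h4 : Real.log s ≤ Real.log n := Real.log_le_log hs0 hsn
  have h5 : x * Real.log n ≤ r ^ 2 + 1 := by
    rw [hx, div_mul_eq_mul_div, div_le_iff₀ ht0]
    have := sq_nonneg r
    gcongr
    linarith
  have hβL : 0 ≤ 2 * β * Real.log n := by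
    have : 0 ≤ β := by linarith
    positivity
  have h6 := mul_le_mul_of_nonneg_left h3 hβL
  have h7 : 4 * β * (x * Real.log n) ≤ 4 * β * (r ^ 2 + 1) := by gcongr
  have h8 := mul_le_mul_of_nonneg_right hβ2 hL
  linarith

/-- The gaps `√(β s ln s)`. The strict inequality for `β` absorbs the deviations of
`ln s (l + 1)` from `ln s l` and of the ratio of consecutive sample sizes from `r ^ 2`. -/
theorem gapS_tail (hr : 1 < r) (hβ : 1 / (4 * (1 - 1 / r) ^ 2) < β) :
    ∃ s₀ : ℝ, ∀ n s t : ℕ, s₀ ≤ s → 1 ≤ s → s ≤ t →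
      r ^ 2 * (s : ℝ) ≤ t + (r ^ 2 + 1) → (t : ℝ) ≤ 3 * r ^ 2 * s →
      gapS β n t * s / t ≤ gapS β n s ∧
        Real.exp (-(2 * (gapS β n s - gapS β n t * s / t) ^ 2 / s)) ≤ 1 / √s := by
  obtain ⟨hβ1, hβ2⟩ := quarter_le_of_gap hr hβ.le
  have hβ0 : 0 < β := by linarith
  have hκ0 : 0 < 1 / r := by positivity
  have hκ1 : 1 / r < 1 := (div_lt_one (by linarith)).2 hr
  have hr2 : 1 < r ^ 2 := one_lt_pow₀ hr two_ne_zero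
  -- `ρ` is such that `2 β (1 - ρ) ^ 2 = 1 / 2`
  set ρ : ℝ := 1 - 1 / (2 * √β) with hρ
  have hsβ : 0 < √β := Real.sqrt_pos.2 hβ0
  have hsq : √β ^ 2 = β := Real.sq_sqrt hβ0.le
  have hρκ : 1 / r < ρ := by
    have h1 : 1 < 2 * √β * (1 - 1 / r) := by
      have h2 : 1 < 4 * (1 - 1 / r) ^ 2 * β := by
        rw [div_lt_iff₀ (by have : 0 < 1 - 1 / r := by linarith
                            positivity)] at hβ
        linarith
      by_contra! hle
      have h3 : (2 * √β * (1 - 1 / r)) ^ 2 ≤ 1 :=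
        pow_le_one₀ (mul_nonneg (by positivity) (by linarith)) hle
      rw [mul_pow, mul_pow, hsq] at h3
      linarith
    have h3 : 1 / (2 * √β) < 1 - 1 / r := by
      rw [div_lt_iff₀ (by positivity)]; linarith
    rw [hρ]; linarith
  have hρ1 : ρ ≤ 1 := by
    have : 0 < 1 / (2 * √β) := by positivity
    rw [hρ]; linarith
  have hρβ : 2 * (1 - ρ) ^ 2 * β = 1 / 2 := by
    rw [hρ, ← hsq]; field_simp; norm_num
  have hρ0 : 0 ≤ ρ := by linarith
  have hlim : Filter.Tendsto
      (fun x : ℝ => (1 + (r ^ 2 + 1) / x) * (1 + Real.log (3 * r ^ 2) / Real.log x))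
      Filter.atTop (nhds ((1 + 0) * (1 + 0))) := by
    refine Filter.Tendsto.mul ?_ ?_
    · exact tendsto_const_nhds.add (tendsto_const_nhds.div_atTop Filter.tendsto_id)
    · exact tendsto_const_nhds.add (tendsto_const_nhds.div_atTop Real.tendsto_log_atTop)
  have hrρ : (1 + 0) * (1 + 0) < (r * ρ) ^ 2 := by
    have : 1 < r * ρ := by
      rw [div_lt_iff₀ (by linarith)] at hρκ
      linarith
    have := one_lt_pow₀ this two_ne_zero
    linarith
  obtain ⟨s₀, hs₀⟩ := Filter.eventually_atTop.1 (hlim.eventually (gt_mem_nhds hrρ))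
  refine ⟨max s₀ 3, fun n s t hss hs hst hrt hts => ?_⟩
  have hs3 : (3 : ℝ) ≤ s := (le_max_right _ _).trans hss
  have hs0 : (0 : ℝ) < s := by linarith
  have hst' : (s : ℝ) ≤ t := by exact_mod_cast hst
  have ht0 : (0 : ℝ) < t := by linarith
  have hlogs : 0 < Real.log s := Real.log_pos (by linarith)
  have hlogt : Real.log t ≤ Real.log (3 * r ^ 2) + Real.log s := by
    rw [← Real.log_mul (by positivity) hs0.ne']
    exact Real.log_le_log ht0 hts
  have hq := (hs₀ s ((le_max_left _ _).trans hss)).le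
  have hscale : (s : ℝ) * Real.log t ≤ ρ ^ 2 * Real.log s * t := by
    have hlogt0 : 0 ≤ Real.log t := Real.log_natCast_nonneg t
    have h1 : r ^ 2 * (s : ℝ) ≤ t * (1 + (r ^ 2 + 1) / s) := by
      have : (r ^ 2 + 1) ≤ t * ((r ^ 2 + 1) / s) := by
        rw [mul_div_assoc', le_div_iff₀ hs0]
        nlinarith
      linarith
    have h2 : Real.log t ≤ Real.log s * (1 + Real.log (3 * r ^ 2) / Real.log s) := by
      rw [mul_add, mul_one, mul_div_cancel₀ _ hlogs.ne']
      linarith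
    have h3 : r ^ 2 * (s : ℝ) * Real.log t ≤
        (t * (1 + (r ^ 2 + 1) / s)) *
          (Real.log s * (1 + Real.log (3 * r ^ 2) / Real.log s)) := by gcongr
    have h4 : (t * Real.log s) * ((1 + (r ^ 2 + 1) / s) *
        (1 + Real.log (3 * r ^ 2) / Real.log s)) ≤ (t * Real.log s) * (r * ρ) ^ 2 := by gcongr
    refine le_of_mul_le_mul_left ?_ (show 0 < r ^ 2 by positivity)
    nlinarith
  obtain ⟨h1, h2⟩ := gap_scaling hs0 ht0 hβ0.le hlogs.le hρ0 hρ1 hscale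
  refine ⟨h1, ?_⟩
  rw [← Real.exp_zero]
  refine exp_neg_le_div_sqrt hs0 (le_trans (le_of_eq ?_) h2)
  rw [hρβ]
  ring

/-- The gap rule: one of the two gaps, with `β` large enough for it. -/
def GapRule (r β : ℝ) (gap : ℕ → ℕ → ℝ) : Prop :=
  (gap = gapN β ∧ 1 / (4 * (1 - 1 / r) ^ 2) ≤ β) ∨
    (gap = gapS β ∧ 1 / (4 * (1 - 1 / r) ^ 2) < β)

theorem GapRule.nonneg {gap : ℕ → ℕ → ℝ} (h : GapRule r β gap) (n s : ℕ) : 0 ≤ gap n s := by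
  rcases h with ⟨rfl, -⟩ | ⟨rfl, -⟩ <;> exact Real.sqrt_nonneg _

theorem GapRule.le {gap : ℕ → ℕ → ℝ} (h : GapRule r β gap) (hβ0 : 0 ≤ β) {n s : ℕ} (hs : 1 ≤ s)
    (hsn : s ≤ n) : gap n s ≤ √β * √(s * Real.log n) := by
  have hs0 : (0 : ℝ) < s := by exact_mod_cast hs
  rw [← Real.sqrt_mul hβ0]
  rcases h with ⟨rfl, -⟩ | ⟨rfl, -⟩
  · unfold gapN
    rw [mul_assoc]
  · unfold gapS
    rw [mul_assoc]
    gcongr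

/-- At the last iteration, where the next gap is `0`. -/
theorem GapRule.tail_last {gap : ℕ → ℕ → ℝ} (h : GapRule r β gap) (hβ : 1 / 4 ≤ β) {n s : ℕ}
    (hs : 1 ≤ s) (hsn : s ≤ n) : Real.exp (-(2 * gap n s ^ 2 / s)) ≤ 1 / √s := by
  have hs0 : (0 : ℝ) < s := by exact_mod_cast hs
  have hlog : 0 ≤ Real.log s := Real.log_natCast_nonneg s
  have hlog' : Real.log s ≤ Real.log n := Real.log_le_log hs0 (by exact_mod_cast hsn)
  have hβ0 : 0 ≤ β := by linarith
  rw [← Real.exp_zero]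
  refine exp_neg_le_div_sqrt hs0 ?_
  rcases h with ⟨rfl, -⟩ | ⟨rfl, -⟩
  · unfold gapN
    rw [Real.sq_sqrt (by have := hlog.trans hlog'; positivity), le_div_iff₀ hs0]
    have h1 : Real.log s / 4 ≤ β * Real.log n := by nlinarith
    nlinarith
  · unfold gapS
    rw [Real.sq_sqrt (by positivity), le_div_iff₀ hs0]
    have h1 : Real.log s / 4 ≤ β * Real.log s := by nlinarith
    nlinarith

theorem tendsto_rpow_natCast (hα : 0 < α) :
    Filter.Tendsto (fun n : ℕ => (n : ℝ) ^ α) Filter.atTop Filter.atTop :=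
  (tendsto_rpow_atTop hα).comp tendsto_natCast_atTop_atTop

theorem eventually_log_le_rpow (hα : 0 < α) {c : ℝ} (hc : 0 < c) :
    ∀ᶠ n : ℕ in Filter.atTop, Real.log n ≤ c * (n : ℝ) ^ α := by
  have h := ((isLittleO_log_rpow_atTop hα).comp_tendsto
    (tendsto_natCast_atTop_atTop (R := ℝ))).bound hc
  filter_upwards [h] with n hn
  simp only [Function.comp_apply, Real.norm_eq_abs] at hn
  rw [abs_of_nonneg (show 0 ≤ (n : ℝ) ^ α by positivity)] at hn
  exact (le_abs_self _).trans hn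

theorem eventually_goodPlan (hα : 0 < α) (hα' : α ≤ 1 / 2) (hr : 1 < r)
    (hβ : 1 / (4 * (1 - 1 / r) ^ 2) ≤ β) :
    ∃ a : ℝ, 1 ≤ a ∧ ∀ᶠ n : ℕ in Filter.atTop, ∀ p gap, Admissible α r η n p →
      GapRule r β gap → GoodPlan α a n p gap := by
  obtain ⟨hβ1, -⟩ := quarter_le_of_gap hr hβ
  have hr1 : 0 < r - 1 := by linarith
  have hr2 : 1 < r ^ 2 := one_lt_pow₀ hr two_ne_zero
  have hβ0 : 0 ≤ β := by linarith
  have e1 : 0 ≤ 4 * r ^ 2 / (r - 1) := by positivity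
  have e2 : 0 < Real.exp (4 * β * (r ^ 2 + 1)) := Real.exp_pos _
  set a : ℝ := 3 * r ^ 2 + 4 * r ^ 2 / (r - 1) + β + Real.exp (4 * β * (r ^ 2 + 1)) with ha
  obtain ⟨s₀, hs₀⟩ : ∃ s₀ : ℝ, 1 / (4 * (1 - 1 / r) ^ 2) < β → ∀ n s t : ℕ, s₀ ≤ s → 1 ≤ s →
      s ≤ t → r ^ 2 * (s : ℝ) ≤ t + (r ^ 2 + 1) → (t : ℝ) ≤ 3 * r ^ 2 * s →
      gapS β n t * s / t ≤ gapS β n s ∧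
        Real.exp (-(2 * (gapS β n s - gapS β n t * s / t) ^ 2 / s)) ≤ 1 / √s := by
    by_cases hc : 1 / (4 * (1 - 1 / r) ^ 2) < β
    · obtain ⟨s₀, h⟩ := gapS_tail hr hc
      exact ⟨s₀, fun _ => h⟩
    · exact ⟨0, fun h => absurd h hc⟩
  refine ⟨a, by linarith, ?_⟩
  have ht := tendsto_rpow_natCast hα
  filter_upwards [Filter.eventually_ge_atTop 3,
    ht.eventually_ge_atTop (r ^ 2 / (r ^ 2 - 1)), ht.eventually_ge_atTop (2 * r ^ 2),
    ht.eventually_ge_atTop ((r ^ 2 + 1) / (r - 1) * (2 * r ^ 2)),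
    ht.eventually_ge_atTop (s₀ * (2 * r ^ 2)),
    eventually_log_le_rpow hα (show 0 < 1 / (2 * r ^ 2) by positivity)]
    with n hn h1 h2 h3 h4 h5 p gap hp hgap
  obtain ⟨y, hy⟩ := hp.geometric hα hα' hr hn h1
  have hr2' : 0 < 2 * r ^ 2 := by positivity
  have hlarge : ∀ l, 1 ≤ l → l ≤ p.lbar → (n : ℝ) ^ α / (2 * r ^ 2) ≤ p.s l :=
    fun l hl hlb => hy.le_size_of_large hr h2 hl (by omega)
  have hone : ∀ l, 1 ≤ l → l ≤ p.lbar + 1 → 1 ≤ p.s l := fun l hl hlb =>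
    hy.valid.one_le_size hl hlb
  have hfrac : ∀ {c c' : ℝ} {s : ℕ}, c ≤ c' → c / √(s : ℝ) ≤ c' / √(s : ℝ) := fun h =>
    div_le_div_of_nonneg_right h (Real.sqrt_nonneg _)
  have htail : ∀ l, 1 ≤ l → l ≤ p.lbar →
      gapAt gap n p (l + 1) * p.s l / p.s (l + 1) ≤ gap n (p.s l) ∧
      Real.exp (-(2 * (gap n (p.s l) - gapAt gap n p (l + 1) * p.s l / p.s (l + 1)) ^ 2 /
        p.s l)) ≤ a / √(p.s l) := by
    intro l hl hlb
    have hs1 := hone l hl (by omega)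
    have hmono := hy.valid.mono l hl hlb
    have hsn := hy.valid.le_last hl (by omega : l ≤ p.lbar + 1)
    have htn := hy.valid.le_last (l := l + 1) (by omega) (by omega)
    rcases hlb.eq_or_lt with rfl | hlt
    · have e : gapAt gap n p (p.lbar + 1) = 0 := if_neg (by omega)
      rw [e, zero_mul, zero_div, sub_zero]
      exact ⟨hgap.nonneg _ _, (hgap.tail_last hβ1 hs1 hsn).trans (hfrac (by linarith))⟩
    · have e : gapAt gap n p (l + 1) = gap n (p.s (l + 1)) := if_pos hlt
      rw [e]
      have hrt := hy.mul_size_le hl hlt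
      have hsl := hlarge l hl hlb
      rcases hgap with ⟨rfl, -⟩ | ⟨rfl, hβ'⟩
      · have h := gapN_tail hr hβ hs1 hmono htn hrt
          (((le_div_iff₀ hr2').2 h3).trans hsl) (h5.trans (by rwa [div_mul_eq_mul_div, one_mul]))
        exact ⟨h.1, h.2.trans (hfrac (by linarith))⟩
      · have h := hs₀ hβ' n _ _ (((le_div_iff₀ hr2').2 h4).trans hsl) hs1 hmono hrt
          (hy.size_le_mul hr hl hlb)
        exact ⟨h.1, h.2.trans (hfrac (by linarith))⟩
  have hsize0 : ∀ l, (0 : ℝ) ≤ p.s l := fun l => Nat.cast_nonneg _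
  have hy1 : 1 ≤ y := by
    have := hy.le_first
    by_contra! hlt
    nlinarith
  exact
    { valid := hy.valid
      first_le := hy.first_le
      size_le := fun l hl hlb => (hy.size_le_mul hr hl hlb).trans
        (mul_le_mul_of_nonneg_right (by linarith) (hsize0 l))
      sum_sqrt_le := by
        refine (hy.sum_sqrt_le hr hy1).trans (mul_le_mul_of_nonneg_right ?_ (Real.sqrt_nonneg _))
        have : 2 * r / (r - 1) ≤ 4 * r ^ 2 / (r - 1) :=
          div_le_div_of_nonneg_right (by nlinarith) hr1.le
        linarith
      lbar_le := (hy.lbar_le hr (by omega) h2).trans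
        (mul_le_mul_of_nonneg_right (by linarith) (by positivity))
      gap_le := fun l hl hlb => by
        refine (hgap.le hβ0 (hone l hl (by omega)) (hy.valid.le_last hl (by omega))).trans
          (mul_le_mul_of_nonneg_right ?_ (Real.sqrt_nonneg _))
        have : √β ≤ 1 + β := Real.sqrt_le_left (by linarith) |>.2 (by nlinarith)
        linarith
      next_gap_le := fun l hl hlb => (htail l hl hlb).1
      tail_le := fun l hl hlb => (htail l hl hlb).2 }

end Gaps

/-! ### The induction on the input size -/

/-- The bound for recursive selections from `m` items, for an arbitrary index. -/
noncomputable def costBound (γ : ℝ) (m : ℕ) : ℝ := 3 / 2 * m + γ * √(m * Real.log m)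

section CostBound

variable {γ : ℝ}

theorem costBound_nonneg (hγ : 0 ≤ γ) (m : ℕ) : 0 ≤ costBound γ m := by
  unfold costBound; positivity

theorem costBound_mono (hγ : 0 ≤ γ) : Monotone (costBound γ) := by
  intro m m' h
  unfold costBound
  rcases Nat.eq_zero_or_pos m with rfl | hm
  · simp only [CharP.cast_eq_zero, mul_zero, zero_mul, Real.sqrt_zero, add_zero]
    positivity
  · have := Real.log_natCast_nonneg m
    gcongr

theorem costBound_le_mul (hγ : 0 ≤ γ) (m : ℕ) : costBound γ m ≤ (3 / 2 + γ) * m := by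
  unfold costBound
  rw [add_mul]
  gcongr
  rw [Real.sqrt_le_left m.cast_nonneg, sq]
  gcongr
  exact Real.log_le_self m.cast_nonneg

theorem costBound_le_sqrt (hγ : 0 ≤ γ) {m n : ℕ} (hmn : m ≤ n) :
    costBound γ m ≤ 3 / 2 * m + γ * √(m * Real.log n) := by
  unfold costBound
  rcases Nat.eq_zero_or_pos m with rfl | hm
  · simp
  · gcongr

/-- A bound that is linear in `m`, so that it can be averaged; `e` is small, and it weighs the
square root against its arguments in the inequality of arithmetic and geometric means. -/
theorem costBound_le_linear (hγ : 0 ≤ γ) {m n : ℕ} (hmn : m ≤ n) {e : ℝ} (he : 0 < e) :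
    costBound γ m ≤ (3 / 2 + γ * e) * m + γ * (Real.log n / (4 * e)) := by
  refine (costBound_le_sqrt hγ hmn).trans ?_
  have hL := Real.log_natCast_nonneg n
  have h : √(m * Real.log n) ≤ e * m + Real.log n / (4 * e) := by
    rw [Real.sqrt_le_left (by positivity)]
    have h1 : (m : ℝ) * Real.log n = 4 * (e * m) * (Real.log n / (4 * e)) := by field_simp
    rw [h1]
    nlinarith [sq_nonneg (e * m - Real.log n / (4 * e))]
  have := mul_le_mul_of_nonneg_left h hγ
  linarith

end CostBound

theorem one_le_log_natCast {n : ℕ} (hn : 3 ≤ n) : 1 ≤ Real.log n := by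
  rw [Real.le_log_iff_exp_le (by exact_mod_cast (by omega : 0 < n))]
  have h : (3 : ℝ) ≤ n := by exact_mod_cast hn
  linarith [Real.exp_one_lt_d9]

section Induction

variable {ι : Type} [DecidableEq ι] {T : Type*} [LinearOrder T] {key : ι → T}
  {gap : ℕ → ℕ → ℝ} {α a γ : ℝ} {n k : ℕ} {p : Plan}

/-- The bounds for the indices of the new pivots that hold for both of them. -/
theorem pivot_index_bounds (hk : 1 ≤ k) (hkn : k ≤ n) {l q : ℕ}
    (hgap : ∀ n s, 0 ≤ gap n s) (hs : 1 ≤ p.s l)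
    (hq : q = iu gap n k p l ∨ q = iv gap n k p l) :
    1 ≤ q ∧ q ≤ p.s l ∧ (k : ℝ) / n * p.s l - gapAt gap n p l ≤ q ∧
      (q : ℝ) ≤ (k : ℝ) / n * p.s l + gapAt gap n p l + 1 := by
  have hij := iu_le_iv (l := l) hgap hk hkn hs
  have hg := gapAt_nonneg hgap n p l
  have hθ : 0 ≤ (k : ℝ) / n := by positivity
  have hlow : (k : ℝ) / n * p.s l - gapAt gap n p l ≤ iu gap n k p l := by
    refine (Nat.le_ceil _).trans ?_
    unfold iu
    exact_mod_cast le_max_left _ _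
  have hhigh : (iv gap n k p l : ℝ) ≤ (k : ℝ) / n * p.s l + gapAt gap n p l + 1 := by
    refine le_trans ?_ (Nat.ceil_lt_add_one (by positivity)).le
    unfold iv
    exact_mod_cast min_le_left _ _
  have hij' : (iu gap n k p l : ℝ) ≤ iv gap n k p l := by exact_mod_cast hij
  rcases hq with rfl | rfl
  · exact ⟨one_le_iu, hij.trans iv_le, hlow, hij'.trans hhigh⟩
  · exact ⟨one_le_iu.trans hij, iv_le, hlow.trans hij', hhigh⟩

/-- The constants in the cost of an iteration, where `g` is the gap, `X` is `√(s ln n)`, `L` is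
`ln n` and `d` bounds the cost caused by a pivot outside of the middle part. -/
theorem step_cost_arith {a γ g X L d : ℝ} (ha : 1 ≤ a) (hγ : 0 ≤ γ) (hg : g ≤ a * X) (hX : 1 ≤ X)
    (hL : 1 ≤ L) (hd : d ≤ 3 / 2 * a ^ 2 * X + γ * (a ^ 2 * L)) :
    a * (g + 1) + 2 * ((3 / 2 + γ * (1 / (24 * a ^ 3))) * (a * (2 * g + 1)) +
        γ * (L / (4 * (1 / (24 * a ^ 3)))) + 2 * (d + (3 / 2 + γ) * a)) ≤
      (23 * a ^ 2 + γ / (4 * a)) * X + γ * (20 * a ^ 3 * L) := by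
  have ha0 : 0 < a := by linarith
  have hX0 : 0 ≤ X := by linarith
  have hL0 : 0 ≤ L := by linarith
  have ha2 : a ≤ a ^ 2 := by rw [sq]; exact le_mul_of_one_le_left ha0.le ha
  have ha3 : a ^ 2 ≤ a ^ 3 := pow_le_pow_right₀ ha (by norm_num)
  have hXa : a ≤ a ^ 2 * X := ha2.trans (le_mul_of_one_le_right (by positivity) hX)
  have hLa : a ≤ a ^ 3 * L := (ha2.trans ha3).trans (le_mul_of_one_le_right (by positivity) hL)
  have h1 : a * g ≤ a ^ 2 * X := by
    rw [sq, mul_assoc]; gcongr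
  have h2 : (3 / 2 + γ * (1 / (24 * a ^ 3))) * (a * (2 * g + 1)) ≤
      9 / 2 * (a ^ 2 * X) + γ / (8 * a) * X := by
    have e : (3 / 2 + γ * (1 / (24 * a ^ 3))) * (3 * (a ^ 2 * X)) =
        9 / 2 * (a ^ 2 * X) + γ / (8 * a) * X := by field_simp; ring
    rw [← e]
    exact mul_le_mul_of_nonneg_left (by linarith) (by positivity)
  have h3 : γ * (L / (4 * (1 / (24 * a ^ 3)))) = 6 * (γ * (a ^ 3 * L)) := by
    field_simp; ring
  have h4 : γ * a ≤ γ * (a ^ 3 * L) := by gcongr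
  have h5 : γ * (a ^ 2 * L) ≤ γ * (a ^ 3 * L) := by gcongr
  have e4 : γ / (4 * a) = 2 * (γ / (8 * a)) := by field_simp; ring
  rw [h3, e4]
  linarith

/-- The average cost of iteration `l`. -/
theorem sum_stepBound_le (ha : 1 ≤ a) (hγ : 0 ≤ γ) (hgap : ∀ n s, 0 ≤ gap n s)
    (hp : GoodPlan α a n p gap) (hn : 3 ≤ n) (hk : 1 ≤ k) (hkn : k ≤ n) {l : ℕ} (hl : 1 ≤ l)
    (hlb : l ≤ p.lbar) {W : Finset ι} (hW : W.card = p.s (l + 1)) :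
    ∑ S ∈ W.powersetCard (p.s l), stepBound (costBound γ) key gap n k p l S W ≤
      ((p.s (l + 1)).choose (p.s l) : ℝ) *
        (((p.s (l + 1) : ℝ) - p.s l) * (1 + min ((k : ℝ) / n) (1 - (k : ℝ) / n)) +
          (23 * a ^ 2 + γ / (4 * a)) * √(p.s l * Real.log n) + γ * (20 * a ^ 3 * Real.log n)) := by
  have hs1 := hp.valid.one_le_size hl (by omega : l ≤ p.lbar + 1)
  have ht1 := hp.valid.one_le_size (l := l + 1) (by omega) (by omega)
  have hst := hp.valid.mono l hl hlb
  have htn := hp.valid.le_last (l := l + 1) (by omega) (by omega)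
  have hL := one_le_log_natCast hn
  have hnpos : (0 : ℝ) < n := by exact_mod_cast (by omega : 0 < n)
  have hθ0 : 0 ≤ (k : ℝ) / n := by positivity
  have hθ1 : (k : ℝ) / n ≤ 1 := (div_le_one hnpos).2 (by exact_mod_cast hkn)
  have hg0 := hgap n (p.s l)
  have hgl : gapAt gap n p l = gap n (p.s l) := if_pos hlb
  have hi : iu gap n k p l = max ⌈(k : ℝ) / n * p.s l - gap n (p.s l)⌉₊ 1 := by
    unfold iu; rw [hgl]
  have hj : iv gap n k p l = min ⌈(k : ℝ) / n * p.s l + gap n (p.s l)⌉₊ (p.s l) := by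
    unfold iv; rw [hgl]
  have hsize : (W.card : ℝ) ≤ a * p.s l := hW ▸ hp.size_le l hl hlb
  have hsW : p.s l ≤ W.card := hW ▸ hst
  have hb : 0 ≤ 3 / 2 + γ := by linarith
  set e : ℝ := 1 / (24 * a ^ 3) with he
  have he0 : 0 < e := by positivity
  have hpart := sum_partitionBound_le (key := key) ha hsW hsize hg0 hi
    ((iu_le_iv hgap hk hkn hs1).trans iv_le) hj hθ0 hθ1
  have hfind : ∀ q, (q = iu gap n k p (l + 1) ∨ q = iv gap n k p (l + 1)) →
      ∑ S ∈ W.powersetCard (p.s l),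
        findBound (costBound γ) key S (iu gap n k p l) (iv gap n k p l) W q ≤
        (W.card.choose (p.s l) : ℝ) *
          ((3 / 2 + γ * e) * (a * (2 * gap n (p.s l) + 1)) + γ * (Real.log n / (4 * e)) +
            2 * (a / √(p.s l) * costBound γ W.card + (3 / 2 + γ) * a)) := by
    intro q hq
    obtain ⟨h1, h2, h3, h4⟩ := pivot_index_bounds hk hkn hgap ht1 hq
    rw [← hW] at h2 h3 h4
    exact sum_findBound_le (key := key) (b := 3 / 2 + γ) (b₁ := 3 / 2 + γ * e)
      (b₀ := γ * (Real.log n / (4 * e))) ha hs1 hsW hsize (costBound_nonneg hγ)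
      (costBound_mono hγ) hb (costBound_le_mul hγ) (by positivity)
      (fun m hm => costBound_le_linear hγ (hm.trans (hW ▸ htn)) he0) hg0 hi hj hθ0 h1 h2 h3 h4
      (hW ▸ hp.next_gap_le l hl hlb) (hW ▸ hp.tail_le l hl hlb)
  have hfu := hfind _ (Or.inl rfl)
  have hfv := hfind _ (Or.inr rfl)
  unfold stepBound
  rw [Finset.sum_add_distrib, Finset.sum_add_distrib]
  refine (add_le_add (add_le_add hpart hfu) hfv).trans ?_
  rw [hW, ← mul_add, ← mul_add]
  refine mul_le_mul_of_nonneg_left ?_ (Nat.cast_nonneg _)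
  have hs0 : (0 : ℝ) < p.s l := by exact_mod_cast hs1
  have hs1' : (1 : ℝ) ≤ p.s l := by exact_mod_cast hs1
  have hg := hp.gap_le l hl hlb
  have htail : a / √(p.s l) * costBound γ (p.s (l + 1)) ≤
      3 / 2 * a ^ 2 * √(p.s l * Real.log n) + γ * (a ^ 2 * Real.log n) := by
    have h1 := costBound_le_sqrt hγ htn
    have h2 : (p.s (l + 1) : ℝ) ≤ a * p.s l := hp.size_le l hl hlb
    have h3 : √(p.s (l + 1) * Real.log n) ≤ √(p.s l) * (a * Real.log n) := by
      rw [Real.sqrt_le_left (by positivity), mul_pow, Real.sq_sqrt hs0.le]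
      have h5 : 1 ≤ a * Real.log n := by nlinarith
      calc (p.s (l + 1) : ℝ) * Real.log n ≤ a * p.s l * Real.log n := by gcongr
        _ = p.s l * (a * Real.log n) := by ring
        _ ≤ p.s l * (a * Real.log n) ^ 2 := by
          gcongr
          nlinarith
    have h4 : √(p.s l : ℝ) ≤ √(p.s l * Real.log n) :=
      Real.sqrt_le_sqrt (le_mul_of_one_le_right hs0.le hL)
    have h6 : 0 < √(p.s l : ℝ) := Real.sqrt_pos.2 hs0
    calc a / √(p.s l) * costBound γ (p.s (l + 1))
        ≤ a / √(p.s l) * (3 / 2 * (a * p.s l) + γ * (√(p.s l) * (a * Real.log n))) := by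
          refine mul_le_mul_of_nonneg_left (h1.trans ?_) (by positivity)
          gcongr
      _ = 3 / 2 * a ^ 2 * √(p.s l) + γ * (a ^ 2 * Real.log n) := by
          have h7 : (p.s l : ℝ) = √(p.s l) * √(p.s l) := (Real.mul_self_sqrt hs0.le).symm
          have h8 : a / √(p.s l) * (3 / 2 * (a * p.s l)) = 3 / 2 * a ^ 2 * √(p.s l) := by
            rw [div_mul_eq_mul_div, div_eq_iff h6.ne']
            linear_combination 3 / 2 * a ^ 2 * h7
          rw [mul_add, h8]
          field_simp
      _ ≤ _ := by gcongr
  have hX1 : 1 ≤ √(p.s l * Real.log n) := by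
    rw [Real.one_le_sqrt]; nlinarith
  have h := step_cost_arith ha hγ hg hX1 hL htail
  linarith

theorem select_spec_of_goodPlan {plan : ℕ → Plan} {ncut : ℕ} {small : Finset ι → ℕ → Run ι}
    {X : Finset ι} (ha : 1 ≤ a) (hγ : 4 * (23 * a ^ 3 + 6) ≤ γ) (hgap : ∀ n s, 0 ≤ gap n s)
    (hp : GoodPlan α a X.card (plan X.card) gap) (hX : 3 ≤ X.card) (hcut : ncut < X.card)
    (hrec : SelectsBelow key (select key plan gap ncut small) (costBound γ) X.card)
    (hk : 1 ≤ k) (hkX : k ≤ X.card) (hlarge : 128 ≤ √(X.card : ℝ))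
    (hlarge' : 80 * a ^ 4 * Real.log X.card ≤ (X.card : ℝ) ^ (α / 2)) :
    (select key plan gap ncut small X k).AlmostSurely (IsKthSmallest key X k) ∧
      (select key plan gap ncut small X k).expectedComparisons ≤
        ENNReal.ofReal ((X.card : ℝ) + min (k : ℝ) ((X.card : ℝ) - k) +
          γ * √((X.card : ℝ) * Real.log X.card)) := by
  have ha0 : 0 < a := by linarith
  have hγ0 : 0 ≤ γ := le_trans (by positivity) hγ
  set n := X.card with hn
  set p := plan n with hpdef
  have hL := one_le_log_natCast hX
  have hnpos : (0 : ℝ) < n := by exact_mod_cast (by omega : 0 < n)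
  set μ : ℝ := min ((k : ℝ) / n) (1 - (k : ℝ) / n) with hμ
  have hkn : (k : ℝ) / n ≤ 1 := (div_le_one hnpos).2 (by exact_mod_cast hkX)
  have hμ0 : 0 ≤ μ := le_min (by positivity) (by linarith)
  set K : ℕ → ℝ := fun l => ((p.s (l + 1) : ℝ) - p.s l) * (1 + μ) +
    (23 * a ^ 2 + γ / (4 * a)) * √(p.s l * Real.log n) + γ * (20 * a ^ 3 * Real.log n) with hK
  obtain ⟨h1, h2⟩ := select_spec (K := K) (costBound_nonneg hγ0) hgap (by omega) hcut hp.valid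
    hrec hk hkX fun l hl hlb W _ hW => sum_stepBound_le ha hγ0 hgap hp hX hk hkX hl hlb hW
  refine ⟨h1, h2.trans ?_⟩
  have hK0 : ∀ j ∈ Finset.range p.lbar, 0 ≤ K (1 + j) := by
    intro j hj
    have hmono : (p.s (1 + j) : ℝ) ≤ p.s (1 + j + 1) := by
      exact_mod_cast hp.valid.mono (1 + j) (by omega) (by have := Finset.mem_range.1 hj; omega)
    have : 0 ≤ (p.s (1 + j + 1) : ℝ) - p.s (1 + j) := by linarith
    simp only [hK]
    positivity
  have hB0 := costBound_nonneg hγ0 (p.s 1)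
  rw [← ENNReal.ofReal_sum_of_nonneg hK0, ← ENNReal.ofReal_add hB0 hB0,
    ← ENNReal.ofReal_add (by positivity) (Finset.sum_nonneg hK0)]
  refine ENNReal.ofReal_le_ofReal ?_
  have hsqrtL : √(n : ℝ) ≤ √(n * Real.log n) :=
    Real.sqrt_le_sqrt (le_mul_of_one_le_right hnpos.le hL)
  set Y : ℝ := √(n * Real.log n) with hY
  have hY0 : 0 ≤ Y := Real.sqrt_nonneg _
  -- the first sample is of size `O(√n)`
  have hfirst : costBound γ (p.s 1) ≤ 3 * Y + γ / 8 * Y := by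
    have h3 := costBound_le_sqrt hγ0 hp.valid.lt.le
    have h4 : √(p.s 1 * Real.log n) ≤ Y / 8 := by
      rw [Real.sqrt_le_left (by positivity), div_pow, hY, Real.sq_sqrt (by positivity),
        le_div_iff₀ (by norm_num)]
      have h5 : (n : ℝ) = √n * √n := (Real.mul_self_sqrt hnpos.le).symm
      have h6 : (p.s 1 : ℝ) * 8 ^ 2 ≤ n := by
        have := hp.first_le
        nlinarith
      nlinarith
    have h5 := hp.first_le
    have := mul_le_mul_of_nonneg_left h4 hγ0
    linarith
  have htel : ∑ j ∈ Finset.range p.lbar, ((p.s (1 + j + 1) : ℝ) - p.s (1 + j)) =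
      n - p.s 1 := by
    have := Finset.sum_range_sub (fun j => (p.s (1 + j) : ℝ)) p.lbar
    simp only [add_zero] at this
    rw [add_comm 1 p.lbar, hp.valid.last] at this
    exact this
  have hsqrt : ∑ j ∈ Finset.range p.lbar, √(p.s (1 + j) * Real.log n) ≤ a * Y := by
    have h3 : ∀ j, √(p.s (1 + j) * Real.log n) = √(p.s (1 + j) : ℝ) * √(Real.log n) :=
      fun j => Real.sqrt_mul (Nat.cast_nonneg _) _
    simp only [h3]
    rw [← Finset.sum_mul, hY, Real.sqrt_mul hnpos.le, ← mul_assoc]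
    exact mul_le_mul_of_nonneg_right hp.sum_sqrt_le (Real.sqrt_nonneg _)
  have hlbar : p.lbar * (20 * a ^ 3 * Real.log n) ≤ Y / 4 := by
    have h3 : (n : ℝ) ^ (1 / 2 - α / 2) * (n : ℝ) ^ (α / 2) = √n := by
      rw [← Real.rpow_add hnpos, Real.sqrt_eq_rpow]; congr 1; ring
    calc p.lbar * (20 * a ^ 3 * Real.log n)
        ≤ a * (n : ℝ) ^ (1 / 2 - α / 2) * (20 * a ^ 3 * Real.log n) := by
          gcongr
          exact hp.lbar_le
      _ = (n : ℝ) ^ (1 / 2 - α / 2) * (80 * a ^ 4 * Real.log n) / 4 := by ring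
      _ ≤ (n : ℝ) ^ (1 / 2 - α / 2) * (n : ℝ) ^ (α / 2) / 4 := by gcongr
      _ ≤ Y / 4 := by rw [h3]; gcongr
  have hsum : ∑ j ∈ Finset.range p.lbar, K (1 + j) =
      (n - p.s 1) * (1 + μ) + (23 * a ^ 2 + γ / (4 * a)) *
        ∑ j ∈ Finset.range p.lbar, √(p.s (1 + j) * Real.log n) +
      γ * (p.lbar * (20 * a ^ 3 * Real.log n)) := by
    simp only [hK]
    rw [Finset.sum_add_distrib, Finset.sum_add_distrib, ← Finset.sum_mul, htel, ← Finset.mul_sum,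
      Finset.sum_const, Finset.card_range, nsmul_eq_mul]
    ring
  have hmin : n * μ = min (k : ℝ) (n - k) := by
    rw [hμ, mul_min_of_nonneg _ _ hnpos.le, mul_sub, mul_div_cancel₀ _ hnpos.ne', mul_one]
  have hs0 : (0 : ℝ) ≤ p.s 1 := Nat.cast_nonneg _
  have hmid : (23 * a ^ 2 + γ / (4 * a)) *
      ∑ j ∈ Finset.range p.lbar, √(p.s (1 + j) * Real.log n) ≤ 23 * a ^ 3 * Y + γ / 4 * Y := by
    refine (mul_le_mul_of_nonneg_left hsqrt (by positivity)).trans (le_of_eq ?_)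
    field_simp
  have hlb := mul_le_mul_of_nonneg_left hlbar hγ0
  have hY4 := mul_le_mul_of_nonneg_right hγ hY0
  rw [hsum, ← hmin]
  have hlead : ((n : ℝ) - p.s 1) * (1 + μ) ≤ n + n * μ := by nlinarith
  linarith

end Induction

/-! ### Small inputs -/

section Small

variable {α r η Ccut : ℝ} {ncut : ℕ}

theorem expectedComparisons_ret {A : Type} (a : A) : (Run.ret a).expectedComparisons = 0 := by
  rw [Run.expectedComparisons_eq_costThen, Run.costThen_ret]

theorem select_one_spec {ι : Type} [DecidableEq ι] {T : Type*} [LinearOrder T] (key : ι → T)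
    (plan : ℕ → Plan) (gap : ℕ → ℕ → ℝ) (ncut : ℕ) (small : Finset ι → ℕ → Run ι) {X : Finset ι}
    {k : ℕ} (hX : X.card = 1) (hk : 1 ≤ k) (hkX : k ≤ X.card) :
    (select key plan gap ncut small X k).AlmostSurely (IsKthSmallest key X k) ∧
      (select key plan gap ncut small X k).expectedComparisons = 0 := by
  have h := (Finset.card_eq_one.mp hX).choose_spec
  rw [select, dif_pos hX]
  generalize (Finset.card_eq_one.mp hX).choose = y at h
  refine ⟨Run.almostSurely_ret ?_, expectedComparisons_ret _⟩
  obtain rfl : k = 1 := by omega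
  subst h
  refine ⟨Finset.mem_singleton_self _, ?_, ?_⟩
  · rw [Finset.filter_singleton, if_neg (lt_irrefl _)]
    simp
  · rw [Finset.filter_singleton, if_pos le_rfl]
    simp

/-- Inputs of bounded size need a bounded expected number of comparisons, uniformly in the sample
sizes and gaps: the number of iterations and the size of the recursive calls are bounded. -/
theorem exists_select_bound (hα : 0 < α) (hα' : α ≤ 1 / 2) (hr : 1 < r) (N : ℕ) :
    ∃ c : ℝ, 0 ≤ c ∧ ∀ (plan : ℕ → Plan) (gap : ℕ → ℕ → ℝ),
      (∀ n, 2 ≤ n → Admissible α r η n (plan n)) → (∀ n s, 0 ≤ gap n s) →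
      ∀ (ι : Type) [DecidableEq ι] (T : Type*) [LinearOrder T] (key : ι → T)
        (small : Finset ι → ℕ → Run ι), IsSmallSelect key ncut Ccut small →
        ∀ (X : Finset ι) (k : ℕ), X.card ≤ N → 1 ≤ k → k ≤ X.card →
          (select key plan gap ncut small X k).AlmostSurely (IsKthSmallest key X k) ∧
          (select key plan gap ncut small X k).expectedComparisons ≤ ENNReal.ofReal c := by
  induction N with
  | zero => exact ⟨0, le_rfl, fun _ _ _ _ _ _ _ _ _ _ _ X k h1 h2 h3 => by omega⟩
  | succ N ih =>
    obtain ⟨c, hc, ih⟩ := ih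
    obtain ⟨m, hm⟩ := pow_unbounded_of_one_lt ((N : ℝ) + 1) (one_lt_pow₀ hr two_ne_zero)
    rw [← pow_mul] at hm
    set K : ℝ := 2 * ((N : ℝ) + 1) + 3 * c + 3 * c with hK
    have hK0 : 0 ≤ K := by positivity
    have hmK : 0 ≤ m * K := by positivity
    refine ⟨c + |Ccut| + (c + m * K), by positivity, ?_⟩
    intro plan gap hplan hgap ι _ T _ key small hsmall X k hXN hk hkX
    have hbig : ∀ x : ℝ, x ≤ c ∨ x ≤ |Ccut| ∨ x ≤ c + c + m * K →
        ENNReal.ofReal x ≤ ENNReal.ofReal (c + |Ccut| + (c + m * K)) := by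
      intro x hx
      refine ENNReal.ofReal_le_ofReal ?_
      have := abs_nonneg Ccut
      rcases hx with hx | hx | hx <;> linarith
    have ih' := ih plan gap hplan hgap ι T key small hsmall
    rcases hXN.lt_or_eq with hlt | heq
    · obtain ⟨h1, h2⟩ := ih' X k (by omega) hk hkX
      exact ⟨h1, h2.trans (hbig _ (Or.inl le_rfl))⟩
    by_cases hX1 : X.card = 1
    · obtain ⟨h1, h2⟩ := select_one_spec key plan gap ncut small hX1 hk hkX
      exact ⟨h1, h2.le.trans zero_le⟩
    by_cases hXcut : X.card ≤ ncut
    · rw [select, dif_neg hX1, if_pos hXcut]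
      obtain ⟨h1, h2⟩ := hsmall X k (by omega) hXcut hk hkX
      exact ⟨h1, h2.trans (hbig _ (Or.inr (Or.inl (le_abs_self _))))⟩
    have hX2 : 2 ≤ X.card := by omega
    have hadm := hplan X.card hX2
    have hrec : SelectsBelow key (select key plan gap ncut small) (fun _ => c) X.card :=
      fun Y hY i h1 h2 => ih' Y i (by omega) h1 h2
    have hfind : ∀ S W : Finset ι, ∀ i j q,
        findBound (fun _ => c) key S i j W q ≤ 3 * c := by
      intro S W i j q
      unfold findBound
      split_ifs <;> linarith
    obtain ⟨h1, h2⟩ := select_spec (K := fun _ => K) (B := fun _ => c) (fun _ => hc) hgap hX2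
      (by omega) (hadm.validPlan hα hα' hr hX2) hrec hk hkX (by
        intro l hl hlb W hWX hW
        rw [← hW, ← Finset.card_powersetCard, ← nsmul_eq_mul]
        refine Finset.sum_le_card_nsmul _ _ _ fun S hS => ?_
        unfold stepBound
        refine add_le_add (add_le_add ?_ (hfind ..)) (hfind ..)
        have hcard : ((W \ S).card : ℝ) ≤ (N : ℝ) + 1 := by
          have := (Finset.card_le_card (Finset.sdiff_subset (s := W) (t := S))).trans
            (Finset.card_le_card hWX)
          rw [heq] at this
          exact_mod_cast this
        have hsub : ∀ P : ι → Prop, ∀ [DecidablePred P],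
            (({z ∈ W \ S | P z}.card : ℕ) : ℝ) ≤ (W \ S).card := by
          intro P _
          exact_mod_cast Finset.card_le_card (Finset.filter_subset _ _)
        unfold partitionBound lowerPart upperPart
        split_ifs
        · linarith [hsub fun z => {w ∈ S | key w ≤ key z}.card < iv gap X.card k (plan X.card) l]
        · linarith [hsub fun z => iu gap X.card k (plan X.card) l ≤ {w ∈ S | key w < key z}.card])
    refine ⟨h1, h2.trans (le_trans ?_ (hbig (c + c + m * K) (Or.inr (Or.inr le_rfl))))⟩
    rw [Finset.sum_const, Finset.card_range, nsmul_eq_mul, ENNReal.ofReal_add (by positivity) hmK,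
      ENNReal.ofReal_add hc hc, ENNReal.ofReal_mul (by positivity), ENNReal.ofReal_natCast]
    gcongr
    refine hadm.lbar_le hα hr hX2 ?_
    rw [heq]
    push_cast
    exact hm.le

end Small

theorem one_le_sqrt_mul_log {n : ℕ} (hn : 2 ≤ n) : 1 ≤ √((n : ℝ) * Real.log n) := by
  rw [Real.one_le_sqrt]
  have h : (2 : ℝ) ≤ n := by exact_mod_cast hn
  have h1 : Real.log 2 ≤ Real.log n := Real.log_le_log (by norm_num) h
  nlinarith [Real.log_two_gt_d9]

end FloydRivest

theorem theorem4p1 (α r β η Ccut : ℝ) (ncut : ℕ) (hα : 0 < α) (hα' : α ≤ 1 / 2) (hr : 1 < r)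
    (hη : 1 / r ^ 2 < η) (hη' : η ≤ 1) :
    ∃ γ : ℝ, 0 < γ ∧
      ∀ (plan : ℕ → FloydRivest.Plan) (gap : ℕ → ℕ → ℝ),
        ((∀ n, 2 ≤ n → FloydRivest.NonroundedSizes α r n (plan n)) ∨
          (∀ n, 2 ≤ n → FloydRivest.RoundedSizes α r n (plan n)) ∨
          (∀ n, 2 ≤ n → FloydRivest.ReducedRoundedSizes α r η n (plan n))) →
        ((gap = FloydRivest.gapN β ∧ 1 / (4 * (1 - 1 / r) ^ 2) ≤ β) ∨
          (gap = FloydRivest.gapS β ∧ 1 / (4 * (1 - 1 / r) ^ 2) < β)) →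
        ∀ (T : Type*) [LinearOrder T] (n : ℕ) (x : Fin n → T)
          (small : Finset (Fin n) → ℕ → FloydRivest.Run (Fin n)),
          FloydRivest.IsSmallSelect x ncut Ccut small →
          ∀ k : ℕ, 1 ≤ k → k ≤ n →
            (FloydRivest.select x plan gap ncut small Finset.univ k).expectedComparisons ≤
              ENNReal.ofReal ((n : ℝ) + min (k : ℝ) ((n : ℝ) - k) +
                γ * √((n : ℝ) * Real.log n)) := by
  by_cases hβ : 1 / (4 * (1 - 1 / r) ^ 2) ≤ β
  swap
  · refine ⟨1, one_pos, fun plan gap _ hgap => absurd ?_ hβ⟩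
    rcases hgap with h | h
    · exact h.2
    · exact h.2.le
  obtain ⟨a, ha, hgood⟩ := FloydRivest.eventually_goodPlan (η := η) hα hα' hr hβ
  have hev : ∀ᶠ n : ℕ in Filter.atTop, 128 ≤ √(n : ℝ) ∧
      80 * a ^ 4 * Real.log n ≤ (n : ℝ) ^ (α / 2) ∧ 3 ≤ n ∧ ncut < n := by
    filter_upwards [(Real.tendsto_sqrt_atTop.comp
        (tendsto_natCast_atTop_atTop (R := ℝ))).eventually_ge_atTop 128,
      FloydRivest.eventually_log_le_rpow (half_pos hα)
        (show 0 < 1 / (80 * a ^ 4) by positivity),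
      Filter.eventually_ge_atTop 3, Filter.eventually_gt_atTop ncut] with n h1 h2 h3 h4
    refine ⟨h1, ?_, h3, h4⟩
    rw [div_mul_eq_mul_div, one_mul, le_div_iff₀ (by positivity)] at h2
    linarith
  obtain ⟨N, hN⟩ := Filter.eventually_atTop.1 (hgood.and hev)
  obtain ⟨c, hc, hsmallsize⟩ := FloydRivest.exists_select_bound (η := η) (Ccut := Ccut)
    (ncut := ncut) hα hα' hr N
  set γ : ℝ := 4 * (23 * a ^ 3 + 6) + c with hγ
  have ha0 : 0 < a := by linarith
  have hγ0 : 0 < γ := by positivity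
  refine ⟨γ, hγ0, fun plan gap hplan hgap T _ n x small hsmall k hk hkn => ?_⟩
  have hplan' : ∀ n, 2 ≤ n → FloydRivest.Admissible α r η n (plan n) := by
    intro n hn
    rcases hplan with h | h | h
    · exact Or.inl (h n hn)
    · exact Or.inr (Or.inl (h n hn))
    · exact Or.inr (Or.inr (h n hn))
  have hgap' : ∀ n s, 0 ≤ gap n s := FloydRivest.GapRule.nonneg hgap
  have main : ∀ (m : ℕ) (X : Finset (Fin n)) (k : ℕ), X.card = m → 1 ≤ k → k ≤ X.card →
      (FloydRivest.select x plan gap ncut small X k).AlmostSurely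
        (FloydRivest.IsKthSmallest x X k) ∧
      (FloydRivest.select x plan gap ncut small X k).expectedComparisons ≤
        ENNReal.ofReal ((X.card : ℝ) + min (k : ℝ) ((X.card : ℝ) - k) +
          γ * √((X.card : ℝ) * Real.log X.card)) := by
    intro m
    induction m using Nat.strong_induction_on with
    | _ m ih =>
      intro X k hXm hk hkX
      rcases lt_or_ge X.card N with hXN | hXN
      · obtain ⟨h1, h2⟩ := hsmallsize plan gap hplan' hgap' (Fin n) T x small hsmall X k hXN.le
          hk hkX
        refine ⟨h1, ?_⟩
        by_cases hX1 : X.card = 1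
        · rw [(FloydRivest.select_one_spec x plan gap ncut small hX1 hk hkX).2]
          exact zero_le
        · refine h2.trans (ENNReal.ofReal_le_ofReal ?_)
          have h3 := FloydRivest.one_le_sqrt_mul_log (show 2 ≤ X.card by omega)
          have h4 : (k : ℝ) ≤ X.card := by exact_mod_cast hkX
          have h5 : 0 ≤ min (k : ℝ) ((X.card : ℝ) - k) :=
            le_min (Nat.cast_nonneg _) (by linarith)
          have h6 : c ≤ γ := by rw [hγ]; linarith [pow_pos ha0 3]
          have h7 : γ ≤ γ * √((X.card : ℝ) * Real.log X.card) :=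
            le_mul_of_one_le_right hγ0.le h3
          have h8 : (0 : ℝ) ≤ X.card := Nat.cast_nonneg _
          linarith
      · obtain ⟨hg, h1, h2, h3, h4⟩ := hN X.card hXN
        refine FloydRivest.select_spec_of_goodPlan ha (by linarith) hgap'
          (hg _ gap (hplan' _ (by omega)) hgap) h3 h4 ?_ hk hkX h1 h2
        intro Y hY i hi hiY
        obtain ⟨h5, h6⟩ := ih Y.card (by omega) Y i rfl hi hiY
        refine ⟨h5, h6.trans (ENNReal.ofReal_le_ofReal ?_)⟩
        unfold FloydRivest.costBound
        have h7 : min (i : ℝ) ((Y.card : ℝ) - i) ≤ Y.card / 2 := by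
          rcases le_total (i : ℝ) (Y.card / 2) with h | h
          · exact (min_le_left _ _).trans h
          · exact (min_le_right _ _).trans (by linarith)
        linarith
  have h := (main _ Finset.univ k rfl hk (by simpa using hkn)).2
  simpa only [Finset.card_univ, Fintype.card_fin] using h
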